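/- Write $\mathbb{T}=\mathbb{R}/2\pi\mathbb{Z}$, $\mathcal{H}=L^2([0,\pi]\times\mathbb{T})$ with inner product $\langle\cdot,\cdot\rangle$ and norm $\|\cdot\|$, and $\Box u=u_{tt}-u_{ss}$, $u^+=\max\{u,0\}$, $u^-=\max\{-u,0\}$. For integers $m\ge 1$, $n\ge 0$ let $\phi_{(m,n)}=\frac{\sqrt2}{\pi}\sin(ms)\cos(nt)$ and $\psi_{(m,n)}=\frac{\sqrt2}{\pi}\sin(ms)\sin(nt)$; these are eigenfunctions of $\Box$ with Dirichlet conditions at $s=0,\pi$, with eigenvalue $m^2-n^2$. Let $\cdots<\lambda_{-1}<\lambda_0=0<\lambda_1<\cdots$ be the values $m^2-n^2$ in increasing order. Let $\mathcal{R}$ and $\mathcal{N}$ be the closed spans in $\mathcal{H}$ of the eigenfunctions with $m\ne n$ and with $m=n$ respectively, and let $\mathcal{H}^1$ be the set of $x\in\mathcal{R}\cap H^1([0,\pi]\times\mathbb{T})$ with zero trace at $s=0$ and $s=\pi$. **Weak solutions.** For $p:[0,\pi]\times\mathbb{T}\times\mathbb{R}\to\mathbb{R}$ and $P(s,t,u)=\int_0^u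 p(s,t,\tau)\,d\tau$, a weak solution of $$\Box u=au^+-bu^-+p(s,t,u)\ \text{ in } ]0,\pi[\times\mathbb{T},\qquad u(0,t)=u(\pi,t)=0,\qquad(1)$$ is a function $u=x+y$ for which $(x,y)\in\mathcal{H}^1\times\mathcal{N}$ is a critical point of $$\tfrac12\left(\|x_s\|^2-\|x_t\|^2-a\|(x+y)^+\|^2-b\|(x+y)^-\|^2\right)-\iint P(s,t,x+y)\,ds\,dt .$$ **The curve $\mathcal{C}_k$.** Let $\lambda_k\neq0$. Call $(\varepsilon_1,\varepsilon_2)$ admissible if $0<\varepsilon_1<\lambda_k-\lambda_{k-1}$ and $0<\varepsilon_2<\frac{1}{\lambda_k-p_k}-\max\{0,-\frac1{p_k}\}$, where $p_k=\lambda_{k-1}+\varepsilon_1$. Put $\mu=\max\{0,-\frac1{p_k}\}+\varepsilon_2$, $q_k=p_k+\frac1\mu$, $Q_k=\,]p_k,q_k[^2$. Let $L:\mathcal{H}\to\mathcal{H}$ be the bounded operator with $Le=(m^2-n^2-p_k)^{-1}e$ for $e=\phi_{(m,n)},\psi_{(m,n)}$. For $r>0$ let $$\check a(r)=\sup_{v\in\mathcal{H},\,v\ne0}\frac{\langle(L-\mu)v,v\rangle}{\|v^+\|^2+r\|v^-\|^2},$$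 and let $\mathcal{C}_k\subset Q_k$ be the curve of the points $\left(p_k+\frac1{\check a(r)+\mu},\,p_k+\frac1{r\check a(r)+\mu}\right)$, $r>0$. (The curves for different admissible pairs agree on the intersection of the squares.) Let $\check Q_k=\,]\lambda_{k-1},+\infty[^2$ if $\lambda_k>0$ and $\check Q_k=\,]\lambda_{k-1},0[^2$ if $\lambda_k<0$. A point of $\check Q_k$ is below $\mathcal{C}_k$ if, for some admissible $(\varepsilon_1,\varepsilon_2)$, it lies in the connected component of $Q_k\setminus\mathcal{C}_k$ that contains $]p_k,\lambda_k[^2$. **Theorem.** Let $\lambda_k\ne0$, let $(a,b)\in\check Q_k$ lie below $\mathcal{C}_k$, and let $p:[0,\pi]\times\mathbb{T}\times\mathbb{R}\to\mathbb{R}$ be continuous with $p(s,t,u)/u\to0$ as $|u|\to\infty$, uniformly in $(s,t)$. Assume that, with increasing and decreasing meant in the wide sense: - (H1) there is $\underline\varepsilon_0>0$ such that for each $(s,t)$ the map $u\mapsto au^+-bu^-+p(s,t,u)-(\lambda_{k-1}+\underline\varepsilon_0)u$ is increasing; - (H2) if $\lambda_k>0$, there is $\overline\varepsilon_0>0$ such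 that for each $(s,t)$ the map $u\mapsto p(s,t,u)-\frac1{\overline\varepsilon_0}u$ is decreasing; - (H3) if $\lambda_k<0$, there is $\overline\varepsilon_0>0$ such that for each $(s,t)$ the map $u\mapsto au^+-bu^-+p(s,t,u)+\overline\varepsilon_0u$ is decreasing. Then problem (1) has a weak solution. Moreover, there are admissible $(\varepsilon_1,\varepsilon_2)$ with $(a,b)\in Q_k$ such that for each $(s,t)$ the map $u\mapsto au^+-bu^-+p(s,t,u)-p_ku$ is strictly increasing and $u\mapsto au^+-bu^-+p(s,t,u)-q_ku$ is strictly decreasing; and for every such choice, with $$J(s,t,u)=\tfrac12(a-p_k)(u^+)^2+\tfrac12(b-p_k)(u^-)^2+P(s,t,u),\qquad J^*(s,t,v)=\sup_{u\in\mathbb{R}}\,[vu-J(s,t,u)],$$ the functional $$I(v)=\tfrac12\langle(L-\mu)v,v\rangle-\iint\left[J^*(s,t,v)-\tfrac\mu2v^2\right]ds\,dt$$ has an absolute maximum on $\mathcal{H}$, and for every maximum point $v_0$ of $I$ the function $u_0=Lv_0$ is a weak solution of (1). -/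

import Mathlib

open MeasureTheory Set

noncomputable section

namespace FucikWave

/-! ### The space `L²([0,π] × 𝕋)`, `𝕋 = ℝ/2πℤ`

Functions on the cylinder `[0,π] × 𝕋` are functions of `(s,t)` on the fundamental domain
`[0,π] × [0,2π]`; continuous objects on the cylinder are `2π`-periodic in `t`. -/

/-- Lebesgue measure on the cylinder. -/
def cyl : Measure (ℝ × ℝ) :=
  volume.restrict (Icc (0 : ℝ) Real.pi ×ˢ Icc (0 : ℝ) (2 * Real.pi))

/-- The Hilbert space `𝓗 = L²([0,π] × 𝕋)`. -/
abbrev HSpace : Type := Lp ℝ 2 cyl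

instance : IsFiniteMeasure cyl := by
  refine ⟨?_⟩
  rw [cyl, Measure.restrict_apply_univ]
  exact (isCompact_Icc.prod isCompact_Icc).measure_lt_top

lemma memLp_of_continuous {h : ℝ × ℝ → ℝ} (hh : Continuous h) : MemLp h 2 cyl := by
  have hK : IsCompact (Icc (0 : ℝ) Real.pi ×ˢ Icc (0 : ℝ) (2 * Real.pi)) :=
    isCompact_Icc.prod isCompact_Icc
  obtain ⟨C, hC⟩ := hK.exists_bound_of_continuousOn hh.continuousOn
  refine MemLp.of_bound hh.aestronglyMeasurable C ?_
  rw [cyl, ae_restrict_iff' hK.measurableSet]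
  exact Filter.Eventually.of_forall hC

lemma integrable_mul (u : HSpace) {h : ℝ × ℝ → ℝ} (hh : Continuous h) :
    Integrable (fun z => u z * h z) cyl :=
  (Lp.memLp u).integrable_mul (memLp_of_continuous hh)

/-! ### Eigenfunctions and eigenvalues of the wave operator -/

/-- `φ_{(m,n)}(s,t) = (√2/π) sin(ms) cos(nt)`. -/
def phi (m n : ℕ) : HSpace :=
  (memLp_of_continuous (h := fun z : ℝ × ℝ =>
    Real.sqrt 2 / Real.pi * (Real.sin (m * z.1) * Real.cos (n * z.2))) (by fun_prop)).toLp _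

/-- `ψ_{(m,n)}(s,t) = (√2/π) sin(ms) sin(nt)`. -/
def psi (m n : ℕ) : HSpace :=
  (memLp_of_continuous (h := fun z : ℝ × ℝ =>
    Real.sqrt 2 / Real.pi * (Real.sin (m * z.1) * Real.sin (n * z.2))) (by fun_prop)).toLp _

/-- The eigenvalues `m² - n²`, `m ≥ 1`, `n ≥ 0`. -/
def eigenvalues : Set ℤ := {l | ∃ m n : ℕ, 1 ≤ m ∧ l = (m : ℤ) ^ 2 - (n : ℤ) ^ 2}

open Classical in
/-- The eigenvalues in increasing order, `… < λ₋₁ < λ₀ = 0 < λ₁ < …`: for `n ≥ 0`, `λ_n` is the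
`n`-th element (counted from `0`) of the eigenvalues in `[0, ∞)`, and `-λ_{-n}` is the `n`-th
natural number `j` for which `-j` is an eigenvalue. -/
def lam : ℤ → ℝ
  | Int.ofNat n => (Nat.nth (fun j : ℕ => (j : ℤ) ∈ eigenvalues) n : ℝ)
  | Int.negSucc n => -(Nat.nth (fun j : ℕ => -(j : ℤ) ∈ eigenvalues) (n + 1) : ℝ)

/-- `𝓡`, the closed span of the `φ_{(m,n)}, ψ_{(m,n)}` with `m ≥ 1`, `n ≥ 0`, `m ≠ n`. -/
def RSpace : Submodule ℝ HSpace :=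
  (Submodule.span ℝ {w | ∃ m n : ℕ, 1 ≤ m ∧ m ≠ n ∧ (w = phi m n ∨ w = psi m n)}).topologicalClosure

/-- `𝓝`, the closed span of the `φ_{(l,l)}, ψ_{(l,l)}` with `l ≥ 1`. -/
def NSpace : Submodule ℝ HSpace :=
  (Submodule.span ℝ {w | ∃ l : ℕ, 1 ≤ l ∧ (w = phi l l ∨ w = psi l l)}).topologicalClosure

/-! ### The energy space `𝓗¹ × 𝓝` -/

/-- Test functions: smooth functions on the closed cylinder, with no boundary condition. -/
def IsTest (g : ℝ × ℝ → ℝ) : Prop :=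
  ContDiff ℝ (⊤ : ℕ∞) g ∧ ∀ s t : ℝ, g (s, t + 2 * Real.pi) = g (s, t)

lemma IsTest.continuous_fderiv_apply {g : ℝ × ℝ → ℝ} (hg : IsTest g) (e : ℝ × ℝ) :
    Continuous (fun z => fderiv ℝ g z e) :=
  (hg.1.continuous_fderiv (by simp)).clm_apply continuous_const

/-- `y` is the weak derivative of `x` in the direction `e`, and the boundary term vanishes: as the
test functions are arbitrary at `s = 0` and `s = π`, for `e = (1,0)` the identity says that `x` has
weak derivative `x_s = y` in the interior and that its trace on `s = 0`, `s = π` is zero. -/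
def HasWeakDeriv (e : ℝ × ℝ) (x y : HSpace) : Prop :=
  ∀ g : ℝ × ℝ → ℝ, IsTest g → ∫ z, x z * fderiv ℝ g z e ∂cyl = -∫ z, y z * g z ∂cyl

lemma integral_add_mul (x y : HSpace) {h : ℝ × ℝ → ℝ} (hh : Continuous h) :
    ∫ z, (x + y : HSpace) z * h z ∂cyl = ∫ z, x z * h z ∂cyl + ∫ z, y z * h z ∂cyl := by
  rw [← integral_add (integrable_mul x hh) (integrable_mul y hh)]
  refine integral_congr_ae ?_
  filter_upwards [Lp.coeFn_add x y] with z hz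
  rw [hz, Pi.add_apply, add_mul]

lemma integral_smul_mul (c : ℝ) (x : HSpace) (h : ℝ × ℝ → ℝ) :
    ∫ z, (c • x : HSpace) z * h z ∂cyl = c * ∫ z, x z * h z ∂cyl := by
  rw [← integral_const_mul]
  refine integral_congr_ae ?_
  filter_upwards [Lp.coeFn_smul c x] with z hz
  rw [hz, Pi.smul_apply, smul_eq_mul, mul_assoc]

lemma HasWeakDeriv.add {e : ℝ × ℝ} {x y x' y' : HSpace} (h : HasWeakDeriv e x y)
    (h' : HasWeakDeriv e x' y') : HasWeakDeriv e (x + x') (y + y') := by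
  intro g hg
  rw [integral_add_mul _ _ (hg.continuous_fderiv_apply e), integral_add_mul _ _ hg.1.continuous,
    h g hg, h' g hg]
  ring

lemma HasWeakDeriv.smul {e : ℝ × ℝ} {x y : HSpace} (c : ℝ) (h : HasWeakDeriv e x y) :
    HasWeakDeriv e (c • x) (c • y) := by
  intro g hg
  rw [integral_smul_mul, integral_smul_mul, h g hg]
  ring

lemma HasWeakDeriv.zero (e : ℝ × ℝ) : HasWeakDeriv e 0 0 := by
  simpa using HasWeakDeriv.smul 0
    (fun g _ => by
      have h0 : ∀ h : ℝ × ℝ → ℝ, ∫ z, (0 : HSpace) z * h z ∂cyl = 0 := fun h => by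
        simpa using integral_smul_mul 0 0 h
      rw [h0, h0, neg_zero] : HasWeakDeriv e 0 0)

/-- `𝓗¹`: the elements `x` of `𝓡` that belong to `H¹([0,π] × 𝕋)` and vanish at `s = 0` and `s = π`.
Such an `x` is stored as the triple `(x, x_s, x_t)` (the weak derivatives are determined by `x`),
so that the norm of the product is equivalent to the `H¹` norm. -/
def H1Space : Submodule ℝ (HSpace × HSpace × HSpace) where
  carrier := {X | X.1 ∈ RSpace ∧ HasWeakDeriv (1, 0) X.1 X.2.1 ∧ HasWeakDeriv (0, 1) X.1 X.2.2}
  add_mem' := fun hX hY => ⟨add_mem hX.1 hY.1, hX.2.1.add hY.2.1, hX.2.2.add hY.2.2⟩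
  zero_mem' := ⟨zero_mem _, HasWeakDeriv.zero _, HasWeakDeriv.zero _⟩
  smul_mem' := fun c _ hX => ⟨RSpace.smul_mem c hX.1, hX.2.1.smul c, hX.2.2.smul c⟩

/-! ### Weak solutions of `u_tt - u_ss = a u⁺ - b u⁻ + p(s,t,u)` -/

/-- `P(s,t,u) = ∫₀ᵘ p(s,t,τ) dτ`. -/
def primP (p : ℝ → ℝ → ℝ → ℝ) (s t u : ℝ) : ℝ := ∫ τ in (0 : ℝ)..u, p s t τ

/-- The energy `½(‖x_s‖² - ‖x_t‖² - a‖(x+y)⁺‖² - b‖(x+y)⁻‖²) - ∬ P(s,t,x+y)` on `𝓗¹ × 𝓝`. -/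
def energy (a b : ℝ) (p : ℝ → ℝ → ℝ → ℝ) (w : H1Space × NSpace) : ℝ :=
  let x : HSpace := w.1.1.1
  let xs : HSpace := w.1.1.2.1
  let xt : HSpace := w.1.1.2.2
  let u : HSpace := x + w.2.1
  1 / 2 * (‖xs‖ ^ 2 - ‖xt‖ ^ 2 - a * ‖Lp.posPart u‖ ^ 2 - b * ‖Lp.negPart u‖ ^ 2)
    - ∫ z, primP p z.1 z.2 (u z) ∂cyl

/-- `u = x + y` is a weak solution: `(x, y)` is a critical point of the energy. -/
def IsWeakSolution (a b : ℝ) (p : ℝ → ℝ → ℝ → ℝ) (u : HSpace) : Prop :=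
  ∃ w : H1Space × NSpace, u = w.1.1.1 + w.2.1 ∧
    HasFDerivAt (energy a b p) (0 : (H1Space × NSpace) →L[ℝ] ℝ) w

/-! ### The curve `𝓒_k` -/

/-- The inverse of `□ - d`, for `d` not an eigenvalue. The coefficient of `v` along an eigenfunction
`e` is `⟨e, v⟩/‖e‖²` (`φ_{(m,0)}` is not a unit vector, and `ψ_{(m,0)} = 0`). -/
def opL (d : ℝ) (v : HSpace) : HSpace :=
  ∑' i : ℕ+ × ℕ,
    ((inner ℝ (phi i.1 i.2) v / ‖phi i.1 i.2‖ ^ 2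
        / (((i.1 : ℕ) : ℝ) ^ 2 - (i.2 : ℝ) ^ 2 - d)) • phi i.1 i.2
      + (inner ℝ (psi i.1 i.2) v / ‖psi i.1 i.2‖ ^ 2
        / (((i.1 : ℕ) : ℝ) ^ 2 - (i.2 : ℝ) ^ 2 - d)) • psi i.1 i.2)

/-- `p_k = λ_{k-1} + ε₁`. -/
def pk (k : ℤ) (ε₁ : ℝ) : ℝ := lam (k - 1) + ε₁

/-- `μ = max{0, -1/(λ_{k-1} + ε₁)} + ε₂`. -/
def mu (k : ℤ) (ε₁ ε₂ : ℝ) : ℝ := max 0 (-1 / pk k ε₁) + ε₂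

/-- `q_k = λ_{k-1} + ε₁ + 1/μ`. -/
def qk (k : ℤ) (ε₁ ε₂ : ℝ) : ℝ := pk k ε₁ + 1 / mu k ε₁ ε₂

/-- The allowed range of the parameters `ε₁`, `ε₂`. -/
def Admissible (k : ℤ) (ε₁ ε₂ : ℝ) : Prop :=
  0 < ε₁ ∧ ε₁ < lam k - lam (k - 1) ∧
    0 < ε₂ ∧ ε₂ < 1 / (lam k - lam (k - 1) - ε₁) - max 0 (-1 / pk k ε₁)

/-- The square `Q_k = ]p_k, q_k[²`. -/
def Qk (k : ℤ) (ε₁ ε₂ : ℝ) : Set (ℝ × ℝ) :=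
  Ioo (pk k ε₁) (qk k ε₁ ε₂) ×ˢ Ioo (pk k ε₁) (qk k ε₁ ε₂)

/-- `Q̌_k = ]λ_{k-1}, ∞[²` if `λ_k > 0`, and `]λ_{k-1}, 0[²` otherwise. -/
def Qcheck (k : ℤ) : Set (ℝ × ℝ) :=
  {x | lam (k - 1) < x.1 ∧ lam (k - 1) < x.2 ∧ (lam k < 0 → x.1 < 0 ∧ x.2 < 0)}

/-- `F(v) = ⟨(L - μ)v, v⟩`. -/
def funF (k : ℤ) (ε₁ ε₂ : ℝ) (v : HSpace) : ℝ :=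
  inner ℝ (opL (pk k ε₁) v - mu k ε₁ ε₂ • v) v

/-- `G_r(v) = ‖v⁺‖² + r‖v⁻‖²`. -/
def funG (r : ℝ) (v : HSpace) : ℝ := ‖Lp.posPart v‖ ^ 2 + r * ‖Lp.negPart v‖ ^ 2

/-- `ǎ(r) = sup_{v ≠ 0} F(v)/G_r(v)`. -/
def acheck (k : ℤ) (ε₁ ε₂ r : ℝ) : ℝ :=
  ⨆ v : {v : HSpace // v ≠ 0}, funF k ε₁ ε₂ v.1 / funG r v.1

/-- The curve `𝓒_k` inside the square `Q_k(ε₁, ε₂)`. -/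
def Ck (k : ℤ) (ε₁ ε₂ : ℝ) : Set (ℝ × ℝ) :=
  (fun r : ℝ => (pk k ε₁ + 1 / (acheck k ε₁ ε₂ r + mu k ε₁ ε₂),
    pk k ε₁ + 1 / (r * acheck k ε₁ ε₂ r + mu k ε₁ ε₂))) '' Ioi 0

/-- `x` lies below `𝓒_k`: for some admissible `ε₁, ε₂`, the point `x` lies in `Q_k` and its
component in `Q_k ∖ 𝓒_k` is the one that contains `]p_k, λ_k[²`. (The curves for different
`ε₁, ε₂` agree where both are defined.) -/
def BelowCk (k : ℤ) (x : ℝ × ℝ) : Prop :=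
  ∃ ε₁ ε₂ : ℝ, Admissible k ε₁ ε₂ ∧
    Ioo (pk k ε₁) (lam k) ×ˢ Ioo (pk k ε₁) (lam k) ⊆
      connectedComponentIn (Qk k ε₁ ε₂ \ Ck k ε₁ ε₂) x

/-! ### The nonlinearity -/

/-- `p(s,t,u)/u → 0` as `|u| → ∞`, uniformly in `(s,t)`. -/
def SmallAtInfinity (p : ℝ → ℝ → ℝ → ℝ) : Prop :=
  ∀ ε > 0, ∃ M > 0, ∀ s ∈ Icc (0 : ℝ) Real.pi, ∀ t u : ℝ, M < |u| → |p s t u / u| < ε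

/-- The right-hand side `a u⁺ - b u⁻ + p(s,t,u)`. -/
def rhs (a b : ℝ) (p : ℝ → ℝ → ℝ → ℝ) (s t u : ℝ) : ℝ :=
  a * max u 0 - b * max (-u) 0 + p s t u

def H1 (k : ℤ) (a b : ℝ) (p : ℝ → ℝ → ℝ → ℝ) : Prop :=
  ∃ ε > 0, ∀ s ∈ Icc (0 : ℝ) Real.pi, ∀ t : ℝ,
    Monotone fun u => rhs a b p s t u - (lam (k - 1) + ε) * u

def H2 (k : ℤ) (p : ℝ → ℝ → ℝ → ℝ) : Prop :=
  0 < lam k → ∃ ε > 0, ∀ s ∈ Icc (0 : ℝ) Real.pi, ∀ t : ℝ,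
    Antitone fun u => p s t u - (1 / ε) * u

def H3 (k : ℤ) (a b : ℝ) (p : ℝ → ℝ → ℝ → ℝ) : Prop :=
  lam k < 0 → ∃ ε > 0, ∀ s ∈ Icc (0 : ℝ) Real.pi, ∀ t : ℝ,
    Antitone fun u => rhs a b p s t u + ε * u

/-! ### The dual functional -/

/-- The choice of `ε₁, ε₂` for the dual problem: admissible, with `(a,b) ∈ Q_k`, and such that
`u ↦ a u⁺ - b u⁻ + p - p_k u` is strictly increasing and `u ↦ a u⁺ - b u⁻ + p - q_k u` strictly
decreasing. -/
def Suitable (k : ℤ) (a b : ℝ) (p : ℝ → ℝ → ℝ → ℝ) (ε₁ ε₂ : ℝ) : Prop :=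
  Admissible k ε₁ ε₂ ∧ (a, b) ∈ Qk k ε₁ ε₂ ∧
    ∀ s ∈ Icc (0 : ℝ) Real.pi, ∀ t : ℝ,
      StrictMono (fun u => rhs a b p s t u - pk k ε₁ * u) ∧
      StrictAnti (fun u => rhs a b p s t u - qk k ε₁ ε₂ * u)

/-- `J = H + P` with `H(u) = ½(a - p_k)(u⁺)² + ½(b - p_k)(u⁻)²`. -/
def funJ (d a b : ℝ) (p : ℝ → ℝ → ℝ → ℝ) (s t u : ℝ) : ℝ :=
  1 / 2 * (a - d) * (max u 0) ^ 2 + 1 / 2 * (b - d) * (max (-u) 0) ^ 2 + primP p s t u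

/-- The Fenchel–Legendre transform `J*(s,t,·)` of `J(s,t,·)`. -/
def funJstar (d a b : ℝ) (p : ℝ → ℝ → ℝ → ℝ) (s t v : ℝ) : ℝ :=
  ⨆ u : ℝ, (v * u - funJ d a b p s t u)

/-- The dual functional `I(v) = ½⟨(L - μ)v, v⟩ - ∬ [J*(s,t,v) - (μ/2) v²]`. -/
def dualI (k : ℤ) (ε₁ ε₂ a b : ℝ) (p : ℝ → ℝ → ℝ → ℝ) (v : HSpace) : ℝ :=
  1 / 2 * funF k ε₁ ε₂ v
    - ∫ z, (funJstar (pk k ε₁) a b p z.1 z.2 (v z) - mu k ε₁ ε₂ / 2 * (v z) ^ 2) ∂cyl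

end FucikWave

end

/-!
Write `f(s,t,u) = a u⁺ - b u⁻ + p(s,t,u)` and `j = f - p_k u = ∂J/∂u`, and split the equation
`□u = f(·,u)` as `(□ - p_k)u = j(·,u)`. The operator `L = (□ - p_k)⁻¹` is bounded, though not
compact because the kernel of `□` is infinite-dimensional. As `j` is increasing in `u`, the function
`v = (□ - p_k)u` satisfies `Lv = ∂J*/∂v(·,v)`, which is the Euler equation of
`I(v) = ½⟨Lv, v⟩ - ∬ J*(s,t,v)`.

*Existence of a maximum.* Asymptotically `2J*(v)` is `(v⁺)²/(a - p_k) + (v⁻)²/(b - p_k)`. In the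
coordinates `A = 1/(a - p_k) - μ`, `B = 1/(b - p_k) - μ`, the condition that `(a,b)` lies below
`𝓒_k` says that `⟨(L - μ)v, v⟩ ≤ θ (A‖v⁺‖² + B‖v⁻‖²)` for some `θ < 1`, so `I` is coercive. Since
`u ↦ j - u/μ` is decreasing, `J*(v) - μv²/2` is convex, while `L - μ` is negative definite apart
from finitely many eigenfunctions; hence a maximizing sequence, along which these finitely many
coefficients converge, is a Cauchy sequence.

*Independence of the parameters.* The supremum defining `𝓒_k` is attained at solutions of
`□v = a v⁺ - b v⁻`, so being below `𝓒_k` is a statement about this equation, in which `ε₁`, `ε₂` do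
not occur.
-/

namespace FucikWave

noncomputable section

/-! ### Diagonal operators on a Hilbert space -/

section Hilbert

variable {ι H : Type*} [NormedAddCommGroup H] [InnerProductSpace ℝ H]

/-- A pairwise orthogonal family of unit vectors, some of which may be replaced by `0`. The zero
vectors make room for `ψ_{(m,0)} = 0` in the family of all eigenfunctions. -/
structure OrthonormalOrZero (e : ι → H) : Prop where
  inner_eq_zero : ∀ ⦃i j⦄, i ≠ j → inner ℝ (e i) (e j) = 0
  eq_zero_or_norm_eq_one : ∀ i, e i = 0 ∨ ‖e i‖ = 1

namespace OrthonormalOrZero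

variable {e : ι → H} {c : ι → ℝ} {C : ℝ}

lemma norm_le_one (he : OrthonormalOrZero e) (i : ι) : ‖e i‖ ≤ 1 := by
  rcases he.eq_zero_or_norm_eq_one i with h | h <;> simp [h]

lemma norm_sum_smul_sq_le (he : OrthonormalOrZero e) (s : Finset ι) (a : ι → ℝ) :
    ‖∑ i ∈ s, a i • e i‖ ^ 2 ≤ ∑ i ∈ s, a i ^ 2 := by
  rw [← real_inner_self_eq_norm_sq, sum_inner]
  refine Finset.sum_le_sum fun i hi => ?_
  rw [inner_sum, Finset.sum_eq_single_of_mem i hi fun j _ hj => by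
    rw [real_inner_smul_left, real_inner_smul_right, he.inner_eq_zero hj.symm, mul_zero, mul_zero],
    real_inner_self_eq_norm_sq, norm_smul, mul_pow, Real.norm_eq_abs, sq_abs]
  exact mul_le_of_le_one_right (sq_nonneg _) (pow_le_one₀ (norm_nonneg _) (he.norm_le_one i))

lemma sum_inner_sq_le (he : OrthonormalOrZero e) (s : Finset ι) (v : H) :
    ∑ i ∈ s, inner ℝ (e i) v ^ 2 ≤ ‖v‖ ^ 2 := by
  have hnonneg : 0 ≤ ‖v - ∑ i ∈ s, inner ℝ (e i) v • e i‖ ^ 2 := sq_nonneg _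
  have hcross : inner ℝ v (∑ i ∈ s, inner ℝ (e i) v • e i) = ∑ i ∈ s, inner ℝ (e i) v ^ 2 := by
    simp only [inner_sum, real_inner_smul_right, real_inner_comm, sq]
  rw [norm_sub_sq_real, hcross] at hnonneg
  linarith [he.norm_sum_smul_sq_le s fun i => inner ℝ (e i) v]

lemma summable_inner_sq (he : OrthonormalOrZero e) (v : H) :
    Summable fun i => inner ℝ (e i) v ^ 2 :=
  summable_of_sum_le (fun _ => sq_nonneg _) fun s => he.sum_inner_sq_le s v

lemma tsum_inner_sq_le (he : OrthonormalOrZero e) (v : H) :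
    ∑' i, inner ℝ (e i) v ^ 2 ≤ ‖v‖ ^ 2 :=
  (he.summable_inner_sq v).tsum_le_of_sum_le fun s => he.sum_inner_sq_le s v

lemma summable_smul [CompleteSpace H] (he : OrthonormalOrZero e) {a : ι → ℝ}
    (ha : Summable fun i => a i ^ 2) : Summable fun i => a i • e i := by
  rw [summable_iff_vanishing_norm] at ha ⊢
  intro ε hε
  obtain ⟨s, hs⟩ := ha (ε ^ 2) (by positivity)
  refine ⟨s, fun t ht => lt_of_pow_lt_pow_left₀ 2 hε.le ?_⟩
  exact (he.norm_sum_smul_sq_le t a).trans_lt ((Real.le_norm_self _).trans_lt (hs t ht))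

lemma sq_mul_inner_le (hc : ∀ i, |c i| ≤ C) (v : H) (i : ι) :
    (c i * inner ℝ (e i) v) ^ 2 ≤ C ^ 2 * inner ℝ (e i) v ^ 2 := by
  rw [mul_pow]
  exact mul_le_mul_of_nonneg_right (sq_le_sq' (abs_le.1 (hc i)).1 (abs_le.1 (hc i)).2) (sq_nonneg _)

lemma summable_sq_mul_inner (he : OrthonormalOrZero e) (hc : ∀ i, |c i| ≤ C) (v : H) :
    Summable fun i => (c i * inner ℝ (e i) v) ^ 2 :=
  Summable.of_nonneg_of_le (fun _ => sq_nonneg _) (sq_mul_inner_le hc v)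
    ((he.summable_inner_sq v).mul_left (C ^ 2))

end OrthonormalOrZero

/-- The operator which is diagonal along the family `e`, with coefficients `c`. -/
def diagOp (e : ι → H) (c : ι → ℝ) (v : H) : H :=
  ∑' i, (c i * inner ℝ (e i) v) • e i

namespace OrthonormalOrZero

variable {e : ι → H} {c : ι → ℝ} {C : ℝ}

lemma diagOp_apply_self (he : OrthonormalOrZero e) (c : ι → ℝ) (i : ι) :
    diagOp e c (e i) = c i • e i := by
  rw [diagOp, tsum_eq_single i fun j hj => by rw [he.inner_eq_zero hj, mul_zero, zero_smul],
    real_inner_self_eq_norm_sq]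
  rcases he.eq_zero_or_norm_eq_one i with h | h <;> simp [h]

variable [CompleteSpace H]

lemma hasSum_diagOp (he : OrthonormalOrZero e) (hc : ∀ i, |c i| ≤ C) (v : H) :
    HasSum (fun i => (c i * inner ℝ (e i) v) • e i) (diagOp e c v) :=
  (he.summable_smul (he.summable_sq_mul_inner hc v)).hasSum

lemma norm_diagOp_le (he : OrthonormalOrZero e) (hc : ∀ i, |c i| ≤ C) (v : H) :
    ‖diagOp e c v‖ ≤ |C| * ‖v‖ := by
  refine le_of_tendsto (he.hasSum_diagOp hc v).norm (Filter.Eventually.of_forall fun s => ?_)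
  refine le_of_sq_le_sq ?_ (by positivity)
  calc ‖∑ i ∈ s, (c i * inner ℝ (e i) v) • e i‖ ^ 2
      ≤ ∑ i ∈ s, (c i * inner ℝ (e i) v) ^ 2 := he.norm_sum_smul_sq_le s _
    _ ≤ C ^ 2 * ∑ i ∈ s, inner ℝ (e i) v ^ 2 := by
      rw [Finset.mul_sum]
      exact Finset.sum_le_sum fun i _ => sq_mul_inner_le hc v i
    _ ≤ (|C| * ‖v‖) ^ 2 := by
      rw [mul_pow, sq_abs]
      gcongr
      exact he.sum_inner_sq_le s v

/-- The bounded operator underlying `diagOp`, for bounded coefficients. -/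
def diagCLM (he : OrthonormalOrZero e) (hc : ∀ i, |c i| ≤ C) : H →L[ℝ] H :=
  LinearMap.mkContinuous
    { toFun := diagOp e c
      map_add' := fun v w => by
        refine (he.hasSum_diagOp hc (v + w)).unique ?_
        simpa only [inner_add_right, mul_add, add_smul] using
          (he.hasSum_diagOp hc v).add (he.hasSum_diagOp hc w)
      map_smul' := fun r v => by
        refine (he.hasSum_diagOp hc (r • v)).unique ?_
        simpa only [real_inner_smul_right, mul_left_comm, smul_smul, RingHom.id_apply] using
          (he.hasSum_diagOp hc v).const_smul r }
    |C| (he.norm_diagOp_le hc)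

@[simp] lemma diagCLM_apply (he : OrthonormalOrZero e) (hc : ∀ i, |c i| ≤ C) (v : H) :
    he.diagCLM hc v = diagOp e c v := rfl

lemma hasSum_inner_diagOp (he : OrthonormalOrZero e) (hc : ∀ i, |c i| ≤ C) (v w : H) :
    HasSum (fun i => c i * inner ℝ (e i) v * inner ℝ (e i) w) (inner ℝ (diagOp e c v) w) := by
  have h := (he.hasSum_diagOp hc v).mapL (innerSL ℝ w)
  simp only [innerSL_apply_apply, real_inner_smul_right] at h
  simpa only [real_inner_comm w] using h

lemma inner_diagOp_comm (he : OrthonormalOrZero e) (hc : ∀ i, |c i| ≤ C) (v w : H) :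
    inner ℝ (diagOp e c v) w = inner ℝ v (diagOp e c w) := by
  rw [real_inner_comm _ v]
  refine (he.hasSum_inner_diagOp hc v w).unique ?_
  simpa only [mul_right_comm] using he.hasSum_inner_diagOp hc w v

lemma inner_diagOp (he : OrthonormalOrZero e) (hc : ∀ i, |c i| ≤ C) (v : H) (i : ι) :
    inner ℝ (e i) (diagOp e c v) = c i * inner ℝ (e i) v := by
  rw [← he.inner_diagOp_comm hc, he.diagOp_apply_self, real_inner_smul_left]

lemma inner_diagOp_self_le (he : OrthonormalOrZero e) (hc : ∀ i, |c i| ≤ C) {κ : ℝ} (hκ : 0 ≤ κ)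
    (S : Finset ι) (hS : ∀ i ∉ S, c i ≤ κ) (v : H) :
    inner ℝ (diagOp e c v) v ≤ κ * ‖v‖ ^ 2 + C * ∑ i ∈ S, inner ℝ (e i) v ^ 2 := by
  classical
  have hfin : HasSum (fun i => if i ∈ S then inner ℝ (e i) v ^ 2 else 0)
      (∑ i ∈ S, inner ℝ (e i) v ^ 2) := by
    rw [← Finset.sum_congr rfl fun i hi => if_pos hi]
    exact hasSum_sum_of_ne_finset_zero fun i hi => if_neg hi
  refine (hasSum_le (fun i => ?_) (he.hasSum_inner_diagOp hc v v)
    (((he.summable_inner_sq v).hasSum.mul_left κ).add (hfin.mul_left C))).trans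
      (by gcongr; exact he.tsum_inner_sq_le v)
  rw [mul_assoc, ← sq]
  split_ifs with hi
  · have hci := (le_abs_self _).trans (hc i)
    nlinarith [mul_le_mul_of_nonneg_right hci (sq_nonneg (inner ℝ (e i) v)),
      mul_nonneg hκ (sq_nonneg (inner ℝ (e i) v))]
  · rw [mul_zero, add_zero]
    exact mul_le_mul_of_nonneg_right (hS i hi) (sq_nonneg _)

lemma exists_inner_diagOp_self_le (he : OrthonormalOrZero e) (hc : ∀ i, |c i| ≤ C) {κ : ℝ}
    (hκ : 0 ≤ κ) {S : Set ι} (hS : S.Finite) (hcS : ∀ i ∉ S, c i ≤ κ) :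
    ∃ n : ℕ, ∃ T : H →L[ℝ] EuclideanSpace ℝ (Fin n), ∀ v,
      inner ℝ (diagOp e c v) v ≤ κ * ‖v‖ ^ 2 + C * ‖T v‖ ^ 2 := by
  let f := hS.toFinset.equivFin.symm
  refine ⟨_, (PiLp.continuousLinearEquiv 2 ℝ fun _ => ℝ).symm.toContinuousLinearMap ∘L
    ContinuousLinearMap.pi fun n => innerSL ℝ (e (f n)), fun v => ?_⟩
  refine (he.inner_diagOp_self_le hc hκ hS.toFinset
    (fun i hi => hcS i (mt hS.mem_toFinset.2 hi)) v).trans_eq ?_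
  rw [EuclideanSpace.real_norm_sq_eq, ← Finset.sum_coe_sort,
    ← f.sum_comp fun i => inner ℝ (e i) v ^ 2]
  rfl

lemma diagOp_eq_self_of_mem_closure_span (he : OrthonormalOrZero e) (hc : ∀ i, |c i| ≤ C)
    {s : Set H} (hs : ∀ w ∈ s, ∃ i, c i = 1 ∧ ∃ r : ℝ, w = r • e i) {v : H}
    (hv : v ∈ (Submodule.span ℝ s).topologicalClosure) : diagOp e c v = v := by
  suffices (Submodule.span ℝ s).topologicalClosure ≤
      ((he.diagCLM hc).eqLocus (ContinuousLinearMap.id ℝ H)) from this hv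
  refine Submodule.topologicalClosure_minimal _ (Submodule.span_le.2 fun w hw => ?_)
    (isClosed_eq (he.diagCLM hc).continuous continuous_id)
  obtain ⟨i, hi, r, rfl⟩ := hs w hw
  simp [LinearMap.mem_eqLocus, he.diagOp_apply_self, hi]

end OrthonormalOrZero

end Hilbert

/-! ### Maximising sequences -/

section Maximizing

variable {H E : Type*} [NormedAddCommGroup H] [NormedSpace ℝ H] [NormedAddCommGroup E]
  [NormedSpace ℝ E]

/-- The midpoint of two almost maximal points is not better than the supremum, so strict concavity
bounds their distance by the distance of their images under `T`. -/
lemma cauchySeq_of_maximizing {Ψ : H → ℝ} {M c C : ℝ} (hc : 0 < c) (T : H →L[ℝ] E)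
    (hM : ∀ v, Ψ v ≤ M)
    (hmid : ∀ v w : H, (Ψ v + Ψ w) / 2 + c * ‖v - w‖ ^ 2 - C * ‖T (v - w)‖ ^ 2
      ≤ Ψ ((1 / 2 : ℝ) • (v + w)))
    {v : ℕ → H} (hT : CauchySeq (T ∘ v))
    (hlim : Filter.Tendsto (Ψ ∘ v) Filter.atTop (nhds M)) : CauchySeq v := by
  rw [cauchySeq_iff_tendsto_dist_atTop_0] at hT ⊢
  set u : ℕ × ℕ → ℝ := fun n => (C * dist (T (v n.1)) (T (v n.2)) ^ 2
    + (M - Ψ (v n.1)) / 2 + (M - Ψ (v n.2)) / 2) / c with hu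
  have hbound : ∀ n : ℕ × ℕ, dist (v n.1) (v n.2) ≤ √(u n) := fun n => by
    refine Real.le_sqrt_of_sq_le ?_
    rw [hu, le_div_iff₀ hc, dist_eq_norm, dist_eq_norm, ← map_sub]
    linarith [(hmid (v n.1) (v n.2)).trans (hM _)]
  have hgap : Filter.Tendsto (fun n => (M - Ψ (v n)) / 2) Filter.atTop (nhds 0) := by
    simpa using (hlim.const_sub M).div_const 2
  have hlim_u : Filter.Tendsto (fun n => √(u n)) Filter.atTop (nhds 0) := by
    rw [← Filter.prod_atTop_atTop_eq] at hT ⊢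
    simpa using (((((hT.pow 2).const_mul C).add (hgap.comp Filter.tendsto_fst)).add
      (hgap.comp Filter.tendsto_snd)).div_const c).sqrt
  exact squeeze_zero (fun _ => dist_nonneg) hbound hlim_u

lemma exists_tendsto_subseq_of_maximizing [CompleteSpace H] [ProperSpace E] {Ψ : H → ℝ}
    (hΨ : Continuous Ψ) {M c C : ℝ} (hc : 0 < c) (T : H →L[ℝ] E) (hM : ∀ v, Ψ v ≤ M)
    (hmid : ∀ v w : H, (Ψ v + Ψ w) / 2 + c * ‖v - w‖ ^ 2 - C * ‖T (v - w)‖ ^ 2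
      ≤ Ψ ((1 / 2 : ℝ) • (v + w)))
    {v : ℕ → H} (hv : Bornology.IsBounded (range v))
    (hlim : Filter.Tendsto (Ψ ∘ v) Filter.atTop (nhds M)) :
    ∃ v₀ : H, Ψ v₀ = M ∧ ∃ φ : ℕ → ℕ, StrictMono φ ∧
      Filter.Tendsto (v ∘ φ) Filter.atTop (nhds v₀) := by
  obtain ⟨_, _, φ, hφ, hTφ⟩ := tendsto_subseq_of_bounded (T.lipschitz.isBounded_image hv)
    fun n => mem_image_of_mem T (mem_range_self n)
  have hlimφ := hlim.comp hφ.tendsto_atTop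
  obtain ⟨v₀, hv₀⟩ := cauchySeq_tendsto_of_complete
    (cauchySeq_of_maximizing hc T hM hmid (v := v ∘ φ) hTφ.cauchySeq hlimφ)
  exact ⟨v₀, tendsto_nhds_unique ((hΨ.tendsto v₀).comp hv₀) hlimφ, φ, hφ, hv₀⟩

lemma exists_forall_le_of_coercive [CompleteSpace H] [ProperSpace E] {Ψ : H → ℝ}
    (hΨ : Continuous Ψ) {c C B δ : ℝ} (hc : 0 < c) (T : H →L[ℝ] E)
    (hmid : ∀ v w : H, (Ψ v + Ψ w) / 2 + c * ‖v - w‖ ^ 2 - C * ‖T (v - w)‖ ^ 2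
      ≤ Ψ ((1 / 2 : ℝ) • (v + w)))
    (hδ : 0 < δ) (hcoer : ∀ v, Ψ v ≤ B - δ * ‖v‖ ^ 2) : ∃ v₀, ∀ v, Ψ v ≤ Ψ v₀ := by
  have hbdd : BddAbove (range Ψ) :=
    ⟨B, by rintro _ ⟨v, rfl⟩; nlinarith [hcoer v, sq_nonneg ‖v‖]⟩
  obtain ⟨t, -, hlim, hrange⟩ := exists_seq_tendsto_sSup (range_nonempty Ψ) hbdd
  choose v hv using hrange
  obtain rfl : Ψ ∘ v = t := funext hv
  have hbelow : ∃ m, ∀ n, m ≤ Ψ (v n) :=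
    hlim.bddBelow_range.imp fun m hm n => hm (mem_range_self n)
  obtain ⟨m, hm⟩ := hbelow
  have hbounded : Bornology.IsBounded (range v) := by
    refine isBounded_iff_forall_norm_le.2 ⟨√((B - m) / δ), ?_⟩
    rintro _ ⟨n, rfl⟩
    refine Real.le_sqrt_of_sq_le ((le_div_iff₀ hδ).2 ?_)
    linarith [hcoer (v n), hm n]
  obtain ⟨v₀, hv₀, -⟩ := exists_tendsto_subseq_of_maximizing hΨ hc T
    (fun v => le_csSup hbdd (mem_range_self v)) hmid hbounded hlim
  exact ⟨v₀, fun v => hv₀ ▸ le_csSup hbdd (mem_range_self v)⟩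

end Maximizing

section SymmetricForm

variable {H : Type*} [NormedAddCommGroup H] [InnerProductSpace ℝ H] {A : H →L[ℝ] H}

lemma inner_self_midpoint (hA : ∀ v w, inner ℝ (A v) w = inner ℝ v (A w)) (v w : H) :
    inner ℝ (A ((1 / 2 : ℝ) • (v + w))) ((1 / 2 : ℝ) • (v + w)) =
      (inner ℝ (A v) v + inner ℝ (A w) w) / 2 - inner ℝ (A (v - w)) (v - w) / 4 := by
  simp only [map_smul, map_add, map_sub, inner_add_left, inner_add_right, inner_sub_left,
    inner_sub_right, real_inner_smul_left, real_inner_smul_right,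
    (hA w v).trans (real_inner_comm _ _)]
  ring

lemma hasFDerivAt_inner_self (hA : ∀ v w, inner ℝ (A v) w = inner ℝ v (A w)) (v : H) :
    HasFDerivAt (fun v => inner ℝ (A v) v) ((2 : ℝ) • innerSL ℝ (A v)) v := by
  refine ((A.hasFDerivAt (x := v)).inner ℝ (hasFDerivAt_id v)).congr_fderiv ?_
  ext w
  simp [(hA w v).trans (real_inner_comm _ _), two_mul]

/-- At a maximum of the difference of a quadratic and a convex function, the derivative of the
former is a subgradient of the latter: only the former is differentiable, so one compares values
along the segment from `v₀` to `v`. -/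
lemma inner_sub_le_sub_of_isMax (hA : ∀ v w, inner ℝ (A v) w = inner ℝ v (A w))
    {φ : H → ℝ} (hφ : ConvexOn ℝ univ φ) {v₀ : H}
    (hmax : ∀ v, 1 / 2 * inner ℝ (A v) v - φ v ≤ 1 / 2 * inner ℝ (A v₀) v₀ - φ v₀) (v : H) :
    inner ℝ (A v₀) (v - v₀) ≤ φ v - φ v₀ := by
  set w := v - v₀ with hw
  have hlim : Filter.Tendsto (fun t : ℝ => inner ℝ (A v₀) w + t * (1 / 2 * inner ℝ (A w) w))
      (nhdsWithin 0 (Ioi 0)) (nhds (inner ℝ (A v₀) w)) := by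
    have hcont : Continuous fun t : ℝ => inner ℝ (A v₀) w + t * (1 / 2 * inner ℝ (A w) w) := by
      fun_prop
    simpa using (hcont.tendsto 0).mono_left (nhdsWithin_le_nhds (s := Ioi 0))
  refine le_of_tendsto hlim ?_
  filter_upwards [Ioo_mem_nhdsGT (zero_lt_one' ℝ)] with t ht
  have hexpand : inner ℝ (A (v₀ + t • w)) (v₀ + t • w) =
      inner ℝ (A v₀) v₀ + 2 * t * inner ℝ (A v₀) w + t ^ 2 * inner ℝ (A w) w := by
    simp only [map_add, map_smul, inner_add_left, inner_add_right, real_inner_smul_left,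
      real_inner_smul_right, (hA w v₀).trans (real_inner_comm _ _)]
    ring
  have hconvex := hφ.2 (mem_univ v₀) (mem_univ v) (sub_nonneg.2 ht.2.le) ht.1.le
    (sub_add_cancel 1 t)
  rw [show (1 - t) • v₀ + t • v = v₀ + t • w by rw [hw]; module, smul_eq_mul, smul_eq_mul]
    at hconvex
  have hmax_t := hmax (v₀ + t • w)
  rw [hexpand] at hmax_t
  refine le_of_mul_le_mul_left ?_ ht.1
  nlinarith

end SymmetricForm

/-! ### The space `L²` of a measure -/

section LebesgueSquare

variable {X : Type*} [MeasurableSpace X] {ν : Measure X}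

lemma integrable_mul_lp (u v : Lp ℝ 2 ν) : Integrable (fun z => u z * v z) ν :=
  (Lp.memLp u).integrable_mul (Lp.memLp v)

lemma integrable_sq (u : Lp ℝ 2 ν) : Integrable (fun z => u z ^ 2) ν :=
  (Lp.memLp u).integrable_sq

lemma inner_eq_integral (u v : Lp ℝ 2 ν) : inner ℝ u v = ∫ z, u z * v z ∂ν := by
  simp only [L2.inner_def, RCLike.inner_apply, conj_trivial, mul_comm]

lemma norm_sq_eq_integral (u : Lp ℝ 2 ν) : ‖u‖ ^ 2 = ∫ z, u z ^ 2 ∂ν := by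
  rw [← real_inner_self_eq_norm_sq, inner_eq_integral]
  simp only [sq]

lemma norm_posPart_sq (u : Lp ℝ 2 ν) : ‖Lp.posPart u‖ ^ 2 = ∫ z, max (u z) 0 ^ 2 ∂ν := by
  rw [norm_sq_eq_integral]
  refine integral_congr_ae ?_
  filter_upwards [Lp.coeFn_posPart u] with z hz
  rw [hz]

lemma norm_negPart_sq (u : Lp ℝ 2 ν) : ‖Lp.negPart u‖ ^ 2 = ∫ z, max (-u z) 0 ^ 2 ∂ν := by
  rw [norm_sq_eq_integral]
  refine integral_congr_ae ?_
  filter_upwards [Lp.coeFn_negPart_eq_max u] with z hz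
  rw [hz]

lemma coeFn_half_smul_add (u v : Lp ℝ 2 ν) :
    ((1 / 2 : ℝ) • (u + v) : Lp ℝ 2 ν) =ᵐ[ν] fun z => (u z + v z) / 2 := by
  filter_upwards [Lp.coeFn_smul (1 / 2 : ℝ) (u + v), Lp.coeFn_add u v] with z h_smul h_add
  rw [h_smul, Pi.smul_apply, h_add, Pi.add_apply, smul_eq_mul]
  ring

end LebesgueSquare

/-! ### Jumping nonlinearities -/

section Jump

variable {α β α' β' : ℝ}

/-- The jumping nonlinearity `x ↦ α x⁺ - β x⁻`, with slope `α` on `[0, ∞)` and `β` on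
`(-∞, 0]`. -/
def jump (α β x : ℝ) : ℝ := α * max x 0 - β * max (-x) 0

/-- The function `x ↦ α (x⁺)² + β (x⁻)²`, twice the primitive of `jump α β`. -/
def jumpSq (α β x : ℝ) : ℝ := α * max x 0 ^ 2 + β * max (-x) 0 ^ 2

@[fun_prop] lemma continuous_jumpSq (α β : ℝ) : Continuous (jumpSq α β) := by
  unfold jumpSq; fun_prop

lemma jump_of_nonneg (α β : ℝ) {x : ℝ} (hx : 0 ≤ x) : jump α β x = α * x := by
  rw [jump, max_eq_left hx, max_eq_right (by linarith)]; ring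

lemma jump_of_nonpos (α β : ℝ) {x : ℝ} (hx : x ≤ 0) : jump α β x = β * x := by
  rw [jump, max_eq_right hx, max_eq_left (by linarith)]; ring

lemma jumpSq_of_nonneg (α β : ℝ) {x : ℝ} (hx : 0 ≤ x) : jumpSq α β x = α * x ^ 2 := by
  rw [jumpSq, max_eq_left hx, max_eq_right (by linarith)]; ring

lemma jumpSq_of_nonpos (α β : ℝ) {x : ℝ} (hx : x ≤ 0) : jumpSq α β x = β * x ^ 2 := by
  rw [jumpSq, max_eq_right hx, max_eq_left (by linarith)]; ring

lemma jump_mul_self (α β x : ℝ) : jump α β x * x = jumpSq α β x := by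
  rcases le_total 0 x with hx | hx
  · rw [jump_of_nonneg _ _ hx, jumpSq_of_nonneg _ _ hx]; ring
  · rw [jump_of_nonpos _ _ hx, jumpSq_of_nonpos _ _ hx]; ring

lemma jumpSq_mul {c : ℝ} (hc : 0 ≤ c) (α β x : ℝ) :
    jumpSq α β (c * x) = c ^ 2 * jumpSq α β x := by
  have hneg : max (-(c * x)) 0 = c * max (-x) 0 := by
    rw [mul_max_of_nonneg _ _ hc, mul_zero, mul_neg]
  rw [jumpSq, jumpSq, hneg, ← mul_zero c, ← mul_max_of_nonneg _ _ hc, mul_zero]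
  ring

lemma jumpSq_self (α x : ℝ) : jumpSq α α x = α * x ^ 2 := by
  rcases le_total 0 x with hx | hx
  · exact jumpSq_of_nonneg _ _ hx
  · exact jumpSq_of_nonpos _ _ hx

lemma jumpSq_add_mul_sq (α β ε x : ℝ) : jumpSq α β x + ε * x ^ 2 = jumpSq (α + ε) (β + ε) x := by
  rw [← jumpSq_self, jumpSq, jumpSq, jumpSq]; ring

lemma jumpSq_mono (hα : α ≤ α') (hβ : β ≤ β') (x : ℝ) : jumpSq α β x ≤ jumpSq α' β' x := by
  unfold jumpSq; gcongr

lemma abs_jumpSq_le (α β x : ℝ) : |jumpSq α β x| ≤ (|α| + |β|) * x ^ 2 := by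
  rcases le_total 0 x with hx | hx
  · rw [jumpSq_of_nonneg _ _ hx, abs_mul, abs_sq]
    gcongr
    linarith [abs_nonneg β]
  · rw [jumpSq_of_nonpos _ _ hx, abs_mul, abs_sq]
    gcongr
    linarith [abs_nonneg α]

lemma jumpSq_midpoint_le (hα : 0 ≤ α) (hβ : 0 ≤ β) (x y : ℝ) :
    jumpSq α β ((x + y) / 2) ≤ (jumpSq α β x + jumpSq α β y) / 2 := by
  have hpos : ∀ x y : ℝ, max ((x + y) / 2) 0 ^ 2 ≤ (max x 0 ^ 2 + max y 0 ^ 2) / 2 := by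
    intro x y
    have hmid : max ((x + y) / 2) 0 ≤ (max x 0 + max y 0) / 2 :=
      max_le (by linarith [le_max_left x 0, le_max_left y 0])
        (by linarith [le_max_right x 0, le_max_right y 0])
    have hsq := pow_le_pow_left₀ (le_max_right ((x + y) / 2) 0) hmid 2
    nlinarith [sq_nonneg (max x 0 - max y 0)]
  have hα_le := mul_le_mul_of_nonneg_left (hpos x y) hα
  have hβ_le := mul_le_mul_of_nonneg_left (hpos (-x) (-y)) hβ
  rw [show (-x + -y) / 2 = -((x + y) / 2) by ring] at hβ_le
  rw [jumpSq, jumpSq, jumpSq]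
  linarith

lemma integral_jump (α β u : ℝ) : ∫ τ in (0 : ℝ)..u, jump α β τ = 1 / 2 * jumpSq α β u := by
  rcases le_total 0 u with hu | hu
  · rw [intervalIntegral.integral_congr (g := fun τ => α * τ)
      (fun τ hτ => jump_of_nonneg α β (by rw [uIcc_of_le hu] at hτ; exact hτ.1)),
      intervalIntegral.integral_const_mul, integral_id, jumpSq_of_nonneg _ _ hu]
    ring
  · rw [intervalIntegral.integral_congr (g := fun τ => β * τ)
      (fun τ hτ => jump_of_nonpos α β (by rw [uIcc_of_ge hu] at hτ; exact hτ.2)),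
      intervalIntegral.integral_const_mul, integral_id, jumpSq_of_nonpos _ _ hu]
    ring

lemma lipschitzWith_jump (α β : ℝ) : LipschitzWith (‖α‖₊ + ‖β‖₊) (jump α β) := by
  have hpos : LipschitzWith 1 fun x : ℝ => max x 0 := LipschitzWith.id.max_const 0
  have hneg : LipschitzWith 1 fun x : ℝ => max (-x) 0 := LipschitzWith.id.neg.max_const 0
  have hsub := ((lipschitzWith_smul α).comp hpos).sub ((lipschitzWith_smul β).comp hneg)
  rwa [mul_one, mul_one] at hsub

end Jump

section JumpForm

variable {X : Type*} [MeasurableSpace X] {ν : Measure X} {α β α' β' : ℝ}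

/-- The functional `v ↦ α ‖v⁺‖² + β ‖v⁻‖²` on `L²`. -/
def jumpForm (α β : ℝ) (v : Lp ℝ 2 ν) : ℝ := α * ‖Lp.posPart v‖ ^ 2 + β * ‖Lp.negPart v‖ ^ 2

lemma integrable_jumpSq (α β : ℝ) (u : Lp ℝ 2 ν) : Integrable (fun z => jumpSq α β (u z)) ν := by
  refine ((integrable_sq u).const_mul (|α| + |β|)).mono'
    ((continuous_jumpSq α β).comp_aestronglyMeasurable (Lp.aestronglyMeasurable u)) ?_
  exact Filter.Eventually.of_forall fun z => abs_jumpSq_le α β (u z)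

lemma jumpForm_eq_integral (α β : ℝ) (v : Lp ℝ 2 ν) :
    jumpForm α β v = ∫ z, jumpSq α β (v z) ∂ν := by
  have hpos : Integrable (fun z => max (v z) 0 ^ 2) ν := by
    simpa [jumpSq] using integrable_jumpSq 1 0 v
  have hneg : Integrable (fun z => max (-v z) 0 ^ 2) ν := by
    simpa [jumpSq] using integrable_jumpSq 0 1 v
  rw [jumpForm, norm_posPart_sq, norm_negPart_sq, ← integral_const_mul, ← integral_const_mul,
    ← integral_add (hpos.const_mul α) (hneg.const_mul β)]
  rfl

lemma jumpForm_self (α : ℝ) (v : Lp ℝ 2 ν) : jumpForm α α v = α * ‖v‖ ^ 2 := by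
  simp only [jumpForm_eq_integral, norm_sq_eq_integral, ← integral_const_mul, jumpSq_self]

lemma jumpForm_smul {c : ℝ} (hc : 0 ≤ c) (α β : ℝ) (v : Lp ℝ 2 ν) :
    jumpForm α β (c • v) = c ^ 2 * jumpForm α β v := by
  rw [jumpForm_eq_integral, jumpForm_eq_integral, ← integral_const_mul]
  refine integral_congr_ae ?_
  filter_upwards [Lp.coeFn_smul c v] with z hz
  rw [hz, Pi.smul_apply, smul_eq_mul, jumpSq_mul hc]

@[simp] lemma jumpForm_zero (α β : ℝ) : jumpForm α β (0 : Lp ℝ 2 ν) = 0 := by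
  simpa using jumpForm_smul le_rfl α β (0 : Lp ℝ 2 ν)

lemma jumpForm_mono (hα : α ≤ α') (hβ : β ≤ β') (v : Lp ℝ 2 ν) :
    jumpForm α β v ≤ jumpForm α' β' v := by
  unfold jumpForm; gcongr

lemma min_mul_norm_sq_le_jumpForm (α β : ℝ) (v : Lp ℝ 2 ν) :
    min α β * ‖v‖ ^ 2 ≤ jumpForm α β v := by
  rw [← jumpForm_self]
  exact jumpForm_mono (min_le_left _ _) (min_le_right _ _) v

lemma jumpForm_pos (hα : 0 < α) (hβ : 0 < β) {v : Lp ℝ 2 ν} (hv : v ≠ 0) : 0 < jumpForm α β v :=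
  (mul_pos (lt_min hα hβ) (pow_pos (norm_pos_iff.2 hv) 2)).trans_le
    (min_mul_norm_sq_le_jumpForm α β v)

lemma mul_jumpForm (c α β : ℝ) (v : Lp ℝ 2 ν) :
    c * jumpForm α β v = jumpForm (c * α) (c * β) v := by
  rw [jumpForm, jumpForm]; ring

lemma jumpForm_add_mul_norm_sq (α β ε : ℝ) (v : Lp ℝ 2 ν) :
    jumpForm α β v + ε * ‖v‖ ^ 2 = jumpForm (α + ε) (β + ε) v := by
  rw [← jumpForm_self, jumpForm, jumpForm, jumpForm]; ring

lemma jumpForm_midpoint_le (hα : 0 ≤ α) (hβ : 0 ≤ β) (v w : Lp ℝ 2 ν) :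
    jumpForm α β ((1 / 2 : ℝ) • (v + w)) ≤ (jumpForm α β v + jumpForm α β w) / 2 := by
  rw [jumpForm_eq_integral, jumpForm_eq_integral, jumpForm_eq_integral,
    ← integral_add (integrable_jumpSq _ _ v) (integrable_jumpSq _ _ w), ← integral_div]
  refine integral_mono_ae (integrable_jumpSq _ _ _)
    (((integrable_jumpSq _ _ v).add (integrable_jumpSq _ _ w)).div_const 2) ?_
  filter_upwards [coeFn_half_smul_add v w] with z hz
  simp only [hz]
  exact jumpSq_midpoint_le hα hβ _ _

end JumpForm

/-! ### Superposition operators on `L²` -/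

section Superposition

variable {X : Type*}

/-- The primitive of `f z` that vanishes at `0`. -/
def prim (f : X → ℝ → ℝ) (z : X) (u : ℝ) : ℝ := ∫ τ in (0 : ℝ)..u, f z τ

lemma prim_zero (f : X → ℝ → ℝ) (z : X) : prim f z 0 = 0 :=
  intervalIntegral.integral_same

variable [MeasurableSpace X] {ν : Measure X} {f : X → ℝ → ℝ} {K : NNReal}

/-- A Carathéodory integrand `f z u` that is uniformly Lipschitz in `u`, with `f · 0` in `L²(ν)`,
so that `u ↦ f(·, u)` maps `L²(ν)` to itself. -/
structure LipIntegrand (f : X → ℝ → ℝ) (K : NNReal) (ν : Measure X) : Prop where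
  measurable_left : ∀ u, Measurable fun z => f z u
  lip : ∀ z, LipschitzWith K (f z)
  memLp_zero : MemLp (fun z => f z 0) 2 ν

namespace LipIntegrand

lemma measurable (hf : LipIntegrand f K ν) : Measurable fun x : X × ℝ => f x.1 x.2 :=
  (measurable_uncurry_of_continuous_of_measurable (u := fun u z => f z u)
    (fun z => (hf.lip z).continuous) hf.measurable_left).comp measurable_swap

lemma memLp (hf : LipIntegrand f K ν) (u : Lp ℝ 2 ν) : MemLp (fun z => f z (u z)) 2 ν := by
  have hdiff : MemLp (fun z => f z (u z) - f z 0) 2 ν := by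
    refine (Lp.memLp u).of_le_mul (c := K) (AEStronglyMeasurable.sub ?_
      hf.memLp_zero.aestronglyMeasurable) (Filter.Eventually.of_forall fun z => ?_)
    · exact (hf.measurable.comp_aemeasurable
        (aemeasurable_id.prodMk (Lp.aestronglyMeasurable u).aemeasurable)).aestronglyMeasurable
    · simpa [dist_eq_norm] using (hf.lip z).dist_le_mul (u z) 0
  convert hdiff.add hf.memLp_zero
  simp

/-- The superposition (Nemytskii) operator `u ↦ f(·, u)` on `L²(ν)`. -/
def nem (hf : LipIntegrand f K ν) (u : Lp ℝ 2 ν) : Lp ℝ 2 ν := (hf.memLp u).toLp _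

lemma coeFn_nem (hf : LipIntegrand f K ν) (u : Lp ℝ 2 ν) :
    hf.nem u =ᵐ[ν] fun z => f z (u z) := (hf.memLp u).coeFn_toLp

lemma hasDerivAt_prim (hf : LipIntegrand f K ν) (z : X) (u : ℝ) :
    HasDerivAt (prim f z) (f z u) u :=
  (hf.lip z).continuous.integral_hasStrictDerivAt 0 u |>.hasDerivAt

lemma continuous_prim (hf : LipIntegrand f K ν) (z : X) : Continuous (prim f z) :=
  continuous_iff_continuousAt.2 fun u => (hf.hasDerivAt_prim z u).continuousAt

lemma measurable_prim_left (hf : LipIntegrand f K ν) (u : ℝ) : Measurable fun z => prim f z u := by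
  have hmeasurable : Measurable fun z => ∫ τ in uIoc 0 u, f z τ :=
    hf.measurable.stronglyMeasurable.integral_prod_right'.measurable
  simp only [prim, intervalIntegral.intervalIntegral_eq_integral_uIoc]
  exact hmeasurable.const_smul (if 0 ≤ u then (1 : ℝ) else -1)

lemma measurable_prim (hf : LipIntegrand f K ν) : Measurable fun x : X × ℝ => prim f x.1 x.2 :=
  (measurable_uncurry_of_continuous_of_measurable (u := fun u z => prim f z u)
    (fun z => hf.continuous_prim z) hf.measurable_prim_left).comp measurable_swap

lemma abs_prim_sub_le (hf : LipIntegrand f K ν) (z : X) (u h : ℝ) :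
    |prim f z (u + h) - prim f z u - f z u * h| ≤ K * h ^ 2 := by
  have hderiv : ∀ x ∈ uIcc u (u + h), HasDerivWithinAt (fun x => prim f z x - f z u * x)
      (f z x - f z u) (uIcc u (u + h)) x := fun x _ => by
    have hlin : HasDerivAt (fun x => f z u * x) (f z u) x := by
      simpa using (hasDerivAt_id x).const_mul (f z u)
    exact ((hf.hasDerivAt_prim z x).sub hlin).hasDerivWithinAt
  have hbound : ∀ x ∈ uIcc u (u + h), ‖f z x - f z u‖ ≤ K * |h| := fun x hx => by
    refine ((hf.lip z).norm_sub_le x u).trans (mul_le_mul_of_nonneg_left ?_ K.2)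
    simpa using abs_sub_left_of_mem_uIcc hx
  have hmvt := (convex_uIcc u (u + h)).norm_image_sub_le_of_norm_hasDerivWithin_le hderiv hbound
    left_mem_uIcc right_mem_uIcc
  rw [Real.norm_eq_abs, add_sub_cancel_left, Real.norm_eq_abs, mul_assoc, ← sq, sq_abs] at hmvt
  convert hmvt using 2
  ring

lemma integrable_prim (hf : LipIntegrand f K ν) (u : Lp ℝ 2 ν) :
    Integrable (fun z => prim f z (u z)) ν := by
  have hlin : Integrable (fun z => u z * f z 0) ν := (Lp.memLp u).integrable_mul hf.memLp_zero
  have hrem : Integrable (fun z => prim f z (u z) - u z * f z 0) ν := by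
    refine ((integrable_sq u).const_mul K).mono'
      (AEStronglyMeasurable.sub ?_ hlin.aestronglyMeasurable)
      (Filter.Eventually.of_forall fun z => ?_)
    · exact (hf.measurable_prim.comp_aemeasurable
        (aemeasurable_id.prodMk (Lp.aestronglyMeasurable u).aemeasurable)).aestronglyMeasurable
    · simpa [prim_zero, mul_comm] using hf.abs_prim_sub_le z 0 (u z)
  exact (hrem.add hlin).congr (Filter.Eventually.of_forall fun z => by simp)

lemma hasFDerivAt_integral_prim (hf : LipIntegrand f K ν) (u : Lp ℝ 2 ν) :
    HasFDerivAt (fun u : Lp ℝ 2 ν => ∫ z, prim f z (u z) ∂ν) (innerSL ℝ (hf.nem u)) u := by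
  rw [hasFDerivAt_iff_isLittleO_nhds_zero]
  refine Asymptotics.IsBigO.trans_isLittleO (g := fun h : Lp ℝ 2 ν => ‖h‖ ^ 2) ?_
    (Asymptotics.isLittleO_norm_pow_id one_lt_two)
  refine Asymptotics.IsBigO.of_bound K (Filter.Eventually.of_forall fun h => ?_)
  have hdiff : Integrable (fun z => prim f z ((u + h : Lp ℝ 2 ν) z) - prim f z (u z)) ν :=
    (hf.integrable_prim _).sub (hf.integrable_prim _)
  rw [innerSL_apply_apply, inner_eq_integral,
    ← integral_sub (hf.integrable_prim _) (hf.integrable_prim _),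
    ← integral_sub hdiff (integrable_mul_lp _ _), norm_pow, norm_norm, norm_sq_eq_integral,
    ← integral_const_mul]
  refine norm_integral_le_of_norm_le ((integrable_sq h).const_mul K) ?_
  filter_upwards [Lp.coeFn_add u h, hf.coeFn_nem u] with z h_add h_nem
  rw [h_add, h_nem, Real.norm_eq_abs, Pi.add_apply]
  exact hf.abs_prim_sub_le z (u z) (h z)

end LipIntegrand

lemma lipIntegrand_jump (ν : Measure X) (α β : ℝ) :
    LipIntegrand (fun _ => jump α β) (‖α‖₊ + ‖β‖₊) ν where
  measurable_left _ := measurable_const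
  lip _ := lipschitzWith_jump α β
  memLp_zero := by simp [jump]

lemma hasFDerivAt_jumpForm (α β : ℝ) (v : Lp ℝ 2 ν) :
    HasFDerivAt (jumpForm α β) ((2 : ℝ) • innerSL ℝ ((lipIntegrand_jump ν α β).nem v)) v := by
  have hprim : jumpForm α β =
      (2 : ℝ) • fun u : Lp ℝ 2 ν => ∫ z, prim (fun _ => jump α β) z (u z) ∂ν := by
    funext w
    simp only [jumpForm_eq_integral, Pi.smul_apply, smul_eq_mul, ← integral_const_mul, prim,
      integral_jump]
    ring_nf
  rw [hprim]
  exact ((lipIntegrand_jump ν α β).hasFDerivAt_integral_prim v).const_smul (2 : ℝ)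

@[fun_prop] lemma continuous_jumpForm (α β : ℝ) : Continuous (jumpForm α β : Lp ℝ 2 ν → ℝ) :=
  continuous_iff_continuousAt.2 fun v => (hasFDerivAt_jumpForm α β v).continuousAt

lemma inner_nem_jump (α β : ℝ) (v : Lp ℝ 2 ν) :
    inner ℝ ((lipIntegrand_jump ν α β).nem v) v = jumpForm α β v := by
  rw [inner_eq_integral, jumpForm_eq_integral]
  refine integral_congr_ae ?_
  filter_upwards [(lipIntegrand_jump ν α β).coeFn_nem v] with z hz
  rw [hz, jump_mul_self]

lemma eq_nem_jump_of_isMax {A : Lp ℝ 2 ν →L[ℝ] Lp ℝ 2 ν}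
    (hA : ∀ v w, inner ℝ (A v) w = inner ℝ v (A w)) {α β : ℝ} {v₀ : Lp ℝ 2 ν}
    (hmax : ∀ v, inner ℝ (A v) v - jumpForm α β v ≤ inner ℝ (A v₀) v₀ - jumpForm α β v₀) :
    A v₀ = (lipIntegrand_jump ν α β).nem v₀ := by
  have hlocal : IsLocalMax (fun v => inner ℝ (A v) v - jumpForm α β v) v₀ :=
    Filter.Eventually.of_forall hmax
  have hzero := hlocal.hasFDerivAt_eq_zero
    ((hasFDerivAt_inner_self hA v₀).sub (hasFDerivAt_jumpForm α β v₀))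
  rw [← smul_sub, smul_eq_zero_iff_right two_ne_zero, sub_eq_zero] at hzero
  exact innerSL_inj.1 hzero

end Superposition

/-! ### The Legendre transform on the real line -/

section Legendre

variable {G g : ℝ → ℝ} {α β μ m C : ℝ}

/-- The Fenchel–Legendre transform of `G : ℝ → ℝ`; as a supremum of real numbers it is meaningful
only where `u ↦ v u - G u` is bounded above. -/
def legendre (G : ℝ → ℝ) (v : ℝ) : ℝ := ⨆ u : ℝ, (v * u - G u)

lemma mul_sub_le_sub_of_monotone (hG : ∀ x, HasDerivAt G (g x) x) (hg : Monotone g) (x y : ℝ) :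
    g x * (y - x) ≤ G y - G x := by
  have hc : Continuous G := continuous_iff_continuousAt.2 fun x => (hG x).continuousAt
  rcases lt_trichotomy x y with hxy | rfl | hxy
  · obtain ⟨c, hc_mem, hc_slope⟩ :=
      exists_hasDerivAt_eq_slope G g hxy hc.continuousOn fun x _ => hG x
    rw [eq_div_iff (by linarith)] at hc_slope
    nlinarith [hg hc_mem.1.le]
  · simp
  · obtain ⟨c, hc_mem, hc_slope⟩ :=
      exists_hasDerivAt_eq_slope G g hxy hc.continuousOn fun x _ => hG x
    rw [eq_div_iff (by linarith)] at hc_slope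
    nlinarith [hg hc_mem.2.le]

lemma mul_sub_le_of_quadratic_le (hm : 0 < m) (hG : ∀ u, m * u ^ 2 - C ≤ G u) (v u : ℝ) :
    v * u - G u ≤ 1 / (4 * m) * v ^ 2 + C := by
  have hsq : 0 ≤ (v - 2 * m * u) ^ 2 / (4 * m) := by positivity
  have hexpand : (v - 2 * m * u) ^ 2 / (4 * m) = 1 / (4 * m) * v ^ 2 - v * u + m * u ^ 2 := by
    field_simp
    ring
  linarith [hG u]

lemma legendre_le_of_quadratic_le (hm : 0 < m) (hG : ∀ u, m * u ^ 2 - C ≤ G u) (v : ℝ) :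
    legendre G v ≤ 1 / (4 * m) * v ^ 2 + C :=
  ciSup_le (mul_sub_le_of_quadratic_le hm hG v)

lemma bddAbove_mul_sub_of_quadratic_le (hm : 0 < m) (hG : ∀ u, m * u ^ 2 - C ≤ G u) (v : ℝ) :
    BddAbove (range fun u => v * u - G u) :=
  ⟨_, by rintro _ ⟨u, rfl⟩; exact mul_sub_le_of_quadratic_le hm hG v u⟩

lemma mul_sub_le_legendre {v : ℝ} (hv : BddAbove (range fun u => v * u - G u)) (u : ℝ) :
    v * u - G u ≤ legendre G v :=
  le_ciSup hv u

lemma convexOn_legendre (hG : ∀ v, BddAbove (range fun u => v * u - G u)) :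
    ConvexOn ℝ univ (legendre G) := by
  refine ⟨convex_univ, fun v _ w _ s t hs ht hst => ciSup_le fun u => ?_⟩
  have hv := mul_le_mul_of_nonneg_left (mul_sub_le_legendre (hG v) u) hs
  have hw := mul_le_mul_of_nonneg_left (mul_sub_le_legendre (hG w) u) ht
  have hsplit : G u = s * G u + t * G u := by rw [← add_mul, hst, one_mul]
  simp only [smul_eq_mul]
  linarith

/-- If `G'` has slope at most `1/μ`, then `legendre G` has slope at least `μ`: one tests the two
suprema on the right with the points `u ± μ (v - w) / 2`. -/
lemma legendre_midpoint_le (hμ : 0 < μ) (hG : ∀ x, HasDerivAt G (g x) x)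
    (hg : Antitone fun x => g x - x / μ) (hbdd : ∀ v, BddAbove (range fun u => v * u - G u))
    (v w : ℝ) :
    legendre G ((v + w) / 2) ≤ (legendre G v + legendre G w) / 2 - μ / 8 * (v - w) ^ 2 := by
  refine ciSup_le fun u => ?_
  set h := μ * (v - w) / 2 with hh
  have hderiv : ∀ x, HasDerivAt (fun x => x ^ 2 / (2 * μ) - G x) (x / μ - g x) x := fun x => by
    refine (((hasDerivAt_pow 2 x).div_const (2 * μ)).sub (hG x)).congr_deriv ?_
    simp only [Nat.cast_ofNat, Nat.add_one_sub_one, pow_one]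
    field_simp
  have hmono : Monotone fun x => x / μ - g x := fun x y hxy => by
    have := hg hxy
    simp only at this ⊢
    linarith
  have htangent_add := mul_sub_le_sub_of_monotone hderiv hmono u (u + h)
  have htangent_sub := mul_sub_le_sub_of_monotone hderiv hmono u (u - h)
  have htest_v := mul_sub_le_legendre (hbdd v) (u + h)
  have htest_w := mul_sub_le_legendre (hbdd w) (u - h)
  have hquad : (u + h) ^ 2 / (2 * μ) + (u - h) ^ 2 / (2 * μ) - 2 * (u ^ 2 / (2 * μ)) =
      μ / 4 * (v - w) ^ 2 := by
    rw [hh]; field_simp; ring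
  have hlin : v * (u + h) + w * (u - h) = (v + w) * u + μ / 2 * (v - w) ^ 2 := by
    rw [hh]; ring
  linarith

lemma legendre_deriv (hG : ∀ x, HasDerivAt G (g x) x) (hg : Monotone g) (u : ℝ) :
    legendre G (g u) = g u * u - G u := by
  have hle : ∀ x, g u * x - G x ≤ g u * u - G u := fun x => by
    linarith [mul_sub_le_sub_of_monotone hG hg u x]
  exact le_antisymm (ciSup_le hle)
    (mul_sub_le_legendre ⟨_, by rintro _ ⟨x, rfl⟩; exact hle x⟩ u)

lemma eq_deriv_of_legendre_eq {u v G' : ℝ} (hv : BddAbove (range fun u => v * u - G u))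
    (hG : HasDerivAt G G' u) (h : legendre G v = v * u - G u) : v = G' := by
  have hmax : IsLocalMax (fun x => v * x - G x) u := Filter.Eventually.of_forall fun x => by
    simpa only [← h] using mul_sub_le_legendre hv x
  have := hmax.hasDerivAt_eq_zero (((hasDerivAt_id u).const_mul v).sub hG)
  linarith

lemma half_jumpSq_sub_le_legendre (hα : 0 < α) (hβ : 0 < β) {v : ℝ}
    (hv : BddAbove (range fun u => v * u - G u))
    (hG : ∀ u, G u ≤ 1 / 2 * jumpSq α β u + C) :
    1 / 2 * jumpSq (1 / α) (1 / β) v - C ≤ legendre G v := by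
  rcases le_total 0 v with hv0 | hv0
  · have htest := mul_sub_le_legendre hv (v / α)
    have hle := hG (v / α)
    rw [jumpSq_of_nonneg _ _ (by positivity : 0 ≤ v / α)] at hle
    rw [jumpSq_of_nonneg _ _ hv0]
    have hval : v * (v / α) - 1 / 2 * (α * (v / α) ^ 2) = 1 / 2 * (1 / α * v ^ 2) := by
      field_simp; ring
    linarith
  · have htest := mul_sub_le_legendre hv (v / β)
    have hle := hG (v / β)
    rw [jumpSq_of_nonpos _ _ (div_nonpos_of_nonpos_of_nonneg hv0 hβ.le)] at hle
    rw [jumpSq_of_nonpos _ _ hv0]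
    have hval : v * (v / β) - 1 / 2 * (β * (v / β) ^ 2) = 1 / 2 * (1 / β * v ^ 2) := by
      field_simp; ring
    linarith

lemma legendre_eq_iSup_rat (hG : Continuous G) {v : ℝ}
    (hv : BddAbove (range fun u => v * u - G u)) :
    legendre G v = ⨆ q : ℚ, (v * (q : ℝ) - G q) := by
  have hq : BddAbove (range fun q : ℚ => v * (q : ℝ) - G q) :=
    hv.mono (by rintro _ ⟨q, rfl⟩; exact ⟨q, rfl⟩)
  refine le_antisymm (ciSup_le fun u => ?_) (ciSup_le fun q => mul_sub_le_legendre hv q)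
  refine Rat.denseRange_cast.induction_on
    (p := fun u : ℝ => v * u - G u ≤ ⨆ q : ℚ, (v * (q : ℝ) - G q)) u ?_ fun q => le_ciSup hq q
  exact isClosed_le (by fun_prop) continuous_const

end Legendre

/-! ### The conjugate of an integral functional -/

section Conjugate

variable {X : Type*} [MeasurableSpace X] {ν : Measure X} {j : X → ℝ → ℝ} {μ α β : ℝ}

/-- The Carathéodory integrands `j = ∂J/∂u` for which the dual problem is posed: `j z` is
increasing with slope at most `1/μ`, and `J` is asymptotic to `½ (α (u⁺)² + β (u⁻)²)` at infinity,
uniformly in `z`. -/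
structure DualIntegrand (j : X → ℝ → ℝ) (μ α β : ℝ) (ν : Measure X) : Prop where
  measurable_left : ∀ u, Measurable fun z => j z u
  memLp_zero : MemLp (fun z => j z 0) 2 ν
  mono : ∀ z, Monotone (j z)
  anti : ∀ z, Antitone fun u => j z u - u / μ
  mu_pos : 0 < μ
  alpha_pos : 0 < α
  beta_pos : 0 < β
  asymp : ∀ ε > 0, ∃ C, ∀ z u, |prim j z u - 1 / 2 * jumpSq α β u| ≤ ε * u ^ 2 + C

/-- The Legendre transform of the primitive of `j z`. -/
def conj (j : X → ℝ → ℝ) (z : X) (v : ℝ) : ℝ := legendre (prim j z) v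

/-- The integral functional `v ↦ ∫ conj j z (v z)`, conjugate to `u ↦ ∫ prim j z (u z)`. -/
def conjInt (j : X → ℝ → ℝ) (v : Lp ℝ 2 ν) : ℝ := ∫ z, conj j z (v z) ∂ν

namespace DualIntegrand

lemma lipIntegrand (hj : DualIntegrand j μ α β ν) : LipIntegrand j (1 / μ).toNNReal ν where
  measurable_left := hj.measurable_left
  memLp_zero := hj.memLp_zero
  lip z := by
    refine LipschitzWith.of_le_add_mul _ fun u w => ?_
    rw [Real.coe_toNNReal _ (one_div_pos.2 hj.mu_pos).le, Real.dist_eq]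
    rcases le_total u w with huw | huw
    · have : 0 ≤ 1 / μ * |u - w| := mul_nonneg (one_div_pos.2 hj.mu_pos).le (abs_nonneg _)
      linarith [hj.mono z huw]
    · have hanti := hj.anti z huw
      simp only at hanti
      rw [abs_of_nonneg (sub_nonneg.2 huw), one_div_mul_eq_div, sub_div]
      linarith

lemma hasDerivAt_prim (hj : DualIntegrand j μ α β ν) (z : X) (u : ℝ) :
    HasDerivAt (prim j z) (j z u) u := hj.lipIntegrand.hasDerivAt_prim z u

lemma exists_quadratic_le_prim (hj : DualIntegrand j μ α β ν) :
    ∃ m > 0, ∃ C, ∀ z u, m * u ^ 2 - C ≤ prim j z u := by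
  have hm : 0 < min α β := lt_min hj.alpha_pos hj.beta_pos
  obtain ⟨C, hC⟩ := hj.asymp (min α β / 4) (by positivity)
  refine ⟨min α β / 4, by positivity, C, fun z u => ?_⟩
  have hlower := (abs_le.1 (hC z u)).1
  have hmin := jumpSq_mono (min_le_left α β) (min_le_right α β) u
  rw [jumpSq_self] at hmin
  linarith

lemma bddAbove (hj : DualIntegrand j μ α β ν) (z : X) (v : ℝ) :
    BddAbove (range fun u : ℝ => v * u - prim j z u) := by
  obtain ⟨m, hm, C, hC⟩ := hj.exists_quadratic_le_prim
  exact bddAbove_mul_sub_of_quadratic_le hm (hC z) v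

lemma mul_sub_prim_le_conj (hj : DualIntegrand j μ α β ν) (z : X) (v u : ℝ) :
    v * u - prim j z u ≤ conj j z v := mul_sub_le_legendre (hj.bddAbove z v) u

lemma conj_nonneg (hj : DualIntegrand j μ α β ν) (z : X) (v : ℝ) : 0 ≤ conj j z v := by
  simpa [prim_zero] using hj.mul_sub_prim_le_conj z v 0

lemma exists_conj_le (hj : DualIntegrand j μ α β ν) :
    ∃ D ≥ 0, ∃ C, ∀ z v, conj j z v ≤ D * v ^ 2 + C := by
  obtain ⟨m, hm, C, hC⟩ := hj.exists_quadratic_le_prim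
  exact ⟨1 / (4 * m), by positivity, C, fun z v => legendre_le_of_quadratic_le hm (hC z) v⟩

lemma exists_half_jumpSq_sub_le_conj (hj : DualIntegrand j μ α β ν) {ε : ℝ} (hε : 0 < ε) :
    ∃ C, ∀ z v, 1 / 2 * jumpSq (1 / (α + ε)) (1 / (β + ε)) v - C ≤ conj j z v := by
  obtain ⟨C, hC⟩ := hj.asymp (ε / 2) (by positivity)
  refine ⟨C, fun z v => half_jumpSq_sub_le_legendre (add_pos hj.alpha_pos hε)
    (add_pos hj.beta_pos hε) (hj.bddAbove z v) fun u => ?_⟩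
  rw [← jumpSq_add_mul_sq]
  linarith [(abs_le.1 (hC z u)).2]

lemma measurable_conj (hj : DualIntegrand j μ α β ν) :
    Measurable fun x : X × ℝ => conj j x.1 x.2 := by
  have hrat : (fun x : X × ℝ => conj j x.1 x.2) =
      fun x => ⨆ q : ℚ, (x.2 * (q : ℝ) - prim j x.1 q) :=
    funext fun x => legendre_eq_iSup_rat (hj.lipIntegrand.continuous_prim x.1)
      (hj.bddAbove x.1 x.2)
  rw [hrat]
  exact Measurable.iSup fun q => (measurable_snd.mul_const _).sub
    ((hj.lipIntegrand.measurable_prim_left q).comp measurable_fst)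

lemma conjInt_nem (hj : DualIntegrand j μ α β ν) (u : Lp ℝ 2 ν) :
    conjInt j (hj.lipIntegrand.nem u) =
      inner ℝ u (hj.lipIntegrand.nem u) - ∫ z, prim j z (u z) ∂ν := by
  rw [conjInt, inner_eq_integral, ← integral_sub (integrable_mul_lp _ _)
    (hj.lipIntegrand.integrable_prim u)]
  refine integral_congr_ae ?_
  filter_upwards [hj.lipIntegrand.coeFn_nem u] with z hz
  rw [hz, mul_comm, conj, legendre_deriv (hj.hasDerivAt_prim z) (hj.mono z)]

section FiniteMeasure

variable [IsFiniteMeasure ν]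

lemma integrable_conj (hj : DualIntegrand j μ α β ν) (v : Lp ℝ 2 ν) :
    Integrable (fun z => conj j z (v z)) ν := by
  obtain ⟨D, -, C, hC⟩ := hj.exists_conj_le
  refine (((integrable_sq v).const_mul D).add (integrable_const C)).mono' ?_ ?_
  · exact (hj.measurable_conj.comp_aemeasurable
      (aemeasurable_id.prodMk (Lp.aestronglyMeasurable v).aemeasurable)).aestronglyMeasurable
  · refine Filter.Eventually.of_forall fun z => ?_
    rw [Real.norm_of_nonneg (hj.conj_nonneg _ _)]
    exact hC z (v z)

lemma convexOn_conjInt (hj : DualIntegrand j μ α β ν) :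
    ConvexOn ℝ univ (conjInt j : Lp ℝ 2 ν → ℝ) := by
  refine ⟨convex_univ, fun v _ w _ s t hs ht hst => ?_⟩
  rw [conjInt, conjInt, conjInt, smul_eq_mul, smul_eq_mul, ← integral_const_mul,
    ← integral_const_mul, ← integral_add ((hj.integrable_conj v).const_mul s)
      ((hj.integrable_conj w).const_mul t)]
  refine integral_mono_ae (hj.integrable_conj _)
    (((hj.integrable_conj v).const_mul s).add ((hj.integrable_conj w).const_mul t)) ?_
  filter_upwards [Lp.coeFn_add (s • v) (t • w), Lp.coeFn_smul s v, Lp.coeFn_smul t w]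
    with z h_add h_smul_v h_smul_w
  simp only [h_add, Pi.add_apply, h_smul_v, h_smul_w, Pi.smul_apply]
  exact (convexOn_legendre (hj.bddAbove z)).2 (mem_univ _) (mem_univ _) hs ht hst

lemma exists_conjInt_le (hj : DualIntegrand j μ α β ν) :
    ∃ D ≥ 0, ∃ C, ∀ v : Lp ℝ 2 ν, conjInt j v ≤ D * ‖v‖ ^ 2 + C := by
  obtain ⟨D, hD, C, hC⟩ := hj.exists_conj_le
  refine ⟨D, hD, ∫ _, C ∂ν, fun v => ?_⟩
  have hsq := (integrable_sq v).const_mul D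
  rw [conjInt, norm_sq_eq_integral, ← integral_const_mul, ← integral_add hsq (integrable_const C)]
  exact integral_mono (hj.integrable_conj v) (hsq.add (integrable_const C)) fun z => hC z (v z)

lemma continuous_conjInt (hj : DualIntegrand j μ α β ν) :
    Continuous (conjInt j : Lp ℝ 2 ν → ℝ) := by
  rw [← continuousOn_univ]
  have hbdd_imp := (hj.convexOn_conjInt.continuousOn_tfae isOpen_univ univ_nonempty).out 3 1
  obtain ⟨D, hD, C, hC⟩ := hj.exists_conjInt_le
  refine hbdd_imp.1 ⟨0, mem_univ _, D * 1 + C, Filter.eventually_map.2 ?_⟩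
  filter_upwards [Metric.ball_mem_nhds (0 : Lp ℝ 2 ν) one_pos] with v hv
  refine (hC v).trans (add_le_add_left (mul_le_mul_of_nonneg_left ?_ hD) C)
  exact pow_le_one₀ (norm_nonneg _) (mem_ball_zero_iff.1 hv).le

lemma conjInt_midpoint_le (hj : DualIntegrand j μ α β ν) (v w : Lp ℝ 2 ν) :
    conjInt j ((1 / 2 : ℝ) • (v + w)) ≤
      (conjInt j v + conjInt j w) / 2 - μ / 8 * ‖v - w‖ ^ 2 := by
  have hmean : Integrable (fun z => (conj j z (v z) + conj j z (w z)) / 2) ν :=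
    ((hj.integrable_conj v).add (hj.integrable_conj w)).div_const 2
  have hsq := (integrable_sq (v - w)).const_mul (μ / 8)
  rw [conjInt, conjInt, conjInt, norm_sq_eq_integral, ← integral_const_mul,
    ← integral_add (hj.integrable_conj v) (hj.integrable_conj w), ← integral_div,
    ← integral_sub hmean hsq]
  refine integral_mono_ae (hj.integrable_conj _) (hmean.sub hsq) ?_
  filter_upwards [coeFn_half_smul_add v w, Lp.coeFn_sub v w] with z h_half h_sub
  simp only [h_half, h_sub, Pi.sub_apply]
  exact legendre_midpoint_le hj.mu_pos (hj.hasDerivAt_prim z) (hj.anti z) (hj.bddAbove z) _ _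

lemma exists_half_jumpForm_sub_le_conjInt (hj : DualIntegrand j μ α β ν) {ε : ℝ} (hε : 0 < ε) :
    ∃ C, ∀ v : Lp ℝ 2 ν, 1 / 2 * jumpForm (1 / (α + ε)) (1 / (β + ε)) v - C ≤ conjInt j v := by
  obtain ⟨C, hC⟩ := hj.exists_half_jumpSq_sub_le_conj hε
  refine ⟨∫ _, C ∂ν, fun v => ?_⟩
  have hjump := (integrable_jumpSq (1 / (α + ε)) (1 / (β + ε)) v).const_mul (1 / 2)
  rw [jumpForm_eq_integral, ← integral_const_mul, ← integral_sub hjump (integrable_const C)]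
  exact integral_mono (hjump.sub (integrable_const C)) (hj.integrable_conj v) fun z => hC z (v z)

/-- Testing with `j(·, u)` turns the subgradient inequality into equality in Young's inequality
almost everywhere. -/
lemma eq_nem_of_subgradient (hj : DualIntegrand j μ α β ν) {u v : Lp ℝ 2 ν}
    (h : ∀ w : Lp ℝ 2 ν, inner ℝ u (w - v) ≤ conjInt j w - conjInt j v) :
    v = hj.lipIntegrand.nem u := by
  have hconj := hj.integrable_conj v
  have hprim := hj.lipIntegrand.integrable_prim u
  have hmul := integrable_mul_lp u v
  have hdiff : Integrable (fun z => conj j z (v z) - u z * v z) ν := hconj.sub hmul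
  have hyoung : ∀ z, 0 ≤ conj j z (v z) - u z * v z + prim j z (u z) := fun z => by
    linarith [hj.mul_sub_prim_le_conj z (v z) (u z)]
  have hzero : ∫ z, (conj j z (v z) - u z * v z + prim j z (u z)) ∂ν = 0 := by
    refine le_antisymm ?_ (integral_nonneg hyoung)
    have htest := h (hj.lipIntegrand.nem u)
    rw [inner_sub_right, hj.conjInt_nem, conjInt, inner_eq_integral u v] at htest
    rw [integral_add hdiff hprim, integral_sub hconj hmul]
    linarith
  refine Lp.ext ?_
  filter_upwards [(integral_eq_zero_iff_of_nonneg hyoung (hdiff.add hprim)).1 hzero,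
    hj.lipIntegrand.coeFn_nem u] with z hz hnem
  rw [hnem]
  refine eq_deriv_of_legendre_eq (hj.bddAbove z _) (hj.hasDerivAt_prim z (u z)) ?_
  rw [← conj]
  rw [Pi.zero_apply] at hz
  linarith

end FiniteMeasure

end DualIntegrand

end Conjugate

/-! ### Trigonometric functions on the cylinder -/

/-- `sin` for `true` and `cos` for `false`: one family for both factors of the eigenfunctions
`φ_{(m,n)}`, `ψ_{(m,n)}` and of their derivatives. -/
def trig (σ : Bool) (x : ℝ) : ℝ := bif σ then Real.sin x else Real.cos x

/-- The sign in the addition formula `trig_mul_trig` and in the derivative of `trig σ`: `-1` for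
the sine and `1` for the cosine. -/
def trigSign (σ : Bool) : ℝ := bif σ then -1 else 1

@[fun_prop] lemma continuous_trig (σ : Bool) : Continuous (trig σ) := by
  cases σ
  · exact Real.continuous_cos
  · exact Real.continuous_sin

lemma trig_mul_trig (σ : Bool) (x y : ℝ) :
    trig σ x * trig σ y = 1 / 2 * Real.cos (x - y) + trigSign σ / 2 * Real.cos (x + y) := by
  cases σ <;> simp only [trig, trigSign, cond_false, cond_true, Real.cos_sub, Real.cos_add] <;> ring

lemma integral_cos_int_mul_pi {k : ℤ} (hk : k ≠ 0) :
    ∫ s in (0 : ℝ)..Real.pi, Real.cos (k * s) = 0 := by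
  rw [intervalIntegral.integral_comp_mul_left _ (Int.cast_ne_zero.2 hk), integral_cos,
    Real.sin_int_mul_pi, mul_zero, Real.sin_zero, sub_zero, smul_zero]

lemma integral_cos_int_mul_two_pi {k : ℤ} (hk : k ≠ 0) :
    ∫ s in (0 : ℝ)..(2 * Real.pi), Real.cos (k * s) = 0 := by
  have hsin : Real.sin (k * (2 * Real.pi)) = 0 := by
    simpa using Real.sin_periodic.int_mul_eq k
  rw [intervalIntegral.integral_comp_mul_left _ (Int.cast_ne_zero.2 hk), integral_cos, hsin,
    mul_zero, Real.sin_zero, sub_zero, smul_zero]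

lemma integral_sin_int_mul_two_pi (k : ℤ) :
    ∫ s in (0 : ℝ)..(2 * Real.pi), Real.sin (k * s) = 0 := by
  rcases eq_or_ne k 0 with rfl | hk
  · simp
  · rw [intervalIntegral.integral_comp_mul_left _ (Int.cast_ne_zero.2 hk), integral_sin,
      Real.cos_int_mul_two_pi, mul_zero, Real.cos_zero, sub_self, smul_zero]

lemma integral_trig_mul_trig (σ : Bool) (m n : ℤ) (a b : ℝ) :
    ∫ s in a..b, trig σ (m * s) * trig σ (n * s) =
      1 / 2 * (∫ s in a..b, Real.cos ((m - n : ℤ) * s)) +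
        trigSign σ / 2 * ∫ s in a..b, Real.cos ((m + n : ℤ) * s) := by
  rw [← intervalIntegral.integral_const_mul, ← intervalIntegral.integral_const_mul,
    ← intervalIntegral.integral_add ((by fun_prop : Continuous _).intervalIntegrable _ _)
      ((by fun_prop : Continuous _).intervalIntegrable _ _)]
  simp_rw [trig_mul_trig, Int.cast_sub, Int.cast_add, sub_mul, add_mul]

lemma integral_trig_mul_trig_pi (σ : Bool) {m n : ℕ} (hm : 1 ≤ m) :
    ∫ s in (0 : ℝ)..Real.pi, trig σ (m * s) * trig σ (n * s) =
      if m = n then Real.pi / 2 else 0 := by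
  have h := integral_trig_mul_trig σ m n 0 Real.pi
  rw [integral_cos_int_mul_pi (k := m + n) (by omega), mul_zero, add_zero] at h
  simp only [Int.cast_natCast] at h
  rw [h]
  split_ifs with hmn
  · simp [hmn, div_eq_inv_mul]
  · rw [integral_cos_int_mul_pi (by omega), mul_zero]

lemma integral_trig_sq_two_pi (τ : Bool) {n : ℕ} (hn : 1 ≤ n) :
    ∫ s in (0 : ℝ)..(2 * Real.pi), trig τ (n * s) * trig τ (n * s) = Real.pi := by
  have h := integral_trig_mul_trig τ n n 0 (2 * Real.pi)
  rw [integral_cos_int_mul_two_pi (k := n + n) (by omega), mul_zero, add_zero] at h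
  simp only [Int.cast_natCast] at h
  rw [h]
  simp

lemma integral_sin_mul_cos_two_pi (m n : ℤ) :
    ∫ s in (0 : ℝ)..(2 * Real.pi), Real.sin (m * s) * Real.cos (n * s) = 0 := by
  have hprod (s : ℝ) : Real.sin (m * s) * Real.cos (n * s) =
      1 / 2 * Real.sin ((m - n : ℤ) * s) + 1 / 2 * Real.sin ((m + n : ℤ) * s) := by
    rw [Int.cast_sub, Int.cast_add, sub_mul, add_mul, Real.sin_sub, Real.sin_add]
    ring
  simp_rw [hprod]
  rw [intervalIntegral.integral_add ((by fun_prop : Continuous _).intervalIntegrable _ _)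
    ((by fun_prop : Continuous _).intervalIntegrable _ _), intervalIntegral.integral_const_mul,
    intervalIntegral.integral_const_mul, integral_sin_int_mul_two_pi, integral_sin_int_mul_two_pi,
    mul_zero, add_zero]

lemma integral_trig_mul_trig_two_pi_eq_zero {τ τ' : Bool} {n n' : ℕ} (h : (n, τ) ≠ (n', τ')) :
    ∫ s in (0 : ℝ)..(2 * Real.pi), trig τ (n * s) * trig τ' (n' * s) = 0 := by
  rcases eq_or_ne τ τ' with rfl | hτ
  · have hn : n ≠ n' := fun h' => h (by rw [h'])
    have := integral_trig_mul_trig τ n n' 0 (2 * Real.pi)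
    rwa [integral_cos_int_mul_two_pi (k := n - n') (by omega),
      integral_cos_int_mul_two_pi (k := n + n') (by omega), mul_zero, mul_zero, add_zero] at this
  · have hsc := integral_sin_mul_cos_two_pi
    cases τ <;> cases τ' <;>
      simp only [ne_eq, not_true_eq_false, trig, cond_true, cond_false] at hτ ⊢
    · simpa [mul_comm] using hsc n' n
    · simpa using hsc n n'

lemma integral_cyl_mul (f g : ℝ → ℝ) :
    ∫ z, f z.1 * g z.2 ∂cyl =
      (∫ s in (0 : ℝ)..Real.pi, f s) * ∫ t in (0 : ℝ)..(2 * Real.pi), g t := by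
  rw [cyl, Measure.volume_eq_prod, ← Measure.prod_restrict, integral_prod_mul,
    integral_Icc_eq_integral_Ioc, integral_Icc_eq_integral_Ioc,
    intervalIntegral.integral_of_le Real.pi_pos.le,
    intervalIntegral.integral_of_le Real.two_pi_pos.le]

/-- The function `(√2/π) trig_σ(ms) trig_τ(nt)`: for `σ = true` it is `φ_{(m,n)}` or `ψ_{(m,n)}`,
for `σ = false` it is proportional to an `s`-derivative of one of these. -/
def waveFun (m n : ℕ) (σ τ : Bool) (z : ℝ × ℝ) : ℝ :=
  Real.sqrt 2 / Real.pi * (trig σ (m * z.1) * trig τ (n * z.2))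

lemma continuous_waveFun (m n : ℕ) (σ τ : Bool) : Continuous (waveFun m n σ τ) := by
  unfold waveFun
  fun_prop

/-- The class of `waveFun` in `𝓗`. -/
def wave (m n : ℕ) (σ τ : Bool) : HSpace :=
  (memLp_of_continuous (continuous_waveFun m n σ τ)).toLp _

lemma phi_eq_wave (m n : ℕ) : phi m n = wave m n true false := rfl

lemma inner_toLp_left {f : ℝ × ℝ → ℝ} (hf : Continuous f) (u : HSpace) :
    inner ℝ ((memLp_of_continuous hf).toLp f : HSpace) u = ∫ z, u z * f z ∂cyl := by
  rw [inner_eq_integral]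
  refine integral_congr_ae ?_
  filter_upwards [(memLp_of_continuous hf).coeFn_toLp] with z hz
  rw [hz, mul_comm]

lemma inner_wave_left (m n : ℕ) (σ τ : Bool) (u : HSpace) :
    inner ℝ (wave m n σ τ) u = ∫ z, u z * waveFun m n σ τ z ∂cyl :=
  inner_toLp_left (continuous_waveFun m n σ τ) u

lemma inner_wave_wave (m n m' n' : ℕ) (σ τ τ' : Bool) :
    inner ℝ (wave m n σ τ) (wave m' n' σ τ') = (Real.sqrt 2 / Real.pi) ^ 2 *
      ((∫ s in (0 : ℝ)..Real.pi, trig σ (m * s) * trig σ (m' * s)) *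
        ∫ t in (0 : ℝ)..(2 * Real.pi), trig τ (n * t) * trig τ' (n' * t)) := by
  rw [inner_wave_left, ← integral_cyl_mul (fun s => trig σ (m * s) * trig σ (m' * s))
    (fun t => trig τ (n * t) * trig τ' (n' * t)), ← integral_const_mul]
  refine integral_congr_ae ?_
  filter_upwards [(memLp_of_continuous (continuous_waveFun m' n' σ τ')).coeFn_toLp] with z hz
  rw [wave, hz, waveFun, waveFun]
  ring

lemma inner_wave_eq_zero {m n m' n' : ℕ} (hm : 1 ≤ m) (σ : Bool) {τ τ' : Bool}
    (h : (m, n, τ) ≠ (m', n', τ')) : inner ℝ (wave m n σ τ) (wave m' n' σ τ') = 0 := by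
  rw [inner_wave_wave]
  by_cases hm' : m = m'
  · rw [integral_trig_mul_trig_two_pi_eq_zero fun h' => h (by rw [hm', h']), mul_zero, mul_zero]
  · rw [integral_trig_mul_trig_pi σ hm, if_neg hm', zero_mul, mul_zero]

lemma norm_wave_congr_space {m : ℕ} (hm : 1 ≤ m) (n : ℕ) (σ σ' τ : Bool) :
    ‖wave m n σ τ‖ = ‖wave m n σ' τ‖ := by
  refine (sq_eq_sq₀ (norm_nonneg _) (norm_nonneg _)).1 ?_
  rw [← real_inner_self_eq_norm_sq, ← real_inner_self_eq_norm_sq, inner_wave_wave, inner_wave_wave,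
    integral_trig_mul_trig_pi σ hm, integral_trig_mul_trig_pi σ' hm]

lemma norm_wave_congr_time (m : ℕ) {n : ℕ} (hn : 1 ≤ n) (σ τ τ' : Bool) :
    ‖wave m n σ τ‖ = ‖wave m n σ τ'‖ := by
  refine (sq_eq_sq₀ (norm_nonneg _) (norm_nonneg _)).1 ?_
  rw [← real_inner_self_eq_norm_sq, ← real_inner_self_eq_norm_sq, inner_wave_wave, inner_wave_wave,
    integral_trig_sq_two_pi τ hn, integral_trig_sq_two_pi τ' hn]

lemma wave_zero_sin (m : ℕ) (σ : Bool) : wave m 0 σ true = 0 := by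
  rw [← norm_eq_zero, ← sq_eq_zero_iff, ← real_inner_self_eq_norm_sq, inner_wave_wave]
  simp [trig]

lemma phi_ne_zero {m : ℕ} (hm : 1 ≤ m) (n : ℕ) : phi m n ≠ 0 := by
  have htime : ∫ t in (0 : ℝ)..(2 * Real.pi), trig false (n * t) * trig false (n * t) ≠ 0 := by
    rcases Nat.eq_zero_or_pos n with rfl | hn
    · simp [trig, Real.pi_ne_zero]
    · rw [integral_trig_sq_two_pi false hn]
      exact Real.pi_ne_zero
  have := Real.pi_ne_zero
  rw [phi_eq_wave, ← norm_ne_zero_iff, ← pow_ne_zero_iff two_ne_zero, ← real_inner_self_eq_norm_sq,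
    inner_wave_wave, integral_trig_mul_trig_pi true hm, if_pos rfl]
  positivity

/-! ### The normalised eigenfunctions and their derivatives -/

/-- Indices `((m, n), τ)` of the eigenfunctions: `τ = false` for `φ_{(m,n)}` and `τ = true` for
`ψ_{(m,n)}`. -/
abbrev Mode : Type := (ℕ+ × ℕ) × Bool

/-- The eigenvalue `m² - n²` of a mode. -/
def eig (i : Mode) : ℝ := ((i.1.1 : ℕ) : ℝ) ^ 2 - (i.1.2 : ℝ) ^ 2

/-- The eigenfunction `φ_{(m,n)}` or `ψ_{(m,n)}` of a mode. -/
def modeVec (i : Mode) : HSpace := wave i.1.1 i.1.2 true i.2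

/-- The normalised eigenfunctions; as `‖0‖⁻¹ = 0`, the mode of `ψ_{(m,0)} = 0` gives `0`. -/
def eigVec (i : Mode) : HSpace := ‖modeVec i‖⁻¹ • modeVec i

/-- `m⁻¹` times the `s`-derivatives of the normalised eigenfunctions. -/
def sVec (i : Mode) : HSpace := ‖modeVec i‖⁻¹ • wave i.1.1 i.1.2 false i.2

/-- `n⁻¹` times the `t`-derivatives of the normalised eigenfunctions, and `0` for `n = 0`. -/
def tVec (i : Mode) : HSpace :=
  (‖modeVec i‖⁻¹ * -trigSign i.2) • wave i.1.1 i.1.2 true (!i.2)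

lemma one_le_space (i : Mode) : 1 ≤ (i.1.1 : ℕ) := i.1.1.pos

lemma Mode.coe_ne {i j : Mode} (h : i ≠ j) :
    ((i.1.1 : ℕ), i.1.2, i.2) ≠ ((j.1.1 : ℕ), j.1.2, j.2) := by
  intro h'
  simp only [Prod.mk.injEq] at h'
  exact h (Prod.ext (Prod.ext (PNat.eq h'.1) h'.2.1) h'.2.2)

lemma eigVec_eq_zero_or_norm_eq_one (i : Mode) : eigVec i = 0 ∨ ‖eigVec i‖ = 1 := by
  rcases eq_or_ne (modeVec i) 0 with h | h
  · exact Or.inl (by rw [eigVec, h, smul_zero])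
  · exact Or.inr (norm_smul_inv_norm (𝕜 := ℝ) h)

lemma norm_sVec (i : Mode) : ‖sVec i‖ = ‖eigVec i‖ := by
  rw [sVec, norm_smul, norm_wave_congr_space (one_le_space i) _ false true, ← norm_smul]
  rfl

lemma tVec_eq_zero {i : Mode} (hi : i.1.2 = 0) : tVec i = 0 := by
  rcases hτ : i.2 with - | -
  · rw [tVec, hi, hτ, Bool.not_false, wave_zero_sin, smul_zero]
  · rw [tVec, modeVec, hi, hτ, wave_zero_sin, norm_zero, inv_zero, zero_mul, zero_smul]

lemma norm_tVec {i : Mode} (hi : 1 ≤ i.1.2) : ‖tVec i‖ = ‖eigVec i‖ := by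
  have hsign : ‖trigSign i.2‖ = 1 := by cases i.2 <;> simp [trigSign]
  rw [tVec, norm_smul, norm_mul, norm_neg, hsign, mul_one,
    norm_wave_congr_time _ hi true (!i.2) i.2, ← norm_smul]
  rfl

lemma orthonormalOrZero_eigVec : OrthonormalOrZero eigVec where
  inner_eq_zero i j hij := by
    rw [eigVec, eigVec, real_inner_smul_left, real_inner_smul_right, modeVec, modeVec,
      inner_wave_eq_zero (one_le_space i) true (Mode.coe_ne hij), mul_zero, mul_zero]
  eq_zero_or_norm_eq_one := eigVec_eq_zero_or_norm_eq_one

lemma orthonormalOrZero_sVec : OrthonormalOrZero sVec where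
  inner_eq_zero i j hij := by
    rw [sVec, sVec, real_inner_smul_left, real_inner_smul_right,
      inner_wave_eq_zero (one_le_space i) false (Mode.coe_ne hij), mul_zero, mul_zero]
  eq_zero_or_norm_eq_one i := by
    rw [← norm_eq_zero, norm_sVec, norm_eq_zero]
    exact eigVec_eq_zero_or_norm_eq_one i

lemma orthonormalOrZero_tVec : OrthonormalOrZero tVec where
  inner_eq_zero i j hij := by
    have hne : ((i.1.1 : ℕ), i.1.2, !i.2) ≠ ((j.1.1 : ℕ), j.1.2, !j.2) := by
      simpa only [ne_eq, Prod.mk.injEq, Bool.not_eq_not, Bool.not_eq_eq_eq_not, Bool.not_not]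
        using Mode.coe_ne hij
    rw [tVec, tVec, real_inner_smul_left, real_inner_smul_right,
      inner_wave_eq_zero (one_le_space i) true hne, mul_zero, mul_zero]
  eq_zero_or_norm_eq_one i := by
    rcases Nat.eq_zero_or_pos i.1.2 with hn | hn
    · exact Or.inl (tVec_eq_zero hn)
    · rw [← norm_eq_zero, norm_tVec hn, norm_eq_zero]
      exact eigVec_eq_zero_or_norm_eq_one i

/-- The eigenvalues of `(□ - d)⁻¹`. -/
def coef (d : ℝ) (i : Mode) : ℝ := 1 / (eig i - d)

lemma opL_eq_diagOp {d C : ℝ} (hc : ∀ i, |coef d i| ≤ C) (v : HSpace) :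
    opL d v = diagOp eigVec (coef d) v := by
  have hterm (i : ℕ+ × ℕ) (τ : Bool) :
      (coef d (i, τ) * inner ℝ (eigVec (i, τ)) v) • eigVec (i, τ) =
      (inner ℝ (modeVec (i, τ)) v / ‖modeVec (i, τ)‖ ^ 2
        / (((i.1 : ℕ) : ℝ) ^ 2 - (i.2 : ℝ) ^ 2 - d)) • modeVec (i, τ) := by
    rw [eigVec, real_inner_smul_left, smul_smul, coef, eig]
    congr 1
    ring
  have hsum := (orthonormalOrZero_eigVec.hasSum_diagOp hc v).prod_fiberwise
    fun i => hasSum_fintype _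
  rw [← hsum.tsum_eq, opL]
  refine tsum_congr fun i => ?_
  rw [Fintype.sum_bool, add_comm, hterm, hterm]
  rfl

/-! ### The eigenvalues in increasing order -/

lemma zero_mem_eigenvalues : (0 : ℤ) ∈ eigenvalues := ⟨1, 1, le_rfl, by norm_num⟩

lemma infinite_nonneg_eigenvalues : {j : ℕ | (j : ℤ) ∈ eigenvalues}.Infinite := by
  refine Set.infinite_of_injective_forall_mem (f := fun n : ℕ => 2 * n + 1)
    (fun a b hab => by simpa using hab) fun n => ⟨n + 1, n, by omega, ?_⟩
  push_cast
  ring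

lemma infinite_nonpos_eigenvalues : {j : ℕ | -(j : ℤ) ∈ eigenvalues}.Infinite := by
  refine Set.infinite_of_injective_forall_mem (f := fun n : ℕ => 2 * n + 3)
    (fun a b hab => by simpa using hab) fun n => ⟨n + 1, n + 2, by omega, ?_⟩
  push_cast
  ring

open Classical in
lemma lam_natCast (n : ℕ) : lam n = (Nat.nth (fun j : ℕ => (j : ℤ) ∈ eigenvalues) n : ℝ) := rfl

open Classical in
lemma lam_neg_natCast (n : ℕ) :
    lam (-(n : ℤ)) = -(Nat.nth (fun j : ℕ => -(j : ℤ) ∈ eigenvalues) n : ℝ) := by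
  cases n with
  | zero =>
    rw [Nat.cast_zero, neg_zero, ← Nat.cast_zero, lam_natCast,
      Nat.nth_zero_of_zero (by simpa using zero_mem_eigenvalues),
      Nat.nth_zero_of_zero (by simpa using zero_mem_eigenvalues), Nat.cast_zero, neg_zero]
  | succ n => rfl

lemma exists_mem_eigenvalues_eig_eq (i : Mode) : ∃ l ∈ eigenvalues, eig i = (l : ℝ) :=
  ⟨_, ⟨i.1.1, i.1.2, one_le_space i, rfl⟩, by rw [eig]; push_cast; rfl⟩

lemma exists_eig_eq_of_mem_eigenvalues {l : ℤ} (hl : l ∈ eigenvalues) :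
    ∃ i, eig i = l ∧ ‖eigVec i‖ = 1 := by
  obtain ⟨m, n, hm, rfl⟩ := hl
  have hphi : modeVec ((⟨m, hm⟩, n), false) ≠ 0 := phi_ne_zero hm n
  exact ⟨((⟨m, hm⟩, n), false), by rw [eig]; push_cast; rfl, norm_smul_inv_norm (𝕜 := ℝ) hphi⟩

lemma exists_eig_eq_lam (k : ℤ) : ∃ i, eig i = lam k ∧ ‖eigVec i‖ = 1 := by
  classical
  rcases k.eq_nat_or_neg with ⟨n, rfl | rfl⟩
  · simpa [lam_natCast] using exists_eig_eq_of_mem_eigenvalues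
      (Nat.nth_mem_of_infinite infinite_nonneg_eigenvalues n)
  · simpa [lam_neg_natCast] using exists_eig_eq_of_mem_eigenvalues
      (Nat.nth_mem_of_infinite infinite_nonpos_eigenvalues n)

lemma le_nth_or_nth_succ_le {q : ℕ → Prop} {j : ℕ} (hj : q j) (n : ℕ) :
    j ≤ Nat.nth q n ∨ Nat.nth q (n + 1) ≤ j := by
  rw [or_iff_not_imp_right, not_le]
  exact fun h => Nat.le_nth_of_lt_nth_succ h hj

lemma eig_le_or_le (k : ℤ) (i : Mode) : eig i ≤ lam (k - 1) ∨ lam k ≤ eig i := by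
  classical
  obtain ⟨l, hl, hil⟩ := exists_mem_eigenvalues_eig_eq i
  rw [hil]
  rcases lt_or_ge 0 k with hk | hk
  · obtain ⟨n, rfl⟩ : ∃ n : ℕ, k = (n + 1 : ℕ) := ⟨(k - 1).toNat, by omega⟩
    rw [show ((n + 1 : ℕ) : ℤ) - 1 = n by push_cast; ring, lam_natCast, lam_natCast]
    rcases lt_or_ge l 0 with hl0 | hl0
    · exact Or.inl ((Int.cast_nonpos.2 hl0.le).trans (Nat.cast_nonneg _))
    · lift l to ℕ using hl0
      exact_mod_cast le_nth_or_nth_succ_le hl n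
  · obtain ⟨n, rfl⟩ : ∃ n : ℕ, k = -(n : ℤ) := ⟨(-k).toNat, by omega⟩
    rw [show -(n : ℤ) - 1 = -((n + 1 : ℕ) : ℤ) by push_cast; ring, lam_neg_natCast,
      lam_neg_natCast]
    rcases lt_or_ge 0 l with hl0 | hl0
    · exact Or.inr ((neg_nonpos.2 (Nat.cast_nonneg _)).trans (Int.cast_nonneg hl0.le))
    · obtain ⟨j, rfl⟩ : ∃ j : ℕ, l = -(j : ℤ) := ⟨(-l).toNat, by omega⟩
      rw [Int.cast_neg, Int.cast_natCast, neg_le_neg_iff, neg_le_neg_iff, Nat.cast_le, Nat.cast_le]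
      exact (le_nth_or_nth_succ_le (q := fun j : ℕ => -(j : ℤ) ∈ eigenvalues) hl n).symm

lemma nonneg_lam_or_lam_nonpos (k : ℤ) : 0 ≤ lam (k - 1) ∨ lam k ≤ 0 := by
  simpa [eig] using eig_le_or_le k ((1, 1), false)

lemma add_le_abs_eig {i : Mode} (hi : (i.1.1 : ℕ) ≠ i.1.2) :
    ((i.1.1 : ℕ) : ℝ) + i.1.2 ≤ |eig i| := by
  have hfactor : eig i = (((i.1.1 : ℕ) : ℝ) + i.1.2) * (((i.1.1 : ℕ) : ℝ) - i.1.2) := by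
    rw [eig]; ring
  have hdiff : (1 : ℝ) ≤ |((i.1.1 : ℕ) : ℝ) - i.1.2| := by
    exact_mod_cast Int.one_le_abs (z := ((i.1.1 : ℕ) : ℤ) - i.1.2) (by omega)
  rw [hfactor, abs_mul, abs_of_nonneg (a := ((i.1.1 : ℕ) : ℝ) + i.1.2) (by positivity)]
  exact le_mul_of_one_le_right (by positivity) hdiff

lemma finite_setOf_abs_eig_le (M : ℝ) :
    {i : Mode | (i.1.1 : ℕ) ≠ i.1.2 ∧ |eig i| ≤ M}.Finite := by
  have hbox := (((Set.finite_Iic ⌊M⌋₊).preimage PNat.coe_injective.injOn).prod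
    (Set.finite_Iic ⌊M⌋₊)).prod (Set.finite_univ (α := Bool))
  refine hbox.subset fun i hi => ?_
  have hle : (((i.1.1 : ℕ) + i.1.2 : ℕ) : ℝ) ≤ M := by
    push_cast
    exact (add_le_abs_eig hi.1).trans hi.2
  have hfloor := Nat.le_floor hle
  simp only [Set.mem_prod, Set.mem_preimage, Set.mem_Iic, Set.mem_univ, and_true]
  omega

/-! ### The operator `L = (□ - d)⁻¹` for `d` in a spectral gap -/

/-- `d` lies strictly between the consecutive eigenvalues `λ_{k-1}` and `λ_k`. -/
def InGap (k : ℤ) (d : ℝ) : Prop := lam (k - 1) < d ∧ d < lam k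

section Gap

variable {k : ℤ} {d : ℝ}

/-- The distance from a point `d` of the gap to its endpoints, a lower bound for the distance from
`d` to the spectrum of `□`. -/
def gapDist (k : ℤ) (d : ℝ) : ℝ := min (d - lam (k - 1)) (lam k - d)

lemma gapDist_le (k : ℤ) (d : ℝ) (i : Mode) : gapDist k d ≤ |eig i - d| := by
  rcases eig_le_or_le k i with h | h
  · rw [abs_sub_comm]
    exact (min_le_left _ _).trans ((sub_le_sub_left h d).trans (le_abs_self _))
  · exact (min_le_right _ _).trans ((sub_le_sub_right h d).trans (le_abs_self _))

namespace InGap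

lemma gapDist_pos (hd : InGap k d) : 0 < gapDist k d :=
  lt_min (sub_pos.2 hd.1) (sub_pos.2 hd.2)

lemma eig_sub_ne_zero (hd : InGap k d) (i : Mode) : eig i - d ≠ 0 :=
  abs_pos.1 (hd.gapDist_pos.trans_le (gapDist_le k d i))

lemma abs_coef_le (hd : InGap k d) (i : Mode) : |coef d i| ≤ 1 / gapDist k d := by
  rw [coef, abs_div, abs_one]
  exact one_div_le_one_div_of_le hd.gapDist_pos (gapDist_le k d i)

lemma coef_le (hd : InGap k d) (i : Mode) : coef d i ≤ 1 / (lam k - d) := by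
  rcases eig_le_or_le k i with h | h
  · exact (one_div_neg.2 (by linarith [hd.1])).le.trans (one_div_pos.2 (sub_pos.2 hd.2)).le
  · exact one_div_le_one_div_of_le (sub_pos.2 hd.2) (sub_le_sub_right h d)

end InGap

/-- The diagonal `m = n`, where the coefficient is `-1/d`, is the only infinite family on which the
coefficients of `L` stay away from `0`. -/
lemma finite_setOf_lt_coef {κ : ℝ} (hκ : 0 < κ) (hκd : -1 / d < κ) :
    {i | κ < coef d i}.Finite := by
  refine (finite_setOf_abs_eig_le (|d| + 1 / κ)).subset fun i hi => ?_
  have hi : κ < 1 / (eig i - d) := hi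
  have hpos : 0 < eig i - d := one_div_pos.1 (hκ.trans hi)
  refine ⟨fun hdiag => ?_, ?_⟩
  · rw [eig, hdiag, sub_self, zero_sub, one_div_neg_eq_neg_one_div, ← neg_div] at hi
    exact lt_asymm hκd hi
  · have hsub : |eig i - d| ≤ 1 / κ := by
      rw [abs_of_pos hpos]
      exact ((lt_one_div hκ hpos).1 hi).le
    linarith [abs_add_le d (eig i - d), congrArg abs (add_sub_cancel d (eig i))]

namespace InGap

/-- `L = (□ - d)⁻¹` as a bounded operator. -/
def clm (hd : InGap k d) : HSpace →L[ℝ] HSpace :=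
  orthonormalOrZero_eigVec.diagCLM hd.abs_coef_le

lemma clm_apply (hd : InGap k d) (v : HSpace) : hd.clm v = opL d v :=
  (opL_eq_diagOp hd.abs_coef_le v).symm

lemma inner_clm_comm (hd : InGap k d) (v w : HSpace) :
    inner ℝ (hd.clm v) w = inner ℝ v (hd.clm w) :=
  orthonormalOrZero_eigVec.inner_diagOp_comm hd.abs_coef_le v w

lemma inner_eigVec_clm (hd : InGap k d) (v : HSpace) (i : Mode) :
    inner ℝ (eigVec i) (hd.clm v) = coef d i * inner ℝ (eigVec i) v :=
  orthonormalOrZero_eigVec.inner_diagOp hd.abs_coef_le v i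

lemma hasSum_clm (hd : InGap k d) (v : HSpace) :
    HasSum (fun i => (coef d i * inner ℝ (eigVec i) v) • eigVec i) (hd.clm v) :=
  orthonormalOrZero_eigVec.hasSum_diagOp hd.abs_coef_le v

lemma exists_inner_clm_self_le (hd : InGap k d) {κ : ℝ} (hκ : max 0 (-1 / d) < κ) :
    ∃ (n : ℕ) (T : HSpace →L[ℝ] EuclideanSpace ℝ (Fin n)) (C : ℝ), ∀ v,
      inner ℝ (hd.clm v) v ≤ κ * ‖v‖ ^ 2 + C * ‖T v‖ ^ 2 := by
  obtain ⟨hκ0, hκd⟩ := max_lt_iff.1 hκ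
  obtain ⟨n, T, hT⟩ := orthonormalOrZero_eigVec.exists_inner_diagOp_self_le hd.abs_coef_le hκ0.le
    (finite_setOf_lt_coef hκ0 hκd) fun i hi => not_lt.1 hi
  exact ⟨n, T, _, hT⟩

lemma inner_clm_self_le (hd : InGap k d) (v : HSpace) :
    inner ℝ (hd.clm v) v ≤ 1 / (lam k - d) * ‖v‖ ^ 2 := by
  simpa [clm] using
    orthonormalOrZero_eigVec.inner_diagOp_self_le hd.abs_coef_le
      (one_div_pos.2 (sub_pos.2 hd.2)).le ∅ (fun i _ => hd.coef_le i) v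

lemma exists_inner_clm_self_eq (hd : InGap k d) :
    ∃ v : HSpace, ‖v‖ = 1 ∧ inner ℝ (hd.clm v) v = 1 / (lam k - d) := by
  obtain ⟨i, hi, hnorm⟩ := exists_eig_eq_lam k
  refine ⟨eigVec i, hnorm, ?_⟩
  rw [hd.inner_clm_comm, hd.inner_eigVec_clm, real_inner_self_eq_norm_sq, hnorm, coef, hi,
    one_pow, mul_one]

lemma resolvent_identity (hd : InGap k d) {d' : ℝ} (hd' : InGap k d') (v : HSpace) :
    hd'.clm (v + (d - d') • hd.clm v) = hd.clm v := by
  refine (hd'.hasSum_clm _).unique ?_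
  convert hd.hasSum_clm v using 3 with i
  have hne := hd.eig_sub_ne_zero i
  have hne' := hd'.eig_sub_ne_zero i
  rw [inner_add_right, real_inner_smul_right, hd.inner_eigVec_clm, coef, coef]
  field_simp
  ring

end InGap

end Gap

/-! ### The quadratic form `⟨(L - μ)v, v⟩` and the function `ǎ` -/

section Curve

lemma funG_eq_jumpForm (r : ℝ) (v : HSpace) : funG r v = jumpForm 1 r v := by
  rw [funG, jumpForm, one_mul]

lemma continuousAt_of_antitoneOn_of_monotoneOn_mul {f : ℝ → ℝ} (hf : AntitoneOn f (Ioi 0))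
    (hmul : MonotoneOn (fun x => x * f x) (Ioi 0)) {r : ℝ} (hr : 0 < r) : ContinuousAt f r := by
  have hscale : Filter.Tendsto (fun x => r / x * f r) (nhds r) (nhds (f r)) := by
    have hcont : ContinuousAt (fun x => r / x * f r) r :=
      (continuousAt_const.div continuousAt_id hr.ne').mul_const _
    simpa [ContinuousAt, div_self hr.ne'] using hcont
  have hlower := (tendsto_const_nhds (x := f r)).min hscale
  have hupper := (tendsto_const_nhds (x := f r)).max hscale
  rw [min_self] at hlower
  rw [max_self] at hupper
  have hbetween : ∀ x, 0 < x → min (f r) (r / x * f r) ≤ f x ∧ f x ≤ max (f r) (r / x * f r) := by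
    intro x hx
    rcases le_total r x with hrx | hxr
    · have hle : r / x * f r ≤ f x := by
        rw [div_mul_eq_mul_div, div_le_iff₀' hx]
        exact hmul hr hx hrx
      exact ⟨min_le_of_right_le hle, le_max_of_le_left (hf hr hx hrx)⟩
    · have hle : f x ≤ r / x * f r := by
        rw [div_mul_eq_mul_div, le_div_iff₀' hx]
        exact hmul hx hr hxr
      exact ⟨min_le_of_left_le (hf hx hr hxr), le_max_of_le_right hle⟩
  refine tendsto_of_tendsto_of_tendsto_of_le_of_le' hlower hupper ?_ ?_
  · filter_upwards [lt_mem_nhds hr] with x hx using (hbetween x hx).1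
  · filter_upwards [lt_mem_nhds hr] with x hx using (hbetween x hx).2

variable {k : ℤ} {ε₁ ε₂ : ℝ}

/-- The coordinate `1/(x - p_k) - μ` on `]p_k, q_k[`, in which `𝓒_k` is the curve of the points
`(ǎ(r), r ǎ(r))`. -/
def dualCoord (k : ℤ) (ε₁ ε₂ x : ℝ) : ℝ := 1 / (x - pk k ε₁) - mu k ε₁ ε₂

lemma dualCoord_le_dualCoord {x y : ℝ} (hx : pk k ε₁ < x) (hxy : x ≤ y) :
    dualCoord k ε₁ ε₂ y ≤ dualCoord k ε₁ ε₂ x :=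
  sub_le_sub_right (one_div_le_one_div_of_le (sub_pos.2 hx) (sub_le_sub_right hxy _)) _

lemma dualCoord_lt_dualCoord {x y : ℝ} (hx : pk k ε₁ < x) (hxy : x < y) :
    dualCoord k ε₁ ε₂ y < dualCoord k ε₁ ε₂ x :=
  sub_lt_sub_right (one_div_lt_one_div_of_lt (sub_pos.2 hx) (sub_lt_sub_right hxy _)) _

namespace Admissible

lemma inGap (h : Admissible k ε₁ ε₂) : InGap k (pk k ε₁) :=
  ⟨by rw [pk]; linarith [h.1], by rw [pk]; linarith [h.2.1]⟩

lemma mu_pos (h : Admissible k ε₁ ε₂) : 0 < mu k ε₁ ε₂ :=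
  add_pos_of_nonneg_of_pos (le_max_left _ _) h.2.2.1

lemma dualCoord_pos (h : Admissible k ε₁ ε₂) {x : ℝ} (hx : x ∈ Ioo (pk k ε₁) (qk k ε₁ ε₂)) :
    0 < dualCoord k ε₁ ε₂ x := by
  have hlt : x - pk k ε₁ < 1 / mu k ε₁ ε₂ := sub_lt_iff_lt_add'.2 hx.2
  exact sub_pos.2 ((lt_one_div (sub_pos.2 hx.1) h.mu_pos).1 hlt)

lemma dualCoord_lam_pos (h : Admissible k ε₁ ε₂) : 0 < dualCoord k ε₁ ε₂ (lam k) := by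
  have hε₂ := h.2.2.2
  rw [sub_sub] at hε₂
  rw [dualCoord, mu, pk]
  rw [pk] at hε₂
  linarith

lemma funF_eq (h : Admissible k ε₁ ε₂) (v : HSpace) :
    funF k ε₁ ε₂ v = inner ℝ (h.inGap.clm v) v - mu k ε₁ ε₂ * ‖v‖ ^ 2 := by
  rw [funF, inner_sub_left, real_inner_smul_left, real_inner_self_eq_norm_sq, h.inGap.clm_apply]

/-- The bounded operator `L - μ`. -/
def shiftedClm (h : Admissible k ε₁ ε₂) : HSpace →L[ℝ] HSpace :=
  h.inGap.clm - mu k ε₁ ε₂ • ContinuousLinearMap.id ℝ HSpace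

lemma inner_shiftedClm_comm (h : Admissible k ε₁ ε₂) (v w : HSpace) :
    inner ℝ (h.shiftedClm v) w = inner ℝ v (h.shiftedClm w) := by
  simp [shiftedClm, inner_sub_left, inner_sub_right, real_inner_smul_left, real_inner_smul_right,
    h.inGap.inner_clm_comm]

lemma funF_eq_inner_shiftedClm (h : Admissible k ε₁ ε₂) :
    funF k ε₁ ε₂ = fun v => inner ℝ (h.shiftedClm v) v := by
  funext v
  simp [funF, shiftedClm, h.inGap.clm_apply]

lemma continuous_funF (h : Admissible k ε₁ ε₂) : Continuous (funF k ε₁ ε₂) := by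
  rw [h.funF_eq_inner_shiftedClm]
  fun_prop

lemma funF_smul (h : Admissible k ε₁ ε₂) (c : ℝ) (v : HSpace) :
    funF k ε₁ ε₂ (c • v) = c ^ 2 * funF k ε₁ ε₂ v := by
  rw [h.funF_eq_inner_shiftedClm]
  simp only [map_smul, real_inner_smul_left, real_inner_smul_right]
  ring

lemma funF_midpoint (h : Admissible k ε₁ ε₂) (v w : HSpace) :
    funF k ε₁ ε₂ ((1 / 2 : ℝ) • (v + w)) =
      (funF k ε₁ ε₂ v + funF k ε₁ ε₂ w) / 2 - funF k ε₁ ε₂ (v - w) / 4 := by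
  rw [h.funF_eq_inner_shiftedClm]
  exact inner_self_midpoint h.inner_shiftedClm_comm v w

lemma exists_funF_le (h : Admissible k ε₁ ε₂) :
    ∃ (n : ℕ) (T : HSpace →L[ℝ] EuclideanSpace ℝ (Fin n)) (C : ℝ), ∀ v,
      funF k ε₁ ε₂ v ≤ -(ε₂ / 2) * ‖v‖ ^ 2 + C * ‖T v‖ ^ 2 := by
  have hκ : max 0 (-1 / pk k ε₁) < mu k ε₁ ε₂ - ε₂ / 2 := by
    rw [mu]; linarith [h.2.2.1]
  obtain ⟨n, T, C, hT⟩ := h.inGap.exists_inner_clm_self_le hκ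
  refine ⟨n, T, C, fun v => ?_⟩
  rw [h.funF_eq]
  linarith [hT v]

lemma funF_le (h : Admissible k ε₁ ε₂) (v : HSpace) :
    funF k ε₁ ε₂ v ≤ dualCoord k ε₁ ε₂ (lam k) * ‖v‖ ^ 2 := by
  rw [h.funF_eq, dualCoord, sub_mul]
  exact sub_le_sub_right (h.inGap.inner_clm_self_le v) _

lemma exists_ne_zero_funF_pos (h : Admissible k ε₁ ε₂) :
    ∃ v : HSpace, v ≠ 0 ∧ 0 < funF k ε₁ ε₂ v := by
  obtain ⟨v, hnorm, hv⟩ := h.inGap.exists_inner_clm_self_eq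
  refine ⟨v, ne_zero_of_norm_ne_zero (hnorm ▸ one_ne_zero), ?_⟩
  rw [h.funF_eq, hv, hnorm, one_pow, mul_one]
  exact h.dualCoord_lam_pos

lemma funF_le_mul_jumpForm (h : Admissible k ε₁ ε₂) {α β : ℝ} (hα : 0 < α) (hβ : 0 < β)
    (v : HSpace) : funF k ε₁ ε₂ v ≤ dualCoord k ε₁ ε₂ (lam k) / min α β * jumpForm α β v := by
  rw [div_mul_eq_mul_div, le_div_iff₀ (lt_min hα hβ)]
  calc funF k ε₁ ε₂ v * min α β ≤ dualCoord k ε₁ ε₂ (lam k) * ‖v‖ ^ 2 * min α β := by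
        gcongr
        exact h.funF_le v
    _ = dualCoord k ε₁ ε₂ (lam k) * (min α β * ‖v‖ ^ 2) := by ring
    _ ≤ dualCoord k ε₁ ε₂ (lam k) * jumpForm α β v :=
        mul_le_mul_of_nonneg_left (min_mul_norm_sq_le_jumpForm α β v) h.dualCoord_lam_pos.le

lemma bddAbove (h : Admissible k ε₁ ε₂) {r : ℝ} (hr : 0 < r) :
    BddAbove (range fun v : {v : HSpace // v ≠ 0} => funF k ε₁ ε₂ v.1 / funG r v.1) := by
  refine ⟨dualCoord k ε₁ ε₂ (lam k) / min 1 r, ?_⟩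
  rintro _ ⟨⟨v, hv⟩, rfl⟩
  simp only [funG_eq_jumpForm]
  exact (div_le_iff₀ (jumpForm_pos one_pos hr hv)).2 (h.funF_le_mul_jumpForm one_pos hr v)

lemma funF_le_acheck (h : Admissible k ε₁ ε₂) {r : ℝ} (hr : 0 < r) (v : HSpace) :
    funF k ε₁ ε₂ v ≤ acheck k ε₁ ε₂ r * jumpForm 1 r v := by
  rcases eq_or_ne v 0 with rfl | hv
  · simp [h.funF_eq, jumpForm_zero]
  · rw [← div_le_iff₀ (jumpForm_pos one_pos hr hv), ← funG_eq_jumpForm]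
    exact le_ciSup (h.bddAbove hr) ⟨v, hv⟩

lemma nonempty (h : Admissible k ε₁ ε₂) : Nonempty {v : HSpace // v ≠ 0} :=
  let ⟨v, hv, _⟩ := h.exists_ne_zero_funF_pos
  ⟨v, hv⟩

lemma acheck_le (h : Admissible k ε₁ ε₂) {r x : ℝ} (hr : 0 < r)
    (hx : ∀ v : HSpace, funF k ε₁ ε₂ v ≤ x * jumpForm 1 r v) : acheck k ε₁ ε₂ r ≤ x := by
  have := h.nonempty
  refine ciSup_le fun v => ?_
  rw [funG_eq_jumpForm, div_le_iff₀ (jumpForm_pos one_pos hr v.2)]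
  exact hx v.1

lemma acheck_pos (h : Admissible k ε₁ ε₂) {r : ℝ} (hr : 0 < r) : 0 < acheck k ε₁ ε₂ r := by
  obtain ⟨v, hv, hpos⟩ := h.exists_ne_zero_funF_pos
  exact pos_of_mul_pos_left (hpos.trans_le (h.funF_le_acheck hr v))
    (jumpForm_pos one_pos hr hv).le

lemma antitoneOn_acheck (h : Admissible k ε₁ ε₂) : AntitoneOn (acheck k ε₁ ε₂) (Ioi 0) :=
  fun _ hr _ hr' hrr => h.acheck_le hr' fun v => (h.funF_le_acheck hr v).trans
    (mul_le_mul_of_nonneg_left (jumpForm_mono le_rfl hrr v) (h.acheck_pos hr).le)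

lemma monotoneOn_mul_acheck (h : Admissible k ε₁ ε₂) :
    MonotoneOn (fun r => r * acheck k ε₁ ε₂ r) (Ioi 0) := by
  intro r hr r' hr' hrr
  change r * _ ≤ r' * _
  rw [← le_div_iff₀' hr, mul_div_right_comm]
  refine h.acheck_le hr fun v => (h.funF_le_acheck hr' v).trans ?_
  rw [mul_comm (r' / r), mul_assoc, mul_jumpForm (r' / r)]
  refine mul_le_mul_of_nonneg_left (jumpForm_mono ?_ ?_ v) (h.acheck_pos hr').le
  · rwa [mul_one, one_le_div hr]
  · rw [div_mul_cancel₀ _ (ne_of_gt hr)]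

lemma continuousAt_acheck (h : Admissible k ε₁ ε₂) {r : ℝ} (hr : 0 < r) :
    ContinuousAt (acheck k ε₁ ε₂) r :=
  continuousAt_of_antitoneOn_of_monotoneOn_mul h.antitoneOn_acheck h.monotoneOn_mul_acheck hr

lemma exists_norm_eq_one_lt_funF (h : Admissible k ε₁ ε₂) {r δ : ℝ} (hr : 0 < r) (hδ : 0 < δ) :
    ∃ v : HSpace, ‖v‖ = 1 ∧ (acheck k ε₁ ε₂ r - δ) * jumpForm 1 r v < funF k ε₁ ε₂ v := by
  have := h.nonempty
  obtain ⟨⟨v, hv⟩, hlt⟩ := exists_lt_of_lt_ciSup (sub_lt_self (acheck k ε₁ ε₂ r) hδ)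
  rw [funG_eq_jumpForm, lt_div_iff₀ (jumpForm_pos one_pos hr hv)] at hlt
  have hinv : 0 < ‖v‖⁻¹ := inv_pos.2 (norm_pos_iff.2 hv)
  refine ⟨‖v‖⁻¹ • v, norm_smul_inv_norm (𝕜 := ℝ) hv, ?_⟩
  rw [h.funF_smul, jumpForm_smul hinv.le, mul_left_comm]
  exact mul_lt_mul_of_pos_left hlt (pow_pos hinv 2)

lemma exists_funF_eq_acheck (h : Admissible k ε₁ ε₂) {r : ℝ} (hr : 0 < r) :
    ∃ v : HSpace, v ≠ 0 ∧ funF k ε₁ ε₂ v = acheck k ε₁ ε₂ r * jumpForm 1 r v := by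
  have hε₂ : 0 < ε₂ := h.2.2.1
  let Ψ : HSpace → ℝ := fun v => funF k ε₁ ε₂ v - acheck k ε₁ ε₂ r * jumpForm 1 r v
  have hΨ : Continuous Ψ := h.continuous_funF.sub ((continuous_jumpForm 1 r).const_mul _)
  have hΨ0 : ∀ v, Ψ v ≤ 0 := fun v => sub_nonpos.2 (h.funF_le_acheck hr v)
  obtain ⟨n, T, C, hT⟩ := h.exists_funF_le
  have hmid : ∀ v w : HSpace, (Ψ v + Ψ w) / 2 + ε₂ / 8 * ‖v - w‖ ^ 2 - C / 4 * ‖T (v - w)‖ ^ 2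
      ≤ Ψ ((1 / 2 : ℝ) • (v + w)) := by
    intro v w
    have hjump := mul_le_mul_of_nonneg_left (jumpForm_midpoint_le zero_le_one hr.le v w)
      (h.acheck_pos hr).le
    simp only [Ψ, h.funF_midpoint]
    linarith [hT (v - w)]
  choose v hnorm hv using fun n : ℕ =>
    h.exists_norm_eq_one_lt_funF hr (Nat.one_div_pos_of_nat (α := ℝ) (n := n))
  have hlower : ∀ n : ℕ, -(1 / ((n : ℝ) + 1) * max 1 r) ≤ Ψ (v n) := by
    intro n
    have hjump : jumpForm 1 r (v n) ≤ max 1 r := by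
      simpa [jumpForm_self, hnorm] using jumpForm_mono (le_max_left 1 r) (le_max_right 1 r) (v n)
    have hscaled := mul_le_mul_of_nonneg_left hjump (Nat.one_div_pos_of_nat (α := ℝ) (n := n)).le
    simp only [Ψ]
    linarith [hv n]
  have hlim : Filter.Tendsto (Ψ ∘ v) Filter.atTop (nhds 0) := by
    refine tendsto_of_tendsto_of_tendsto_of_le_of_le ?_ tendsto_const_nhds hlower fun n => hΨ0 _
    simpa using (tendsto_one_div_add_atTop_nhds_zero_nat.mul_const (max 1 r)).neg
  have hbounded : Bornology.IsBounded (range v) :=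
    isBounded_iff_forall_norm_le.2 ⟨1, by rintro _ ⟨n, rfl⟩; exact (hnorm n).le⟩
  obtain ⟨v₀, hv₀, φ, -, hφ⟩ := exists_tendsto_subseq_of_maximizing hΨ
    (by positivity : 0 < ε₂ / 8) T hΨ0 hmid hbounded hlim
  have hnorm₀ : ‖v₀‖ = 1 := tendsto_nhds_unique hφ.norm (by simp [hnorm])
  exact ⟨v₀, ne_zero_of_norm_ne_zero (hnorm₀ ▸ one_ne_zero), sub_eq_zero.1 hv₀⟩

lemma exists_clm_eq_nem_jump (h : Admissible k ε₁ ε₂) {r : ℝ} (hr : 0 < r) :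
    ∃ v : HSpace, v ≠ 0 ∧ h.inGap.clm v = (lipIntegrand_jump cyl
      (acheck k ε₁ ε₂ r + mu k ε₁ ε₂) (r * acheck k ε₁ ε₂ r + mu k ε₁ ε₂)).nem v := by
  have hsplit : ∀ v, inner ℝ (h.inGap.clm v) v
      - jumpForm (acheck k ε₁ ε₂ r + mu k ε₁ ε₂) (r * acheck k ε₁ ε₂ r + mu k ε₁ ε₂) v =
      funF k ε₁ ε₂ v - acheck k ε₁ ε₂ r * jumpForm 1 r v := fun v => by
    rw [h.funF_eq, mul_jumpForm, mul_one, mul_comm r, ← jumpForm_add_mul_norm_sq]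
    ring
  obtain ⟨v, hv, heq⟩ := h.exists_funF_eq_acheck hr
  refine ⟨v, hv, eq_nem_jump_of_isMax h.inGap.inner_clm_comm fun w => ?_⟩
  rw [hsplit, hsplit, heq, sub_self]
  exact sub_nonpos.2 (h.funF_le_acheck hr w)

end Admissible

/-! ### The region below the curve -/

/-- A function on `Q_k` that vanishes exactly on `𝓒_k` and is positive below it. -/
def curveFun (k : ℤ) (ε₁ ε₂ : ℝ) (x : ℝ × ℝ) : ℝ :=
  dualCoord k ε₁ ε₂ x.1 - acheck k ε₁ ε₂ (dualCoord k ε₁ ε₂ x.2 / dualCoord k ε₁ ε₂ x.1)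

/-- `(a, b)` lies in the Fučík spectrum of `□`, for `a, b > d`: in terms of `L = (□ - d)⁻¹` and
`v = (□ - d)u`, the equation `□u = au⁺ - bu⁻` reads `Lv = v⁺/(a - d) - v⁻/(b - d)`. -/
def InFucik {d : ℝ} (hd : InGap k d) (a b : ℝ) : Prop :=
  ∃ v : HSpace, v ≠ 0 ∧ hd.clm v = (lipIntegrand_jump cyl (1 / (a - d)) (1 / (b - d))).nem v

lemma jump_one_div_sub_change {a b d e : ℝ} (had : d < a) (hbd : d < b) (hae : e < a) (hbe : e < b)
    (x : ℝ) : jump (1 / (a - e)) (1 / (b - e)) (x + (d - e) * jump (1 / (a - d)) (1 / (b - d)) x) =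
      jump (1 / (a - d)) (1 / (b - d)) x := by
  rw [← sub_pos] at had hbd hae hbe
  rcases le_total 0 x with hx | hx
  · have heq : x + (d - e) * (1 / (a - d) * x) = (a - e) * (x / (a - d)) := by
      field_simp
      ring
    rw [jump_of_nonneg _ _ hx, heq, jump_of_nonneg _ _ (by positivity)]
    field_simp
  · have heq : x + (d - e) * (1 / (b - d) * x) = (b - e) * (x / (b - d)) := by
      field_simp
      ring
    rw [jump_of_nonpos _ _ hx, heq, jump_of_nonpos _ _
      (mul_nonpos_of_nonneg_of_nonpos hbe.le (div_nonpos_of_nonpos_of_nonneg hx hbd.le))]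
    field_simp

lemma InFucik.change {a b d e : ℝ} {hd : InGap k d} (h : InFucik hd a b) (he : InGap k e)
    (had : d < a) (hbd : d < b) (hae : e < a) (hbe : e < b) : InFucik he a b := by
  obtain ⟨v, hv, hLv⟩ := h
  have hLw := hd.resolvent_identity he v
  refine ⟨v + (d - e) • hd.clm v, fun hw => hv ?_, ?_⟩
  · have hzero : hd.clm v = 0 := by rw [← hLw, hw, map_zero]
    simpa [hzero] using hw
  · rw [hLw]
    refine Lp.ext ?_
    have hcoe := (lipIntegrand_jump cyl (1 / (a - d)) (1 / (b - d))).coeFn_nem v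
    rw [← hLv] at hcoe
    filter_upwards [hcoe, Lp.coeFn_add v ((d - e) • hd.clm v), Lp.coeFn_smul (d - e) (hd.clm v),
      (lipIntegrand_jump cyl (1 / (a - e)) (1 / (b - e))).coeFn_nem (v + (d - e) • hd.clm v)]
      with z hL hadd hsmul hnem
    rw [hnem, hadd, Pi.add_apply, hsmul, Pi.smul_apply, smul_eq_mul, hL,
      jump_one_div_sub_change had hbd hae hbe]

namespace Admissible

lemma continuousOn_curveFun (h : Admissible k ε₁ ε₂) :
    ContinuousOn (curveFun k ε₁ ε₂) (Qk k ε₁ ε₂) := by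
  intro x hx
  have hcoord : ∀ y ∈ Ioo (pk k ε₁) (qk k ε₁ ε₂), ContinuousAt (dualCoord k ε₁ ε₂) y :=
    fun y hy => (continuousAt_const.div (continuousAt_id.sub continuousAt_const)
      (sub_pos.2 hy.1).ne').sub continuousAt_const
  have hfst : ContinuousAt (fun x : ℝ × ℝ => dualCoord k ε₁ ε₂ x.1) x :=
    (hcoord x.1 hx.1).comp continuousAt_fst
  have hsnd : ContinuousAt (fun x : ℝ × ℝ => dualCoord k ε₁ ε₂ x.2) x :=
    (hcoord x.2 hx.2).comp continuousAt_snd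
  have hpos := h.dualCoord_pos hx.1
  exact (hfst.sub (ContinuousAt.comp (g := acheck k ε₁ ε₂)
    (h.continuousAt_acheck (div_pos (h.dualCoord_pos hx.2) hpos))
    (hsnd.div hfst hpos.ne'))).continuousWithinAt

lemma mem_Ck_of_curveFun_eq_zero (h : Admissible k ε₁ ε₂) {x : ℝ × ℝ} (hx : x ∈ Qk k ε₁ ε₂)
    (h0 : curveFun k ε₁ ε₂ x = 0) : x ∈ Ck k ε₁ ε₂ := by
  have hpos := h.dualCoord_pos hx.1
  refine ⟨dualCoord k ε₁ ε₂ x.2 / dualCoord k ε₁ ε₂ x.1, div_pos (h.dualCoord_pos hx.2) hpos, ?_⟩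
  simp only [← sub_eq_zero.1 h0, div_mul_cancel₀ _ hpos.ne']
  simp [dualCoord]

lemma curveFun_pos_of_lt_lam (h : Admissible k ε₁ ε₂) {x : ℝ × ℝ}
    (hx : x ∈ Ioo (pk k ε₁) (lam k) ×ˢ Ioo (pk k ε₁) (lam k)) : 0 < curveFun k ε₁ ε₂ x := by
  have hcoord : ∀ y ∈ Ioo (pk k ε₁) (lam k), dualCoord k ε₁ ε₂ (lam k) < dualCoord k ε₁ ε₂ y :=
    fun y hy => dualCoord_lt_dualCoord hy.1 hy.2
  have hA := h.dualCoord_lam_pos.trans (hcoord _ hx.1)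
  have hB := h.dualCoord_lam_pos.trans (hcoord _ hx.2)
  rw [curveFun, sub_pos]
  set A := dualCoord k ε₁ ε₂ x.1
  set B := dualCoord k ε₁ ε₂ x.2
  set c := dualCoord k ε₁ ε₂ (lam k)
  calc acheck k ε₁ ε₂ (B / A) ≤ c / min A B * A := by
        refine h.acheck_le (div_pos hB hA) fun v => (h.funF_le_mul_jumpForm hA hB v).trans_eq ?_
        rw [mul_assoc, mul_jumpForm A, mul_one, mul_div_cancel₀ _ hA.ne']
    _ < A := mul_lt_of_lt_one_left hA
        ((div_lt_one (lt_min hA hB)).2 (lt_min (hcoord _ hx.1) (hcoord _ hx.2)))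

lemma exists_funF_le_jumpForm (h : Admissible k ε₁ ε₂) {x : ℝ × ℝ} (hx : x ∈ Qk k ε₁ ε₂)
    (h0 : 0 < curveFun k ε₁ ε₂ x) : ∃ θ : ℝ, 0 < θ ∧ θ < 1 ∧ ∀ v, funF k ε₁ ε₂ v ≤
      θ * jumpForm (dualCoord k ε₁ ε₂ x.1) (dualCoord k ε₁ ε₂ x.2) v := by
  have hA := h.dualCoord_pos hx.1
  have hr := div_pos (h.dualCoord_pos hx.2) hA
  refine ⟨_, div_pos (h.acheck_pos hr) hA, (div_lt_one hA).2 (sub_pos.1 h0), fun v => ?_⟩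
  refine (h.funF_le_acheck hr v).trans_eq ?_
  rw [mul_jumpForm, mul_jumpForm]
  congr 1 <;> field_simp

lemma inFucik_of_curveFun_eq_zero (h : Admissible k ε₁ ε₂) {x : ℝ × ℝ} (hx : x ∈ Qk k ε₁ ε₂)
    (h0 : curveFun k ε₁ ε₂ x = 0) : InFucik h.inGap x.1 x.2 := by
  have hA := h.dualCoord_pos hx.1
  obtain ⟨v, hv, hLv⟩ := h.exists_clm_eq_nem_jump (div_pos (h.dualCoord_pos hx.2) hA)
  rw [div_mul_eq_mul_div, ← sub_eq_zero.1 h0, mul_div_cancel_right₀ _ hA.ne', dualCoord,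
    dualCoord, sub_add_cancel, sub_add_cancel] at hLv
  exact ⟨v, hv, hLv⟩

lemma not_inFucik_of_curveFun_pos (h : Admissible k ε₁ ε₂) {x : ℝ × ℝ} (hx : x ∈ Qk k ε₁ ε₂)
    (h0 : 0 < curveFun k ε₁ ε₂ x) {a b : ℝ} (ha : a ∈ Ioc (pk k ε₁) x.1)
    (hb : b ∈ Ioc (pk k ε₁) x.2) : ¬ InFucik h.inGap a b := by
  rintro ⟨v, hv, hLv⟩
  have hF : funF k ε₁ ε₂ v = jumpForm (dualCoord k ε₁ ε₂ a) (dualCoord k ε₁ ε₂ b) v := by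
    rw [h.funF_eq, hLv, inner_nem_jump, sub_eq_add_neg, ← neg_mul, jumpForm_add_mul_norm_sq]
    rfl
  obtain ⟨θ, -, hθ, hle⟩ := h.exists_funF_le_jumpForm hx h0
  have hmono := jumpForm_mono (dualCoord_le_dualCoord (ε₂ := ε₂) ha.1 ha.2)
    (dualCoord_le_dualCoord (ε₂ := ε₂) hb.1 hb.2) v
  have hlt := mul_lt_of_lt_one_left
    (jumpForm_pos (h.dualCoord_pos hx.1) (h.dualCoord_pos hx.2) hv) hθ
  exact (hF ▸ hle v).not_gt (hlt.trans_le hmono)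

lemma exists_inFucik_of_curveFun_nonpos (h : Admissible k ε₁ ε₂) {x : ℝ × ℝ}
    (hx : x ∈ Qk k ε₁ ε₂) (h0 : curveFun k ε₁ ε₂ x ≤ 0) {m : ℝ} (hpm : pk k ε₁ ≤ m)
    (hmlam : m < lam k) (hm₁ : m < x.1) (hm₂ : m < x.2) :
    ∃ a ∈ Ioc m x.1, ∃ b ∈ Ioc m x.2, InFucik h.inGap a b := by
  have hsub : Ioc m x.1 ×ˢ Ioc m x.2 ⊆ Qk k ε₁ ε₂ := fun y hy =>
    ⟨⟨hpm.trans_lt hy.1.1, hy.1.2.trans_lt hx.1.2⟩, ⟨hpm.trans_lt hy.2.1, hy.2.2.trans_lt hx.2.2⟩⟩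
  obtain ⟨a, hma, ha⟩ := exists_between (lt_min hmlam hm₁)
  obtain ⟨b, hmb, hb⟩ := exists_between (lt_min hmlam hm₂)
  rw [lt_min_iff] at ha hb
  have hpos : 0 < curveFun k ε₁ ε₂ (a, b) := h.curveFun_pos_of_lt_lam
    ⟨⟨hpm.trans_lt hma, ha.1⟩, ⟨hpm.trans_lt hmb, hb.1⟩⟩
  obtain ⟨y, hy, hy0⟩ := (isPreconnected_Ioc.prod isPreconnected_Ioc).intermediate_value
    (⟨⟨hm₁, le_rfl⟩, ⟨hm₂, le_rfl⟩⟩ : x ∈ Ioc m x.1 ×ˢ Ioc m x.2)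
    (⟨⟨hma, ha.2.le⟩, ⟨hmb, hb.2.le⟩⟩ : (a, b) ∈ Ioc m x.1 ×ˢ Ioc m x.2)
    (h.continuousOn_curveFun.mono hsub) ⟨h0, hpos.le⟩
  exact ⟨y.1, hy.1, y.2, hy.2, h.inFucik_of_curveFun_eq_zero (hsub hy) hy0⟩

lemma curveFun_pos_of_curveFun_pos (h : Admissible k ε₁ ε₂) {δ₁ δ₂ : ℝ} (h' : Admissible k δ₁ δ₂)
    {x : ℝ × ℝ} (hx : x ∈ Qk k ε₁ ε₂) (hx' : x ∈ Qk k δ₁ δ₂) (h0 : 0 < curveFun k ε₁ ε₂ x) :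
    0 < curveFun k δ₁ δ₂ x := by
  by_contra! hle
  obtain ⟨a, ha, b, hb, hFucik⟩ := h'.exists_inFucik_of_curveFun_nonpos hx' hle
    (le_max_left _ (pk k ε₁)) (max_lt h'.inGap.2 h.inGap.2) (max_lt hx'.1.1 hx.1.1)
    (max_lt hx'.2.1 hx.2.1)
  obtain ⟨had, hae⟩ := max_lt_iff.1 ha.1
  obtain ⟨hbd, hbe⟩ := max_lt_iff.1 hb.1
  exact h.not_inFucik_of_curveFun_pos hx h0 ⟨hae, ha.2⟩ ⟨hbe, hb.2⟩
    (hFucik.change h.inGap had hbd hae hbe)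

end Admissible

lemma BelowCk.exists_curveFun_pos {x : ℝ × ℝ} (hx : BelowCk k x) :
    ∃ ε₁ ε₂ : ℝ, Admissible k ε₁ ε₂ ∧ x ∈ Qk k ε₁ ε₂ ∧ 0 < curveFun k ε₁ ε₂ x := by
  obtain ⟨ε₁, ε₂, h, hsub⟩ := hx
  have hIoo : (Ioo (pk k ε₁) (lam k)).Nonempty := nonempty_Ioo.2 h.inGap.2
  obtain ⟨y, hy⟩ := hIoo.prod hIoo
  have hcomponent := connectedComponentIn_subset (Qk k ε₁ ε₂ \ Ck k ε₁ ε₂) x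
  have hx : x ∈ Qk k ε₁ ε₂ \ Ck k ε₁ ε₂ := connectedComponentIn_nonempty_iff.1 ⟨y, hsub hy⟩
  refine ⟨ε₁, ε₂, h, hx.1, ?_⟩
  by_contra! hle
  obtain ⟨w, hw, hw0⟩ := isPreconnected_connectedComponentIn.intermediate_value
    (mem_connectedComponentIn hx) (hsub hy)
    (h.continuousOn_curveFun.mono (hcomponent.trans sdiff_subset))
    ⟨hle, (h.curveFun_pos_of_lt_lam hy).le⟩
  exact (hcomponent hw).2 (h.mem_Ck_of_curveFun_eq_zero (hcomponent hw).1 hw0)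

end Curve

/-! ### The dual functional -/

section Dual

variable {k : ℤ} {ε₁ ε₂ : ℝ} {x : ℝ × ℝ} {j : ℝ × ℝ → ℝ → ℝ}

/-- The dual functional `½⟨Lv, v⟩ - ∬ J*(s, t, v)`, where `j = ∂J/∂u`. -/
def dualFun (h : Admissible k ε₁ ε₂) (j : ℝ × ℝ → ℝ → ℝ) (v : HSpace) : ℝ :=
  1 / 2 * inner ℝ (h.inGap.clm v) v - conjInt j v

lemma exists_le_one_div_add {α β A B : ℝ} (hα : 0 < α) (hβ : 0 < β) (hA : A < 1 / α)
    (hB : B < 1 / β) : ∃ ε > 0, A ≤ 1 / (α + ε) ∧ B ≤ 1 / (β + ε) := by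
  have hev : ∀ {γ D : ℝ}, 0 < γ → D < 1 / γ →
      ∀ᶠ ε in nhdsWithin (0 : ℝ) (Ioi 0), D ≤ 1 / (γ + ε) := fun {γ D} hγ hD => by
    have hcont : ContinuousAt (fun ε : ℝ => 1 / (γ + ε)) 0 :=
      continuousAt_const.div (continuousAt_const.add continuousAt_id) (by simpa using hγ.ne')
    exact nhdsWithin_le_nhds <| (hcont.eventually (lt_mem_nhds (by simpa using hD))).mono
      fun _ => le_of_lt
  exact (eventually_mem_nhdsWithin.and ((hev hα hA).and (hev hβ hB))).exists

lemma exists_dualFun_le (h : Admissible k ε₁ ε₂) (hx : x ∈ Qk k ε₁ ε₂)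
    (h0 : 0 < curveFun k ε₁ ε₂ x)
    (hj : DualIntegrand j (mu k ε₁ ε₂) (x.1 - pk k ε₁) (x.2 - pk k ε₁) cyl) :
    ∃ δ > 0, ∃ C, ∀ v, dualFun h j v ≤ C - δ * ‖v‖ ^ 2 := by
  obtain ⟨θ, -, hθ1, hθ⟩ := h.exists_funF_le_jumpForm hx h0
  have hA := h.dualCoord_pos hx.1
  have hB := h.dualCoord_pos hx.2
  obtain ⟨τ, hθτ, hτ1⟩ := exists_between hθ1
  have hscaled : ∀ {y : ℝ}, 0 < dualCoord k ε₁ ε₂ y →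
      τ * dualCoord k ε₁ ε₂ y + mu k ε₁ ε₂ < 1 / (y - pk k ε₁) :=
    fun hy => lt_sub_iff_add_lt.1 (mul_lt_of_lt_one_left hy hτ1)
  obtain ⟨ε, hε, hεA, hεB⟩ :=
    exists_le_one_div_add hj.alpha_pos hj.beta_pos (hscaled hA) (hscaled hB)
  set A := dualCoord k ε₁ ε₂ x.1
  set B := dualCoord k ε₁ ε₂ x.2
  obtain ⟨C, hC⟩ := hj.exists_half_jumpForm_sub_le_conjInt hε
  refine ⟨1 / 2 * ((τ - θ) * min A B),
    mul_pos one_half_pos (mul_pos (sub_pos.2 hθτ) (lt_min hA hB)), C, fun v => ?_⟩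
  have hconj : τ * jumpForm A B v + mu k ε₁ ε₂ * ‖v‖ ^ 2 ≤
      jumpForm (1 / (x.1 - pk k ε₁ + ε)) (1 / (x.2 - pk k ε₁ + ε)) v := by
    rw [mul_jumpForm, jumpForm_add_mul_norm_sq]
    exact jumpForm_mono hεA hεB v
  have hmin := mul_le_mul_of_nonneg_left (min_mul_norm_sq_le_jumpForm A B v)
    (sub_pos.2 hθτ).le
  have hF := hθ v
  rw [h.funF_eq] at hF
  rw [dualFun]
  linarith [hC v]

lemma exists_forall_dualFun_le (h : Admissible k ε₁ ε₂) (hx : x ∈ Qk k ε₁ ε₂)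
    (h0 : 0 < curveFun k ε₁ ε₂ x)
    (hj : DualIntegrand j (mu k ε₁ ε₂) (x.1 - pk k ε₁) (x.2 - pk k ε₁) cyl) :
    ∃ v₀, ∀ v, dualFun h j v ≤ dualFun h j v₀ := by
  obtain ⟨δ, hδ, C, hcoer⟩ := exists_dualFun_le h hx h0 hj
  have hcont : Continuous (dualFun h j) := by
    have := hj.continuous_conjInt
    unfold dualFun
    fun_prop
  obtain ⟨n, T, D, hT⟩ := h.exists_funF_le
  refine exists_forall_le_of_coercive hcont (div_pos h.2.2.1 (by norm_num : (0 : ℝ) < 16)) T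
    (C := D / 8) (fun v w => ?_) hδ hcoer
  have hF := hT (v - w)
  rw [h.funF_eq] at hF
  rw [dualFun, dualFun, dualFun, inner_self_midpoint h.inGap.inner_clm_comm]
  linarith [hj.conjInt_midpoint_le v w]

lemma eq_nem_of_forall_dualFun_le {μ α β : ℝ} (h : Admissible k ε₁ ε₂)
    (hj : DualIntegrand j μ α β cyl) {v₀ : HSpace}
    (hmax : ∀ v, dualFun h j v ≤ dualFun h j v₀) :
    v₀ = hj.lipIntegrand.nem (h.inGap.clm v₀) :=
  hj.eq_nem_of_subgradient
    (inner_sub_le_sub_of_isMax h.inGap.inner_clm_comm hj.convexOn_conjInt hmax)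

end Dual

/-! ### Weak derivatives of the eigenfunctions -/

lemma integrable_of_continuous {f : ℝ × ℝ → ℝ} (hf : Continuous f) : Integrable f cyl :=
  (memLp_of_continuous hf).integrable one_le_two

lemma hasDerivAt_fst_of_differentiable {F : ℝ × ℝ → ℝ} (hF : Differentiable ℝ F) (s t : ℝ) :
    HasDerivAt (fun s => F (s, t)) (fderiv ℝ F (s, t) (1, 0)) s :=
  (hF (s, t)).hasFDerivAt.comp_hasDerivAt s ((hasDerivAt_id s).prodMk (hasDerivAt_const s t))

lemma hasDerivAt_snd_of_differentiable {F : ℝ × ℝ → ℝ} (hF : Differentiable ℝ F) (s t : ℝ) :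
    HasDerivAt (fun t => F (s, t)) (fderiv ℝ F (s, t) (0, 1)) t :=
  (hF (s, t)).hasFDerivAt.comp_hasDerivAt t ((hasDerivAt_const t s).prodMk (hasDerivAt_id t))

lemma integral_fderiv_space {F : ℝ × ℝ → ℝ} (hF : ContDiff ℝ 1 F)
    (hbdry : ∀ t, F (Real.pi, t) = F (0, t)) : ∫ z, fderiv ℝ F z (1, 0) ∂cyl = 0 := by
  have hcont : Continuous fun z => fderiv ℝ F z (1, 0) :=
    (hF.continuous_fderiv one_ne_zero).clm_apply continuous_const
  have hintegrable := integrable_of_continuous hcont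
  rw [cyl, Measure.volume_eq_prod, ← Measure.prod_restrict] at hintegrable ⊢
  rw [integral_prod_symm _ hintegrable]
  refine integral_eq_zero_of_ae (Filter.Eventually.of_forall fun t => ?_)
  have hslice : Continuous fun s => fderiv ℝ F (s, t) (1, 0) := hcont.comp (by fun_prop)
  simp only [Pi.zero_apply]
  rw [integral_Icc_eq_integral_Ioc,
    ← intervalIntegral.integral_of_le Real.pi_pos.le,
    intervalIntegral.integral_eq_sub_of_hasDerivAt (f := fun s => F (s, t))
      (fun s _ => hasDerivAt_fst_of_differentiable (hF.differentiable one_ne_zero) s t)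
      (hslice.intervalIntegrable _ _), hbdry, sub_self]

lemma integral_fderiv_time {F : ℝ × ℝ → ℝ} (hF : ContDiff ℝ 1 F)
    (hbdry : ∀ s, F (s, 2 * Real.pi) = F (s, 0)) : ∫ z, fderiv ℝ F z (0, 1) ∂cyl = 0 := by
  have hcont : Continuous fun z => fderiv ℝ F z (0, 1) :=
    (hF.continuous_fderiv one_ne_zero).clm_apply continuous_const
  have hintegrable := integrable_of_continuous hcont
  rw [cyl, Measure.volume_eq_prod, ← Measure.prod_restrict] at hintegrable ⊢
  rw [integral_prod _ hintegrable]
  refine integral_eq_zero_of_ae (Filter.Eventually.of_forall fun s => ?_)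
  have hslice : Continuous fun t => fderiv ℝ F (s, t) (0, 1) := hcont.comp (by fun_prop)
  simp only [Pi.zero_apply]
  rw [integral_Icc_eq_integral_Ioc,
    ← intervalIntegral.integral_of_le Real.two_pi_pos.le,
    intervalIntegral.integral_eq_sub_of_hasDerivAt (f := fun t => F (s, t))
      (fun t _ => hasDerivAt_snd_of_differentiable (hF.differentiable one_ne_zero) s t)
      (hslice.intervalIntegrable _ _), hbdry, sub_self]

lemma hasWeakDeriv_toLp {F G : ℝ × ℝ → ℝ} {e : ℝ × ℝ} {c : ℝ} (hF : ContDiff ℝ 1 F)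
    (hG : Continuous G) (hderiv : ∀ z, fderiv ℝ F z e = c * G z)
    (hbdry : ∀ g, IsTest g → ∫ z, fderiv ℝ (F * g) z e ∂cyl = 0) :
    HasWeakDeriv e ((memLp_of_continuous hF.continuous).toLp F)
      (c • (memLp_of_continuous hG).toLp G) := by
  intro g hg
  have hproduct : ∀ z, fderiv ℝ (F * g) z e = F z * fderiv ℝ g z e + c * (G z * g z) := fun z => by
    rw [fderiv_mul (hF.differentiable one_ne_zero z) (hg.1.differentiable (by simp) z)]
    simp only [add_apply, smul_apply, smul_eq_mul, hderiv]
    ring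
  have hFg : Integrable (fun z => F z * fderiv ℝ g z e) cyl :=
    integrable_of_continuous (hF.continuous.mul (hg.continuous_fderiv_apply e))
  have hGg : Integrable (fun z => G z * g z) cyl :=
    integrable_of_continuous (hG.mul hg.1.continuous)
  have hzero := hbdry g hg
  simp_rw [hproduct] at hzero
  rw [integral_add hFg (hGg.const_mul c), integral_const_mul] at hzero
  have hcoe : ∀ {f h : ℝ × ℝ → ℝ} (hf : Continuous f),
      ∫ z, ((memLp_of_continuous hf).toLp f : HSpace) z * h z ∂cyl = ∫ z, f z * h z ∂cyl :=
    fun {f h} hf => integral_congr_ae <| (memLp_of_continuous hf).coeFn_toLp.mono fun z hz => by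
      simp only [hz]
  rw [integral_smul_mul, hcoe hF.continuous, hcoe hG]
  linarith

@[fun_prop] lemma contDiff_trig (σ : Bool) {n : WithTop ℕ∞} : ContDiff ℝ n (trig σ) := by
  cases σ
  · exact Real.contDiff_cos
  · exact Real.contDiff_sin

lemma hasDerivAt_trig (σ : Bool) (x : ℝ) : HasDerivAt (trig σ) (-trigSign σ * trig (!σ) x) x := by
  cases σ
  · simpa [trig, trigSign] using! Real.hasDerivAt_cos x
  · simpa [trig, trigSign] using! Real.hasDerivAt_sin x

lemma trig_nat_mul_add_two_pi (τ : Bool) (n : ℕ) (t : ℝ) :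
    trig τ (n * (t + 2 * Real.pi)) = trig τ (n * t) := by
  rw [mul_add]
  cases τ
  · exact Real.cos_add_nat_mul_two_pi _ _
  · exact Real.sin_add_nat_mul_two_pi _ _

lemma contDiff_waveFun (m n : ℕ) (σ τ : Bool) {r : WithTop ℕ∞} :
    ContDiff ℝ r (waveFun m n σ τ) := by
  unfold waveFun
  fun_prop

lemma isTest_waveFun (m n : ℕ) (σ τ : Bool) : IsTest (waveFun m n σ τ) :=
  ⟨contDiff_waveFun m n σ τ, fun s t => by simp only [waveFun, trig_nat_mul_add_two_pi]⟩

lemma fderiv_waveFun_space (m n : ℕ) (σ τ : Bool) (z : ℝ × ℝ) :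
    fderiv ℝ (waveFun m n σ τ) z (1, 0) = -trigSign σ * m * waveFun m n (!σ) τ z := by
  refine (hasDerivAt_fst_of_differentiable
    ((contDiff_waveFun m n σ τ).differentiable one_ne_zero) z.1 z.2).unique ?_
  have htrig := (hasDerivAt_trig σ (m * z.1)).comp z.1 ((hasDerivAt_id z.1).const_mul (m : ℝ))
  refine ((htrig.mul_const (trig τ (n * z.2))).const_mul (Real.sqrt 2 / Real.pi)).congr_deriv ?_
  rw [waveFun]
  ring

lemma fderiv_waveFun_time (m n : ℕ) (σ τ : Bool) (z : ℝ × ℝ) :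
    fderiv ℝ (waveFun m n σ τ) z (0, 1) = -trigSign τ * n * waveFun m n σ (!τ) z := by
  refine (hasDerivAt_snd_of_differentiable
    ((contDiff_waveFun m n σ τ).differentiable one_ne_zero) z.1 z.2).unique ?_
  have htrig := (hasDerivAt_trig τ (n * z.2)).comp z.2 ((hasDerivAt_id z.2).const_mul (n : ℝ))
  refine ((htrig.const_mul (trig σ (m * z.1))).const_mul (Real.sqrt 2 / Real.pi)).congr_deriv ?_
  rw [waveFun]
  ring

lemma hasWeakDeriv_wave_space (m n : ℕ) (τ : Bool) :
    HasWeakDeriv (1, 0) (wave m n true τ) ((m : ℝ) • wave m n false τ) :=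
  hasWeakDeriv_toLp (contDiff_waveFun m n true τ) (continuous_waveFun m n false τ)
    (fun z => by simp [fderiv_waveFun_space, trigSign])
    fun _ hg => integral_fderiv_space
      ((contDiff_waveFun m n true τ).mul (hg.1.of_le (by exact_mod_cast le_top)))
      fun t => by simp [waveFun, trig]

lemma hasWeakDeriv_wave_time (m n : ℕ) (τ : Bool) :
    HasWeakDeriv (0, 1) (wave m n true τ) ((-trigSign τ * n) • wave m n true (!τ)) :=
  hasWeakDeriv_toLp (contDiff_waveFun m n true τ) (continuous_waveFun m n true (!τ))
    (fderiv_waveFun_time m n true τ)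
    fun _ hg => integral_fderiv_time
      ((contDiff_waveFun m n true τ).mul (hg.1.of_le (by exact_mod_cast le_top)))
      fun s => by
        have hper := congr_arg₂ (· * ·) ((isTest_waveFun m n true τ).2 s 0) (hg.2 s 0)
        simpa only [zero_add, Pi.mul_apply] using hper

lemma hasWeakDeriv_eigVec_space (i : Mode) :
    HasWeakDeriv (1, 0) (eigVec i) (((i.1.1 : ℕ) : ℝ) • sVec i) := by
  rw [sVec, smul_comm]
  exact (hasWeakDeriv_wave_space i.1.1 i.1.2 i.2).smul ‖modeVec i‖⁻¹

lemma hasWeakDeriv_eigVec_time (i : Mode) :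
    HasWeakDeriv (0, 1) (eigVec i) ((i.1.2 : ℝ) • tVec i) := by
  have h := (hasWeakDeriv_wave_time i.1.1 i.1.2 i.2).smul ‖modeVec i‖⁻¹
  rwa [smul_smul, ← mul_assoc, mul_comm _ (i.1.2 : ℝ), ← smul_smul] at h

lemma hasWeakDeriv_of_hasSum {ι : Type*} {e : ℝ × ℝ} {f g : ι → HSpace} {x y : HSpace}
    (hf : HasSum f x) (hg : HasSum g y) (hderiv : ∀ i, HasWeakDeriv e (f i) (g i)) :
    HasWeakDeriv e x y := by
  intro φ hφ
  rw [← inner_toLp_left (hφ.continuous_fderiv_apply e), ← inner_toLp_left hφ.1.continuous]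
  set φ' : HSpace := (memLp_of_continuous (hφ.continuous_fderiv_apply e)).toLp _
  set φ₀ : HSpace := (memLp_of_continuous hφ.1.continuous).toLp _
  have hterm : (fun i => innerSL ℝ φ' (f i)) = fun i => -innerSL ℝ φ₀ (g i) := funext fun i => by
    rw [innerSL_apply_apply, innerSL_apply_apply, inner_toLp_left (hφ.continuous_fderiv_apply e),
      inner_toLp_left hφ.1.continuous]
    exact hderiv i φ hφ
  exact (hf.mapL (innerSL ℝ φ')).unique (hterm ▸ (hg.mapL (innerSL ℝ φ₀)).neg)

lemma HasWeakDeriv.inner_wave_space {x y : HSpace} (h : HasWeakDeriv (1, 0) x y) (m n : ℕ)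
    (σ τ : Bool) :
    inner ℝ (wave m n σ τ) y = trigSign σ * m * inner ℝ (wave m n (!σ) τ) x := by
  have hweak := h _ (isTest_waveFun m n σ τ)
  simp_rw [fderiv_waveFun_space, mul_left_comm, integral_const_mul, ← inner_wave_left] at hweak
  linarith

lemma HasWeakDeriv.inner_wave_time {x y : HSpace} (h : HasWeakDeriv (0, 1) x y) (m n : ℕ)
    (σ τ : Bool) :
    inner ℝ (wave m n σ τ) y = trigSign τ * n * inner ℝ (wave m n σ (!τ)) x := by
  have hweak := h _ (isTest_waveFun m n σ τ)
  simp_rw [fderiv_waveFun_time, mul_left_comm, integral_const_mul, ← inner_wave_left] at hweak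
  linarith

lemma inner_sVec {x y : HSpace} (h : HasWeakDeriv (1, 0) x y) (i : Mode) :
    inner ℝ (sVec i) y = (i.1.1 : ℕ) * inner ℝ (eigVec i) x := by
  rw [sVec, eigVec, modeVec, real_inner_smul_left, real_inner_smul_left, h.inner_wave_space,
    Bool.not_false, trigSign, cond_false]
  ring

lemma inner_tVec {x y : HSpace} (h : HasWeakDeriv (0, 1) x y) (i : Mode) :
    inner ℝ (tVec i) y = (i.1.2 : ℝ) * inner ℝ (eigVec i) x := by
  have hsign : -trigSign i.2 * trigSign (!i.2) = 1 := by cases i.2 <;> simp [trigSign]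
  rw [tVec, eigVec, real_inner_smul_left, real_inner_smul_left, h.inner_wave_time, Bool.not_not,
    ← modeVec]
  linear_combination ‖modeVec i‖⁻¹ * i.1.2 * inner ℝ (modeVec i) x * hsign

/-! ### The energy space in terms of modes -/

/-- The modes with `m ≠ n`, which span `𝓡`; the others span `𝓝`. -/
def rangeModes : Set Mode := {i | (i.1.1 : ℕ) ≠ i.1.2}

lemma modeVec_eq_phi_or_psi (i : Mode) :
    modeVec i = phi i.1.1 i.1.2 ∨ modeVec i = psi i.1.1 i.1.2 := by
  obtain ⟨i, τ⟩ := i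
  cases τ
  · exact Or.inl rfl
  · exact Or.inr rfl

lemma eigVec_mem_RSpace {i : Mode} (hi : i ∈ rangeModes) : eigVec i ∈ RSpace :=
  RSpace.smul_mem _ <| Submodule.le_topologicalClosure _ <| Submodule.subset_span
    ⟨_, _, i.1.1.pos, hi, modeVec_eq_phi_or_psi i⟩

lemma eigVec_mem_NSpace {i : Mode} (hi : i ∉ rangeModes) : eigVec i ∈ NSpace := by
  have hmode := modeVec_eq_phi_or_psi i
  rw [← show (i.1.1 : ℕ) = i.1.2 from not_not.1 hi] at hmode
  exact NSpace.smul_mem _ <| Submodule.le_topologicalClosure _ <| Submodule.subset_span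
    ⟨_, i.1.1.pos, hmode⟩

lemma exists_eq_smul_eigVec {w : HSpace} {m n : ℕ} (hm : 1 ≤ m) (hw : w = phi m n ∨ w = psi m n) :
    ∃ i : Mode, i.1 = (⟨m, hm⟩, n) ∧ ∃ r : ℝ, w = r • eigVec i := by
  have hmode (i : Mode) : modeVec i = ‖modeVec i‖ • eigVec i := by
    rcases eq_or_ne (modeVec i) 0 with h | h
    · rw [h, norm_zero, zero_smul]
    · rw [eigVec, smul_inv_smul₀ (norm_ne_zero_iff.2 h)]
  rcases hw with rfl | rfl
  · exact ⟨((⟨m, hm⟩, n), false), rfl, _, hmode ((⟨m, hm⟩, n), false)⟩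
  · exact ⟨((⟨m, hm⟩, n), true), rfl, _, hmode ((⟨m, hm⟩, n), true)⟩

lemma abs_indicator_one_le {α : Type*} (s : Set α) (i : α) : |s.indicator (1 : α → ℝ) i| ≤ 1 := by
  simpa using! norm_indicator_le_norm_self (s := s) (1 : α → ℝ) i

lemma hasSum_inner_of_mem_RSpace {v : HSpace} (hv : v ∈ RSpace) (w : HSpace) :
    HasSum (fun i => rangeModes.indicator 1 i * inner ℝ (eigVec i) v * inner ℝ (eigVec i) w)
      (inner ℝ v w) := by
  have hbound := abs_indicator_one_le rangeModes
  have hself : diagOp eigVec (rangeModes.indicator 1) v = v :=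
    orthonormalOrZero_eigVec.diagOp_eq_self_of_mem_closure_span hbound
      (by
        rintro w ⟨m, n, hm, hmn, hw⟩
        obtain ⟨i, hi, hr⟩ := exists_eq_smul_eigVec hm hw
        exact ⟨i, indicator_of_mem (by simpa [rangeModes, hi] using hmn) _, hr⟩) hv
  simpa only [hself] using orthonormalOrZero_eigVec.hasSum_inner_diagOp hbound v w

lemma hasSum_inner_of_mem_NSpace {v : HSpace} (hv : v ∈ NSpace) (w : HSpace) :
    HasSum (fun i => rangeModesᶜ.indicator 1 i * inner ℝ (eigVec i) v * inner ℝ (eigVec i) w)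
      (inner ℝ v w) := by
  have hbound := abs_indicator_one_le rangeModesᶜ
  have hself : diagOp eigVec (rangeModesᶜ.indicator 1) v = v :=
    orthonormalOrZero_eigVec.diagOp_eq_self_of_mem_closure_span hbound
      (by
        rintro w ⟨l, hl, hw⟩
        obtain ⟨i, hi, hr⟩ := exists_eq_smul_eigVec hl hw
        exact ⟨i, indicator_of_mem (by simp [rangeModes, hi]) _, hr⟩) hv
  simpa only [hself] using orthonormalOrZero_eigVec.hasSum_inner_diagOp hbound v w

lemma inner_eq_zero_of_mem_NSpace {v w : HSpace} (hv : v ∈ NSpace)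
    (hw : ∀ i ∉ rangeModes, inner ℝ (eigVec i) w = 0) : inner ℝ w v = 0 := by
  have hsum := hasSum_inner_of_mem_NSpace hv w
  have hterm (i : Mode) :
      rangeModesᶜ.indicator 1 i * inner ℝ (eigVec i) v * inner ℝ (eigVec i) w = 0 := by
    by_cases hi : i ∈ rangeModes
    · simp [hi]
    · rw [hw i hi, mul_zero]
  simp only [hterm] at hsum
  rw [real_inner_comm]
  exact hsum.unique hasSum_zero

lemma exists_H1Space_of_summable {a : Mode → ℝ} (hsupp : ∀ i ∉ rangeModes, a i = 0)
    (ha : Summable fun i => a i ^ 2) (hs : Summable fun i => ((i.1.1 : ℕ) * a i) ^ 2)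
    (ht : Summable fun i => (i.1.2 * a i) ^ 2) :
    ∃ X : H1Space, HasSum (fun i => a i • eigVec i) X.1.1 ∧
      HasSum (fun i => ((i.1.1 : ℕ) * a i) • sVec i) X.1.2.1 ∧
      HasSum (fun i => (i.1.2 * a i) • tVec i) X.1.2.2 := by
  have hX := (orthonormalOrZero_eigVec.summable_smul ha).hasSum
  have hXs := (orthonormalOrZero_sVec.summable_smul hs).hasSum
  have hXt := (orthonormalOrZero_tVec.summable_smul ht).hasSum
  have hmem : ∑' i, a i • eigVec i ∈ RSpace :=
    (Submodule.isClosed_topologicalClosure _).mem_of_tendsto hX <|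
      Filter.Eventually.of_forall fun s => RSpace.sum_mem fun i _ => by
        by_cases hi : i ∈ rangeModes
        · exact RSpace.smul_mem _ (eigVec_mem_RSpace hi)
        · simp [hsupp i hi]
  have hspace := hasWeakDeriv_of_hasSum hX hXs fun i => by
    simpa only [smul_smul, mul_comm] using (hasWeakDeriv_eigVec_space i).smul (a i)
  have htime := hasWeakDeriv_of_hasSum hX hXt fun i => by
    simpa only [smul_smul, mul_comm] using (hasWeakDeriv_eigVec_time i).smul (a i)
  exact ⟨⟨(_, _, _), hmem, hspace, htime⟩, hX, hXs, hXt⟩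

lemma hasSum_inner_space_sub_inner_time {a : Mode → ℝ} {xs xt : HSpace}
    (hs : HasSum (fun i => ((i.1.1 : ℕ) * a i) • sVec i) xs)
    (ht : HasSum (fun i => (i.1.2 * a i) • tVec i) xt) (h : H1Space) :
    HasSum (fun i => eig i * a i * inner ℝ (eigVec i) h.1.1)
      (inner ℝ xs h.1.2.1 - inner ℝ xt h.1.2.2) := by
  have hsum := (hs.mapL (innerSL ℝ h.1.2.1)).sub (ht.mapL (innerSL ℝ h.1.2.2))
  have hspace (i : Mode) : inner ℝ h.1.2.1 (sVec i) = (i.1.1 : ℕ) * inner ℝ (eigVec i) h.1.1 := by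
    rw [real_inner_comm, inner_sVec h.2.2.1]
  have htime (i : Mode) : inner ℝ h.1.2.2 (tVec i) = i.1.2 * inner ℝ (eigVec i) h.1.1 := by
    rw [real_inner_comm, inner_tVec h.2.2.2]
  have hterm (i : Mode) : ((i.1.1 : ℕ) * a i) * ((i.1.1 : ℕ) * inner ℝ (eigVec i) h.1.1) -
      (i.1.2 * a i) * (i.1.2 * inner ℝ (eigVec i) h.1.1) =
      eig i * a i * inner ℝ (eigVec i) h.1.1 := by
    rw [eig]
    ring
  simp only [innerSL_apply_apply, real_inner_smul_right, hspace, htime, hterm] at hsum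
  rwa [real_inner_comm, real_inner_comm h.1.2.2]

/-! ### Regularity of `Lv` -/

namespace InGap

variable {k : ℤ} {d : ℝ}

lemma abs_mul_indicator_coef_le (hd : InGap k d) (i : Mode) {r : ℝ}
    (hr : |r| ≤ (i.1.1 : ℕ) + i.1.2) :
    |r * rangeModes.indicator (coef d) i| ≤ 1 + |d| / gapDist k d := by
  have hgap := hd.gapDist_pos
  have hdist : 0 < |eig i - d| := abs_pos.2 (hd.eig_sub_ne_zero i)
  have htriangle : |eig i| ≤ |eig i - d| + |d| := by
    simpa only [sub_add_cancel] using abs_add_le (eig i - d) d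
  by_cases hi : i ∈ rangeModes
  · calc |r * rangeModes.indicator (coef d) i| = |r| / |eig i - d| := by
          rw [indicator_of_mem hi, coef, abs_mul, abs_div, abs_one, mul_one_div]
      _ ≤ (|eig i - d| + |d|) / |eig i - d| := by
          gcongr
          exact hr.trans ((add_le_abs_eig hi).trans htriangle)
      _ = 1 + |d| / |eig i - d| := by rw [add_div, div_self hdist.ne']
      _ ≤ 1 + |d| / gapDist k d := by
          gcongr
          exact gapDist_le k d i
  · rw [indicator_of_notMem hi, mul_zero, abs_zero]
    positivity

lemma inner_eigVec_add_smul_clm (hd : InGap k d) (v : HSpace) (i : Mode) :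
    inner ℝ (eigVec i) (v + d • hd.clm v) = eig i * (coef d i * inner ℝ (eigVec i) v) := by
  have hne := hd.eig_sub_ne_zero i
  rw [inner_add_right, real_inner_smul_right, hd.inner_eigVec_clm, coef]
  field_simp
  ring

lemma exists_energy_splitting (hd : InGap k d) (v : HSpace) :
    ∃ w : H1Space × NSpace, hd.clm v = w.1.1.1 + w.2.1 ∧
      (∀ h : H1Space, inner ℝ w.1.1.2.1 h.1.2.1 - inner ℝ w.1.1.2.2 h.1.2.2 =
        inner ℝ (v + d • hd.clm v) h.1.1) ∧
      ∀ η : NSpace, inner ℝ (v + d • hd.clm v) η.1 = 0 := by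
  set a : Mode → ℝ := fun i => rangeModes.indicator (coef d) i * inner ℝ (eigVec i) v
  have hsummable (r : Mode → ℝ) (hr : ∀ i, |r i| ≤ (i.1.1 : ℕ) + i.1.2) :
      Summable fun i => (r i * a i) ^ 2 := by
    simpa only [a, mul_assoc] using orthonormalOrZero_eigVec.summable_sq_mul_inner
      (fun i => hd.abs_mul_indicator_coef_le i (hr i)) v
  have hone (i : Mode) : |(1 : ℝ)| ≤ (i.1.1 : ℕ) + i.1.2 := by
    rw [abs_one]
    exact_mod_cast (one_le_space i).trans (Nat.le_add_right _ _)
  obtain ⟨X, hX, hXs, hXt⟩ := exists_H1Space_of_summable (a := a)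
    (fun i hi => by simp only [a, indicator_of_notMem hi, zero_mul])
    (by simpa only [one_mul] using hsummable (fun _ => 1) hone)
    (hsummable _ fun i => by simp) (hsummable _ fun i => by simp)
  have hN : hd.clm v - X.1.1 ∈ NSpace := by
    refine (Submodule.isClosed_topologicalClosure _).mem_of_tendsto ((hd.hasSum_clm v).sub hX) <|
      Filter.Eventually.of_forall fun s => NSpace.sum_mem fun i _ => ?_
    by_cases hi : i ∈ rangeModes
    · simp [a, hi]
    · simpa [a, hi] using NSpace.smul_mem _ (eigVec_mem_NSpace hi)
  refine ⟨(X, ⟨_, hN⟩), (add_sub_cancel _ _).symm, fun h => ?_, fun η => ?_⟩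
  · have hsum := hasSum_inner_of_mem_RSpace h.2.1 (v + d • hd.clm v)
    refine (hasSum_inner_space_sub_inner_time hXs hXt h).unique ?_
    rw [real_inner_comm]
    convert hsum using 2 with i
    rw [hd.inner_eigVec_add_smul_clm]
    by_cases hi : i ∈ rangeModes
    · simp only [a, indicator_of_mem hi, Pi.one_apply]
      ring
    · simp [a, hi]
  · refine inner_eq_zero_of_mem_NSpace η.2 fun i hi => ?_
    rw [hd.inner_eigVec_add_smul_clm, eig, not_not.1 hi, sub_self, zero_mul]

end InGap

/-! ### The nonlinearity -/

section Nonlinearity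

/-- The metric projection of the plane onto the fundamental domain `[0,π] × [0,2π]`. -/
def cylProj (z : ℝ × ℝ) : ℝ × ℝ :=
  (projIcc 0 Real.pi Real.pi_pos.le z.1, projIcc 0 (2 * Real.pi) Real.two_pi_pos.le z.2)

lemma cylProj_mem (z : ℝ × ℝ) :
    cylProj z ∈ Icc (0 : ℝ) Real.pi ×ˢ Icc (0 : ℝ) (2 * Real.pi) :=
  ⟨Subtype.prop _, Subtype.prop _⟩

lemma continuous_cylProj : Continuous cylProj := by
  unfold cylProj
  fun_prop

lemma cylProj_ae_eq : ∀ᵐ z ∂cyl, cylProj z = z := by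
  filter_upwards [ae_restrict_mem (measurableSet_Icc.prod measurableSet_Icc)] with z hz
  rw [cylProj, projIcc_of_mem _ hz.1, projIcc_of_mem _ hz.2]

variable {k : ℤ} {a b d : ℝ} {p : ℝ → ℝ → ℝ → ℝ} {ε ε₁ ε₂ : ℝ}

/-- Continuity of the nonlinearity `p` on `[0,π] × 𝕋 × ℝ`. -/
abbrev CylContinuous (p : ℝ → ℝ → ℝ → ℝ) : Prop :=
  ContinuousOn (fun x : ℝ × ℝ × ℝ => p x.1 x.2.1 x.2.2) (Icc (0 : ℝ) Real.pi ×ˢ univ)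

/-- The function `p` on the fundamental domain, extended to the plane by composition with the
projection: unlike `p`, it is continuous everywhere. -/
def clampP (p : ℝ → ℝ → ℝ → ℝ) (z : ℝ × ℝ) (u : ℝ) : ℝ := p (cylProj z).1 (cylProj z).2 u

lemma continuous_clampP (hp : CylContinuous p) :
    Continuous fun x : (ℝ × ℝ) × ℝ => clampP p x.1 x.2 :=
  have hproj : Continuous fun x : (ℝ × ℝ) × ℝ => cylProj x.1 :=
    continuous_cylProj.comp continuous_fst
  hp.comp_continuous (hproj.fst.prodMk (hproj.snd.prodMk continuous_snd)) fun x =>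
    ⟨(cylProj_mem x.1).1, mem_univ _⟩

lemma exists_abs_clampP_le (hp : CylContinuous p) (hsmall : SmallAtInfinity p) (hε : 0 < ε) :
    ∃ C, ∀ z u, |clampP p z u| ≤ ε * |u| + C := by
  obtain ⟨M, hM, hlarge⟩ := hsmall ε hε
  have hK : IsCompact (Icc 0 Real.pi ×ˢ Icc 0 (2 * Real.pi) ×ˢ Icc (-M) M) :=
    isCompact_Icc.prod (isCompact_Icc.prod isCompact_Icc)
  obtain ⟨C, hC⟩ := hK.exists_bound_of_continuousOn
    (hp.mono (prod_mono le_rfl (subset_univ _)))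
  refine ⟨|C|, fun z u => ?_⟩
  rcases le_or_gt |u| M with hu | hu
  · have hbounded : |clampP p z u| ≤ C :=
      hC (_, _, u) ⟨(cylProj_mem z).1, (cylProj_mem z).2, abs_le.1 hu⟩
    have hlin : 0 ≤ ε * |u| := by positivity
    linarith [le_abs_self C]
  · have hsublinear := hlarge _ (cylProj_mem z).1 (cylProj z).2 u hu
    rw [abs_div, div_lt_iff₀ (hM.trans hu)] at hsublinear
    exact hsublinear.le.trans (le_add_of_nonneg_right (abs_nonneg C))

lemma exists_abs_prim_clampP_le (hp : CylContinuous p) (hsmall : SmallAtInfinity p) (hε : 0 < ε) :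
    ∃ C, ∀ z u, |prim (clampP p) z u| ≤ ε * u ^ 2 + C := by
  obtain ⟨C, hbound⟩ := exists_abs_clampP_le hp hsmall (half_pos hε)
  refine ⟨C ^ 2 / (2 * ε), fun z u => ?_⟩
  have hprim : |prim (clampP p) z u| ≤ (ε / 2 * |u| + C) * |u - 0| := by
    refine intervalIntegral.norm_integral_le_of_norm_le_const (f := clampP p z) fun τ hτ => ?_
    have hτu : |τ| ≤ |u| := by simpa using abs_sub_left_of_mem_uIcc (uIoc_subset_uIcc hτ)
    exact (hbound z τ).trans (by gcongr)
  have hyoung : C * |u| ≤ ε / 2 * u ^ 2 + C ^ 2 / (2 * ε) := by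
    have hsq : 0 ≤ (ε * |u| - C) ^ 2 / (2 * ε) := by positivity
    have hexpand : (ε * |u| - C) ^ 2 / (2 * ε) =
        ε / 2 * |u| ^ 2 - C * |u| + C ^ 2 / (2 * ε) := by
      field_simp
      ring
    rw [sq_abs] at hexpand
    linarith
  rw [sub_zero, add_mul, mul_assoc, ← sq, sq_abs] at hprim
  linarith

/-- The right-hand side `a u⁺ - b u⁻ + p - d u`, on the fundamental domain and extended to the
plane by composition with the projection. -/
def shiftRhs (a b : ℝ) (p : ℝ → ℝ → ℝ → ℝ) (d : ℝ) (z : ℝ × ℝ) (u : ℝ) : ℝ :=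
  rhs a b p (cylProj z).1 (cylProj z).2 u - d * u

lemma jump_sub (a b d u : ℝ) : jump (a - d) (b - d) u = jump a b u - d * u := by
  rcases le_total 0 u with hu | hu
  · rw [jump_of_nonneg _ _ hu, jump_of_nonneg _ _ hu]; ring
  · rw [jump_of_nonpos _ _ hu, jump_of_nonpos _ _ hu]; ring

lemma shiftRhs_eq_jump_add (z : ℝ × ℝ) (u : ℝ) :
    shiftRhs a b p d z u = jump (a - d) (b - d) u + clampP p z u := by
  rw [jump_sub, shiftRhs, jump, rhs, clampP]
  ring

lemma continuous_shiftRhs (hp : CylContinuous p) :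
    Continuous fun x : (ℝ × ℝ) × ℝ => shiftRhs a b p d x.1 x.2 := by
  simp only [shiftRhs_eq_jump_add]
  exact ((lipschitzWith_jump _ _).continuous.comp continuous_snd).add (continuous_clampP hp)

lemma continuous_shiftRhs_left (hp : CylContinuous p) (u : ℝ) :
    Continuous fun z => shiftRhs a b p d z u :=
  (continuous_shiftRhs hp).comp (Continuous.prodMk_left u)

lemma prim_shiftRhs (hp : CylContinuous p) (z : ℝ × ℝ) (u : ℝ) :
    prim (shiftRhs a b p d) z u = 1 / 2 * jumpSq (a - d) (b - d) u + prim (clampP p) z u := by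
  have hclamp : Continuous (clampP p z) := (continuous_clampP hp).comp (Continuous.prodMk_right z)
  simp only [prim, shiftRhs_eq_jump_add]
  rw [← integral_jump, intervalIntegral.integral_add
    ((lipschitzWith_jump _ _).continuous.intervalIntegrable _ _) (hclamp.intervalIntegrable _ _)]

lemma prim_clampP {z : ℝ × ℝ} (hz : cylProj z = z) (u : ℝ) :
    prim (clampP p) z u = primP p z.1 z.2 u := by
  simp only [prim, clampP, primP, hz]

lemma funJstar_eq_conj (hp : CylContinuous p) {z : ℝ × ℝ} (hz : cylProj z = z) (v : ℝ) :
    funJstar d a b p z.1 z.2 v = conj (shiftRhs a b p d) z v := by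
  have hprim : prim (shiftRhs a b p d) z = funJ d a b p z.1 z.2 := by
    funext u
    rw [prim_shiftRhs hp, prim_clampP hz, funJ, jumpSq]
    ring
  rw [conj, hprim]
  rfl

namespace Suitable

lemma dualIntegrand (hp : CylContinuous p) (hsmall : SmallAtInfinity p)
    (hs : Suitable k a b p ε₁ ε₂) : DualIntegrand (shiftRhs a b p (pk k ε₁)) (mu k ε₁ ε₂)
      (a - pk k ε₁) (b - pk k ε₁) cyl where
  measurable_left u := (continuous_shiftRhs_left hp u).measurable
  memLp_zero := memLp_of_continuous (continuous_shiftRhs_left hp 0)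
  mono z := (hs.2.2 _ (cylProj_mem z).1 _).1.monotone
  anti z u w huw := by
    have hanti := (hs.2.2 _ (cylProj_mem z).1 (cylProj z).2).2.antitone huw
    simp only [shiftRhs, qk, add_mul, one_div_mul_eq_div, ← sub_sub] at hanti ⊢
    exact hanti
  mu_pos := hs.1.mu_pos
  alpha_pos := sub_pos.2 hs.2.1.1.1
  beta_pos := sub_pos.2 hs.2.1.2.1
  asymp ε hε := by
    simpa only [prim_shiftRhs hp, add_sub_cancel_left] using exists_abs_prim_clampP_le hp hsmall hε

lemma dualI_eq_dualFun (hp : CylContinuous p) (hsmall : SmallAtInfinity p)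
    (hs : Suitable k a b p ε₁ ε₂) (v : HSpace) :
    dualI k ε₁ ε₂ a b p v = dualFun hs.1 (shiftRhs a b p (pk k ε₁)) v := by
  have h_split : ∫ z, (funJstar (pk k ε₁) a b p z.1 z.2 (v z) - mu k ε₁ ε₂ / 2 * (v z) ^ 2) ∂cyl =
      conjInt (shiftRhs a b p (pk k ε₁)) v - mu k ε₁ ε₂ / 2 * ‖v‖ ^ 2 := by
    rw [conjInt, norm_sq_eq_integral, ← integral_const_mul,
      ← integral_sub ((hs.dualIntegrand hp hsmall).integrable_conj v)
        ((integrable_sq v).const_mul _)]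
    refine integral_congr_ae ?_
    filter_upwards [cylProj_ae_eq] with z hz
    rw [funJstar_eq_conj hp hz]
  rw [dualI, h_split, hs.1.funF_eq, dualFun]
  ring

lemma lipIntegrand (hp : CylContinuous p) (hsmall : SmallAtInfinity p)
    (hs : Suitable k a b p ε₁ ε₂) :
    LipIntegrand (shiftRhs a b p 0) ((1 / mu k ε₁ ε₂).toNNReal + ‖pk k ε₁‖₊) cyl where
  measurable_left u := (continuous_shiftRhs_left hp u).measurable
  lip z := by
    have hsplit : shiftRhs a b p 0 z =
        fun u => shiftRhs a b p (pk k ε₁) z u + pk k ε₁ • u := by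
      funext u
      rw [shiftRhs, shiftRhs, smul_eq_mul]
      ring
    rw [hsplit]
    exact ((hs.dualIntegrand hp hsmall).lipIntegrand.lip z).add (lipschitzWith_smul _)
  memLp_zero := memLp_of_continuous (continuous_shiftRhs_left hp 0)

end Suitable

end Nonlinearity

/-! ### Critical points of the energy -/

section CriticalPoints

variable {k : ℤ} {a b : ℝ} {p : ℝ → ℝ → ℝ → ℝ} {ε₁ ε₂ : ℝ} {K : NNReal}

/-- The map `(x, y) ↦ x + y`. -/
def sumCLM : (H1Space × NSpace) →L[ℝ] HSpace :=
  (ContinuousLinearMap.fst ℝ HSpace (HSpace × HSpace)).comp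
    (H1Space.subtypeL.comp (ContinuousLinearMap.fst ℝ H1Space NSpace)) +
  NSpace.subtypeL.comp (ContinuousLinearMap.snd ℝ H1Space NSpace)

/-- The map `(x, y) ↦ x_s`. -/
def spaceCLM : (H1Space × NSpace) →L[ℝ] HSpace :=
  ((ContinuousLinearMap.fst ℝ HSpace HSpace).comp
    (ContinuousLinearMap.snd ℝ HSpace (HSpace × HSpace))).comp
    (H1Space.subtypeL.comp (ContinuousLinearMap.fst ℝ H1Space NSpace))

/-- The map `(x, y) ↦ x_t`. -/
def timeCLM : (H1Space × NSpace) →L[ℝ] HSpace :=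
  ((ContinuousLinearMap.snd ℝ HSpace HSpace).comp
    (ContinuousLinearMap.snd ℝ HSpace (HSpace × HSpace))).comp
    (H1Space.subtypeL.comp (ContinuousLinearMap.fst ℝ H1Space NSpace))

lemma energy_eq (hp : CylContinuous p) (hf : LipIntegrand (shiftRhs a b p 0) K cyl)
    (w : H1Space × NSpace) :
    energy a b p w = 1 / 2 * (‖spaceCLM w‖ ^ 2 - ‖timeCLM w‖ ^ 2) -
      ∫ z, prim (shiftRhs a b p 0) z (sumCLM w z) ∂cyl := by
  have hprim : (fun z => prim (shiftRhs a b p 0) z (sumCLM w z)) =ᵐ[cyl] fun z =>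
      1 / 2 * jumpSq a b (sumCLM w z) + primP p z.1 z.2 (sumCLM w z) := by
    filter_upwards [cylProj_ae_eq] with z hz
    rw [prim_shiftRhs hp, prim_clampP hz, sub_zero, sub_zero]
  have hjump : Integrable (fun z => 1 / 2 * jumpSq a b (sumCLM w z)) cyl :=
    (integrable_jumpSq _ _ _).const_mul _
  have hprimP : Integrable (fun z => primP p z.1 z.2 (sumCLM w z)) cyl :=
    (((hf.integrable_prim (sumCLM w)).congr hprim).sub hjump).congr
      (Filter.Eventually.of_forall fun z => add_sub_cancel_left _ _)
  rw [integral_congr_ae hprim, integral_add hjump hprimP, integral_const_mul,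
    ← jumpForm_eq_integral, jumpForm]
  change 1 / 2 * (‖spaceCLM w‖ ^ 2 - ‖timeCLM w‖ ^ 2 - a * ‖Lp.posPart (sumCLM w)‖ ^ 2 -
    b * ‖Lp.negPart (sumCLM w)‖ ^ 2) - ∫ z, primP p z.1 z.2 (sumCLM w z) ∂cyl = _
  ring

lemma hasFDerivAt_energy (hp : CylContinuous p) (hf : LipIntegrand (shiftRhs a b p 0) K cyl)
    (w : H1Space × NSpace) :
    HasFDerivAt (energy a b p) ((innerSL ℝ (spaceCLM w)).comp spaceCLM -
      (innerSL ℝ (timeCLM w)).comp timeCLM -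
      (innerSL ℝ (hf.nem (sumCLM w))).comp sumCLM) w := by
  have hspace := (spaceCLM.hasFDerivAt (x := w)).norm_sq
  have htime := (timeCLM.hasFDerivAt (x := w)).norm_sq
  have hprim := (hf.hasFDerivAt_integral_prim (sumCLM w)).comp w sumCLM.hasFDerivAt
  rw [funext (energy_eq hp hf)]
  refine (((hspace.sub htime).const_mul (1 / 2)).sub hprim).congr_fderiv ?_
  rw [← smul_sub, ← Nat.cast_smul_eq_nsmul ℝ, smul_smul]
  norm_num

lemma isWeakSolution_of_equation (hp : CylContinuous p)
    (hf : LipIntegrand (shiftRhs a b p 0) K cyl) {u : HSpace} (w : H1Space × NSpace)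
    (hu : u = w.1.1.1 + w.2.1)
    (h_range : ∀ h : H1Space, inner ℝ w.1.1.2.1 h.1.2.1 - inner ℝ w.1.1.2.2 h.1.2.2 =
        inner ℝ (hf.nem u) h.1.1)
    (h_kernel : ∀ η : NSpace, inner ℝ (hf.nem u) η.1 = 0) : IsWeakSolution a b p u := by
  refine ⟨w, hu, (hasFDerivAt_energy hp hf w).congr_fderiv ?_⟩
  have hsum : sumCLM w = u := hu.symm
  refine ContinuousLinearMap.ext fun y => ?_
  change inner ℝ w.1.1.2.1 y.1.1.2.1 - inner ℝ w.1.1.2.2 y.1.1.2.2 -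
    inner ℝ (hf.nem (sumCLM w)) (y.1.1.1 + y.2.1) = 0
  rw [hsum, inner_add_right, h_range, h_kernel]
  ring

namespace Suitable

lemma nem_clm_eq (hp : CylContinuous p) (hsmall : SmallAtInfinity p)
    (hs : Suitable k a b p ε₁ ε₂) {v₀ : HSpace}
    (hmax : ∀ v, dualI k ε₁ ε₂ a b p v ≤ dualI k ε₁ ε₂ a b p v₀) :
    (hs.lipIntegrand hp hsmall).nem (hs.1.inGap.clm v₀) =
      v₀ + pk k ε₁ • hs.1.inGap.clm v₀ := by
  set u₀ := hs.1.inGap.clm v₀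
  have hdual := hs.dualIntegrand hp hsmall
  simp only [hs.dualI_eq_dualFun hp hsmall] at hmax
  have heuler : v₀ = hdual.lipIntegrand.nem u₀ := eq_nem_of_forall_dualFun_le hs.1 hdual hmax
  nth_rewrite 1 [heuler]
  refine Lp.ext ?_
  filter_upwards [(hs.lipIntegrand hp hsmall).coeFn_nem u₀, hdual.lipIntegrand.coeFn_nem u₀,
    Lp.coeFn_add (hdual.lipIntegrand.nem u₀) (pk k ε₁ • u₀),
    Lp.coeFn_smul (pk k ε₁) u₀] with z h_nem h_dual h_add h_smul
  rw [h_nem, h_add, Pi.add_apply, h_dual, h_smul, Pi.smul_apply, smul_eq_mul, shiftRhs, shiftRhs]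
  ring

/-- By duality, a maximum point `v₀` satisfies `v₀ = f(·, L v₀) - p_k L v₀`, where `f` is the
right-hand side. -/
lemma isWeakSolution_opL (hp : CylContinuous p) (hsmall : SmallAtInfinity p)
    (hs : Suitable k a b p ε₁ ε₂) {v₀ : HSpace}
    (hmax : ∀ v, dualI k ε₁ ε₂ a b p v ≤ dualI k ε₁ ε₂ a b p v₀) :
    IsWeakSolution a b p (opL (pk k ε₁) v₀) := by
  have hnem := hs.nem_clm_eq hp hsmall hmax
  obtain ⟨w, hw, h_range, h_kernel⟩ := hs.1.inGap.exists_energy_splitting v₀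
  rw [← hs.1.inGap.clm_apply]
  exact isWeakSolution_of_equation hp (hs.lipIntegrand hp hsmall) w hw
    (fun h => by rw [hnem, h_range]) fun η => by rw [hnem, h_kernel]

end Suitable

end CriticalPoints

/-! ### Choice of the parameters -/

section Parameters

variable {k : ℤ} {a b d q ε ε₁ ε₂ T : ℝ} {p : ℝ → ℝ → ℝ → ℝ}

lemma strictAnti_jump {α β : ℝ} (hα : α < 0) (hβ : β < 0) : StrictAnti (jump α β) := by
  have hneg : StrictAntiOn (jump α β) (Iic 0) := fun x hx y hy hxy => by
    rw [jump_of_nonpos _ _ hx, jump_of_nonpos _ _ hy]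
    exact mul_lt_mul_of_neg_left hxy hβ
  have hpos : StrictAntiOn (jump α β) (Ici 0) := fun x hx y hy hxy => by
    rw [jump_of_nonneg _ _ hx, jump_of_nonneg _ _ hy]
    exact mul_lt_mul_of_neg_left hxy hα
  exact hneg.Iic_union_Ici hpos

lemma max_zero_neg_one_div_lt (hgap : 0 ≤ lam (k - 1) ∨ lam k < 0) (hd : InGap k d) :
    max 0 (-1 / d) < 1 / (lam k - d) := by
  have hpos : 0 < 1 / (lam k - d) := one_div_pos.2 (sub_pos.2 hd.2)
  refine max_lt hpos ?_
  rcases hgap with hgap | hgap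
  · exact (div_neg_of_neg_of_pos (by norm_num) (hgap.trans_lt hd.1)).trans hpos
  · rw [neg_div, ← one_div_neg_eq_neg_one_div]
    exact one_div_lt_one_div_of_lt (sub_pos.2 hd.2) (by linarith)

/-- As `ε ↓ 0`, the point `d + 1/(max{0, -1/d} + ε)` tends to `+∞` if `d > 0` and to `0` if
`d < 0`. -/
lemma eventually_lt_add_one_div (hgap : 0 ≤ lam (k - 1) ∨ lam k < 0) (hd : InGap k d)
    (hT : lam k < 0 → T < 0) :
    ∀ᶠ ε in nhdsWithin (0 : ℝ) (Ioi 0), T < d + 1 / (max 0 (-1 / d) + ε) := by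
  rcases hgap with hgap | hgap
  · have hd_pos : 0 < d := hgap.trans_lt hd.1
    have hmax : max 0 (-1 / d) = 0 :=
      max_eq_left (div_nonpos_of_nonpos_of_nonneg (by norm_num) hd_pos.le)
    simp only [hmax, zero_add, one_div]
    exact (Filter.tendsto_atTop_add_const_left _ d tendsto_inv_nhdsGT_zero).eventually
      (Filter.eventually_gt_atTop T)
  · have hd_neg : d < 0 := hd.2.trans hgap
    have hpos : 0 < -1 / d := div_pos_of_neg_of_neg (by norm_num) hd_neg
    have hcont : ContinuousAt (fun ε : ℝ => d + 1 / (-1 / d + ε)) 0 :=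
      continuousAt_const.add (continuousAt_const.div (continuousAt_const.add continuousAt_id)
        (by simpa using hpos.ne'))
    have hlimit : d + 1 / (-1 / d + 0) = 0 := by
      rw [add_zero, one_div_div, div_neg, div_one, add_neg_cancel]
    rw [max_eq_right hpos.le]
    exact nhdsWithin_le_nhds (hcont.eventually (lt_mem_nhds (by simpa only [hlimit] using hT hgap)))

lemma strictAnti_rhs_sub_of_antitone {c s t : ℝ} (hp : Antitone fun u => p s t u - c * u)
    (ha : a + c < q) (hb : b + c < q) : StrictAnti fun u => rhs a b p s t u - q * u := by
  have hjump : StrictAnti (jump (a - (q - c)) (b - (q - c))) :=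
    strictAnti_jump (by linarith) (by linarith)
  convert hjump.add_antitone hp using 2 with u
  rw [jump_sub, jump, rhs]
  ring

lemma exists_forall_strictAnti_of_pos (hk : 0 < lam k) (hH2 : H2 k p) :
    ∃ T, ∀ q, T < q → a < q ∧ b < q ∧ ∀ s ∈ Icc (0 : ℝ) Real.pi, ∀ t : ℝ,
      StrictAnti fun u => rhs a b p s t u - q * u := by
  obtain ⟨ε, hε, hanti⟩ := hH2 hk
  have hc : 0 < 1 / ε := one_div_pos.2 hε
  refine ⟨max a b + 1 / ε, fun q hq => ?_⟩
  have ha : a + 1 / ε < q := by linarith [le_max_left a b]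
  have hb : b + 1 / ε < q := by linarith [le_max_right a b]
  exact ⟨by linarith, by linarith,
    fun s hs t => strictAnti_rhs_sub_of_antitone (hanti s hs t) ha hb⟩

lemma exists_forall_strictAnti_of_neg (hk : lam k < 0) (hH3 : H3 k a b p) (ha : a < 0)
    (hb : b < 0) : ∃ T < 0, ∀ q, T < q → a < q ∧ b < q ∧ ∀ s ∈ Icc (0 : ℝ) Real.pi, ∀ t : ℝ,
      StrictAnti fun u => rhs a b p s t u - q * u := by
  obtain ⟨ε, hε, hanti⟩ := hH3 hk
  refine ⟨max (max a b) (-ε), max_lt (max_lt ha hb) (neg_lt_zero.2 hε), fun q hq => ?_⟩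
  obtain ⟨⟨haq, hbq⟩, hεq⟩ : (a < q ∧ b < q) ∧ -ε < q := by simpa only [max_lt_iff] using hq
  refine ⟨haq, hbq, fun s hs t u w huw => ?_⟩
  have hle := hanti s hs t huw.le
  have hlt : (q + ε) * u < (q + ε) * w := mul_lt_mul_of_pos_left huw (by linarith)
  simp only at hle ⊢
  linarith

lemma exists_forall_strictAnti (hk : lam k ≠ 0) (hH2 : H2 k p) (hH3 : H3 k a b p)
    (hQ : (a, b) ∈ Qcheck k) :
    ∃ T, (lam k < 0 → T < 0) ∧ ∀ q, T < q → a < q ∧ b < q ∧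
      ∀ s ∈ Icc (0 : ℝ) Real.pi, ∀ t : ℝ, StrictAnti fun u => rhs a b p s t u - q * u := by
  rcases hk.lt_or_gt with hneg | hpos
  · obtain ⟨T, hT, hanti⟩ :=
      exists_forall_strictAnti_of_neg hneg hH3 (hQ.2.2 hneg).1 (hQ.2.2 hneg).2
    exact ⟨T, fun _ => hT, hanti⟩
  · obtain ⟨T, hanti⟩ := exists_forall_strictAnti_of_pos hpos hH2
    exact ⟨T, fun hneg => absurd hneg hpos.not_gt, hanti⟩

lemma exists_strictMono_rhs_sub_pk (hgap : lam (k - 1) < lam k) (hH1 : H1 k a b p)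
    (ha : lam (k - 1) < a) (hb : lam (k - 1) < b) :
    ∃ ε₁ > 0, InGap k (pk k ε₁) ∧ pk k ε₁ < a ∧ pk k ε₁ < b ∧
      ∀ s ∈ Icc (0 : ℝ) Real.pi, ∀ t : ℝ, StrictMono fun u => rhs a b p s t u - pk k ε₁ * u := by
  obtain ⟨ε₀, hε₀, hmono⟩ := hH1
  obtain ⟨d, hd, hlt⟩ : ∃ d, lam (k - 1) < d ∧
      d < min (min (lam (k - 1) + ε₀) (lam k)) (min a b) :=
    exists_between (lt_min (lt_min (lt_add_of_pos_right _ hε₀) hgap) (lt_min ha hb))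
  obtain ⟨⟨hdε₀, hdk⟩, hda, hdb⟩ : (d < lam (k - 1) + ε₀ ∧ d < lam k) ∧ d < a ∧ d < b := by
    simpa only [lt_min_iff] using hlt
  have hpk : pk k (d - lam (k - 1)) = d := add_sub_cancel _ _
  refine ⟨d - lam (k - 1), sub_pos.2 hd, ?_⟩
  rw [hpk]
  refine ⟨⟨hd, hdk⟩, hda, hdb, fun s hs t u w huw => ?_⟩
  have hle := hmono s hs t huw.le
  have hlt := mul_lt_mul_of_pos_left huw (sub_pos.2 hdε₀)
  simp only at hle ⊢
  linarith

lemma exists_suitable (hk : lam k ≠ 0) (hgap : lam (k - 1) < lam k) (hH1 : H1 k a b p)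
    (hH2 : H2 k p) (hH3 : H3 k a b p) (hQ : (a, b) ∈ Qcheck k) :
    ∃ ε₁ ε₂ : ℝ, Suitable k a b p ε₁ ε₂ := by
  have hsign : 0 ≤ lam (k - 1) ∨ lam k < 0 :=
    (nonneg_lam_or_lam_nonpos k).imp_right hk.lt_of_le
  obtain ⟨ε₁, hε₁, hd, hda, hdb, hmono⟩ := exists_strictMono_rhs_sub_pk hgap hH1 hQ.1 hQ.2.1
  obtain ⟨T, hT, hanti⟩ := exists_forall_strictAnti hk hH2 hH3 hQ
  obtain ⟨ε₂, hTq, hε₂, hε₂_lt⟩ := ((eventually_lt_add_one_div hsign hd hT).and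
    (Ioo_mem_nhdsGT (sub_pos.2 (max_zero_neg_one_div_lt hsign hd)))).exists
  obtain ⟨haq, hbq, hanti⟩ := hanti (qk k ε₁ ε₂) hTq
  refine ⟨ε₁, ε₂, ⟨hε₁, lt_sub_iff_add_lt'.2 hd.2, hε₂, ?_⟩, ⟨⟨hda, haq⟩, hdb, hbq⟩,
    fun s hs t => ⟨hmono s hs t, hanti s hs t⟩⟩
  rwa [sub_sub]

lemma Suitable.exists_forall_dualI_le (hp : CylContinuous p) (hsmall : SmallAtInfinity p)
    (hC : BelowCk k (a, b)) (hs : Suitable k a b p ε₁ ε₂) :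
    ∃ v₀, ∀ v, dualI k ε₁ ε₂ a b p v ≤ dualI k ε₁ ε₂ a b p v₀ := by
  obtain ⟨δ₁, δ₂, hδ, hδQ, hδpos⟩ := hC.exists_curveFun_pos
  simp only [hs.dualI_eq_dualFun hp hsmall]
  exact exists_forall_dualFun_le hs.1 hs.2.1
    (hδ.curveFun_pos_of_curveFun_pos hs.1 hδQ hs.2.1 hδpos) (hs.dualIntegrand hp hsmall)

lemma BelowCk.lam_pred_lt {x : ℝ × ℝ} (hx : BelowCk k x) : lam (k - 1) < lam k := by
  obtain ⟨ε₁, ε₂, h, -⟩ := hx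
  exact sub_pos.1 (h.1.trans h.2.1)

end Parameters

end

end FucikWave

theorem mainTheorem3 (k : ℤ) (hk : FucikWave.lam k ≠ 0) (a b : ℝ) (p : ℝ → ℝ → ℝ → ℝ)
    (hp_cont : ContinuousOn (fun x : ℝ × ℝ × ℝ => p x.1 x.2.1 x.2.2)
      (Set.Icc (0 : ℝ) Real.pi ×ˢ Set.univ))
    (hp_per : ∀ s ∈ Set.Icc (0 : ℝ) Real.pi, ∀ t u : ℝ, p s (t + 2 * Real.pi) u = p s t u)
    (hp_small : FucikWave.SmallAtInfinity p)
    (hH1 : FucikWave.H1 k a b p) (hH2 : FucikWave.H2 k p) (hH3 : FucikWave.H3 k a b p)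
    (hQ : (a, b) ∈ FucikWave.Qcheck k) (hC : FucikWave.BelowCk k (a, b)) :
    (∃ u : FucikWave.HSpace, FucikWave.IsWeakSolution a b p u) ∧
    (∃ ε₁ ε₂ : ℝ, FucikWave.Suitable k a b p ε₁ ε₂) ∧
    ∀ ε₁ ε₂ : ℝ, FucikWave.Suitable k a b p ε₁ ε₂ →
      (∃ v₀ : FucikWave.HSpace, ∀ v : FucikWave.HSpace,
        FucikWave.dualI k ε₁ ε₂ a b p v ≤ FucikWave.dualI k ε₁ ε₂ a b p v₀) ∧
      ∀ v₀ : FucikWave.HSpace,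
        (∀ v : FucikWave.HSpace,
          FucikWave.dualI k ε₁ ε₂ a b p v ≤ FucikWave.dualI k ε₁ ε₂ a b p v₀) →
        FucikWave.IsWeakSolution a b p (FucikWave.opL (FucikWave.pk k ε₁) v₀) := by
  have hsuitable : ∃ ε₁ ε₂ : ℝ, FucikWave.Suitable k a b p ε₁ ε₂ :=
    FucikWave.exists_suitable hk hC.lam_pred_lt hH1 hH2 hH3 hQ
  obtain ⟨ε₁, ε₂, hs⟩ := hsuitable
  obtain ⟨v₀, hv₀⟩ := hs.exists_forall_dualI_le hp_cont hp_small hC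
  exact ⟨⟨_, hs.isWeakSolution_opL hp_cont hp_small hv₀⟩, ⟨ε₁, ε₂, hs⟩, fun _ _ hs' =>
    ⟨hs'.exists_forall_dualI_le hp_cont hp_small hC,
      fun _ hmax => hs'.isWeakSolution_opL hp_cont hp_small hmax⟩⟩
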